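/- Fix an integer $m\ge 1$, put $n=2m+2$, and fix $\rho>1$. Let $\mathbb A_\rho=\{\lambda\in\mathbb C:1/\rho<|\lambda|<\rho\}$ and let $\mathcal W^{\ge0}_{\mathbb R}$ be the real Banach space of series $f(\lambda)=\sum_{k\ge0}f_k\lambda^k$, $f_k\in\mathbb R$, with norm $\|f\|_\rho=\sum_k|f_k|\rho^k<\infty$; write $f^0=f_0$. For $\mathbf x=(r,a,b,c)\in\mathbb R\times(\mathcal W^{\ge0}_{\mathbb R})^3$ and $t\in\mathbb R$ let $$\eta_t^{\mathbf x}(z,\lambda)=\begin{pmatrix}0&0\\ mrz^{m-1}&0\end{pmatrix}dz+t\sum_{j=0}^{n-1}A_j(\lambda)\frac{dz}{z-p_j},\qquad p_j=e^{2\pi i j/n},$$ where $$A_0(\lambda)=\begin{pmatrix}a(\lambda)&\lambda^{-1}b(\lambda)\\ \lambda c(\lambda)&-a(\lambda)\end{pmatrix},\qquad A_{j+1}(\lambda)=D^{-1}A_j(-\lambda)D,\qquad D=\mathrm{diag}(e^{i\pi m/n},e^{-i\pi m/n}).$$ Let $M(t,\mathbf x)(\lambda)$ be the monodromy, along the counterclockwise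 simple loop $\gamma_0$ based at $0$ given by the petal $R=2\cos(n\theta/2)$, $|\theta|\le\pi/n$ (which encloses $p_0=1$ and no other $p_j$), of the solution of $d\Phi=\Phi\,\eta_t^{\mathbf x}$, $\Phi(z=0)=\mathrm{Id}$. Put $\widetilde M=\frac1t\log M$ for $t\neq0$ (power series of $\log$ at $\mathrm{Id}$) and $\widetilde M(0,\mathbf x)=\partial_tM(t,\mathbf x)|_{t=0}$, and let $f^*(\lambda)=\overline{f(1/\bar\lambda)}$. Consider the equations $$\widetilde M_{11}+\widetilde M_{11}^*=0,\quad \widetilde M_{21}+\widetilde M_{12}^*=0\ \text{ on }\mathbb A_\rho,\quad \widetilde M_{12}(\lambda=1)=\widetilde M_{12}(\lambda=-1)=0,\quad (a^0)^2+b^0c^0=1,\tag{E}$$ and let $\mathbf x_0$ be given by $r=1$, $a=\lambda$, $b=\frac{\lambda^2-1}2$, $c=-2$. 1. There are $\varepsilon>0$, a neighbourhood $U$ of $\mathbf x_0$ and a family $\mathbf x(t)=(r(t),a(t),b(t),c(t))$, smooth on $(-\varepsilon,\varepsilon)$ with $\mathbf x(0)=\mathbf x_0$, such that for every $t\in(-\varepsilon,\varepsilon)$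 the point $\mathbf x(t)$ is the unique solution of (E) at time $t$ in $U$. 2. This family, and indeed every family $\mathbf x(t)$ with $\mathbf x(0)=\mathbf x_0$ that is continuous at $t=0$ and solves (E) for all $t$ near $0$, is smooth at $t=0$ and satisfies, for all $t$ near $0$, with $\eta_t=\eta_t^{\mathbf x(t)}$, $$\eta_{-t}(z,-\lambda)=\eta_t(z,\lambda)\qquad(\lambda\in\mathbb A_\rho,\ z\in\mathbb C\setminus\{p_0,\dots,p_{n-1}\}),$$ and, for $|\lambda|<\rho$, $$a(-t)(-\lambda)=-a(t)(\lambda),\quad b(-t)(-\lambda)=b(t)(\lambda),\quad c(-t)(-\lambda)=c(t)(\lambda),\quad r(-t)=r(t).$$ In particular, for every even $k\ge0$, $\frac{d^k}{dt^k}a(t)\big|_{t=0}$ is an odd function of $\lambda$ and vanishes at $\lambda=0$. 3. The two forms of the parity are equivalent: for every $t\ne0$ and all parameters $\mathbf x=(r,a,b,c)$, $\hat{\mathbf x}=(\hat r,\hat a,\hat b,\hat c)$, one has $\eta^{\hat{\mathbf x}}_{-t}(z,-\lambda)=\eta^{\mathbf x}_t(z,\lambda)$ for all $\lambda\in\mathbb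 A_\rho$ and $z\in\mathbb C\setminus\{p_0,\dots,p_{n-1}\}$ if and only if, for $|\lambda|<\rho$, $\hat a(-\lambda)=-a(\lambda)$, $\hat b(-\lambda)=b(\lambda)$, $\hat c(-\lambda)=c(\lambda)$, and $\hat r=r$. -/

import Mathlib

open scoped ContDiff Topology

namespace DPW

noncomputable section

/-- Real power series `∑ f_k λ^k` with `∑ |f_k| ρ^k < ∞`, as a subspace of all coefficient
sequences. -/
def wSubmodule (ρ : ℝ) [Fact (1 < ρ)] : Submodule ℝ (ℕ → ℝ) where
  carrier := {f | Summable fun k => |f k| * ρ ^ k}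
  zero_mem' := by
    change Summable fun k => |(0 : ℕ → ℝ) k| * ρ ^ k
    simp
  add_mem' := by
    intro f g hf hg
    have hρ : 0 < ρ := lt_trans one_pos (Fact.out : 1 < ρ)
    refine Summable.of_nonneg_of_le (fun k => by positivity) (fun k => ?_) (hf.add hg)
    rw [← add_mul]
    exact mul_le_mul_of_nonneg_right (abs_add_le _ _) (by positivity)
  smul_mem' := by
    intro c f hf
    have h := Summable.mul_left |c| hf
    refine h.congr (fun k => ?_)
    simp [abs_mul, mul_assoc]

/-- The space of loops `f(λ) = ∑_{k ≥ 0} f_k λ^k` with real Fourier coefficients and finite norm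
`‖f‖_ρ = ∑ |f_k| ρ^k`. An element is represented by its coefficient sequence. -/
def W (ρ : ℝ) [Fact (1 < ρ)] : Type := wSubmodule ρ

variable {ρ : ℝ} [Fact (1 < ρ)]

instance : AddCommGroup (W ρ) := inferInstanceAs (AddCommGroup (wSubmodule ρ))

instance : Module ℝ (W ρ) := inferInstanceAs (Module ℝ (wSubmodule ρ))

/-- The `k`-th Fourier coefficient. -/
def W.coeff (f : W ρ) (k : ℕ) : ℝ := f.1 k

instance : Norm (W ρ) := ⟨fun f => ∑' k, |f.coeff k| * ρ ^ k⟩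

theorem W.summable (f : W ρ) : Summable fun k => |f.coeff k| * ρ ^ k := f.2

theorem W.norm_def (f : W ρ) : ‖f‖ = ∑' k, |f.coeff k| * ρ ^ k := rfl

theorem W.coeff_add (f g : W ρ) (k : ℕ) : (f + g).coeff k = f.coeff k + g.coeff k := rfl

theorem W.coeff_smul (c : ℝ) (f : W ρ) (k : ℕ) : (c • f).coeff k = c * f.coeff k := rfl

theorem W.coeff_zero (k : ℕ) : (0 : W ρ).coeff k = 0 := rfl

theorem W.ext {f g : W ρ} (h : ∀ k, f.coeff k = g.coeff k) : f = g :=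
  Subtype.ext (funext h)

theorem W.core : NormedSpace.Core ℝ (W ρ) where
  norm_nonneg f := by
    have hρ : 0 < ρ := lt_trans one_pos (Fact.out : 1 < ρ)
    exact tsum_nonneg fun k => by positivity
  norm_smul c f := by
    rw [W.norm_def, W.norm_def, Real.norm_eq_abs, ← tsum_mul_left]
    refine tsum_congr fun k => ?_
    rw [W.coeff_smul, abs_mul, mul_assoc]
  norm_triangle f g := by
    have hρ : 0 < ρ := lt_trans one_pos (Fact.out : 1 < ρ)
    rw [W.norm_def, W.norm_def, W.norm_def, ← f.summable.tsum_add g.summable]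
    refine Summable.tsum_le_tsum (fun k => ?_) (f + g).summable (f.summable.add g.summable)
    rw [W.coeff_add, ← add_mul]
    exact mul_le_mul_of_nonneg_right (abs_add_le _ _) (by positivity)
  norm_eq_zero_iff f := by
    have hρ : 0 < ρ := lt_trans one_pos (Fact.out : 1 < ρ)
    constructor
    · intro h
      have h0 : HasSum (fun k => |f.coeff k| * ρ ^ k) 0 := by
        have := f.summable.hasSum
        rwa [← W.norm_def, h] at this
      rw [hasSum_zero_iff_of_nonneg (fun k => by positivity)] at h0
      refine W.ext fun k => ?_
      have hk := congrFun h0 k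
      simp only [Pi.zero_apply, mul_eq_zero, abs_eq_zero] at hk
      rcases hk with hk | hk
      · exact hk
      · exact absurd hk (by positivity)
    · rintro rfl
      simp [W.norm_def, W.coeff_zero]

instance : NormedAddCommGroup (W ρ) := NormedAddCommGroup.ofCore W.core

instance : NormedSpace ℝ (W ρ) := NormedSpace.ofCore W.core

/-- The value `f(λ) = ∑ f_k λ^k`, meaningful for `|λ| ≤ ρ`. -/
def W.eval (f : W ρ) (l : ℂ) : ℂ := ∑' k, (f.coeff k : ℂ) * l ^ k

/-- The loop given by a real polynomial in `λ`. -/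
def W.ofPoly (p : Polynomial ℝ) : W ρ :=
  ⟨fun k => p.coeff k, summable_of_ne_finset_zero (s := p.support) (fun k hk => by
    simp [Polynomial.notMem_support_iff.mp hk])⟩

/-- The parameter vector `𝐱 = (r, a, b, c)`. -/
abbrev Param (ρ : ℝ) [Fact (1 < ρ)] : Type := ℝ × W ρ × W ρ × W ρ

def Param.r (x : Param ρ) : ℝ := x.1

def Param.a (x : Param ρ) : W ρ := x.2.1

def Param.b (x : Param ρ) : W ρ := x.2.2.1

def Param.c (x : Param ρ) : W ρ := x.2.2.2

/-- The central value `r = 1`, `a = λ`, `b = (λ² - 1)/2`, `c = -2`. -/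
def Param.central (ρ : ℝ) [Fact (1 < ρ)] : Param ρ :=
  (1, W.ofPoly Polynomial.X,
    W.ofPoly (Polynomial.C (1 / 2) * (Polynomial.X ^ 2 - 1)), W.ofPoly (Polynomial.C (-2)))

/-- The open annulus `1/ρ < |λ| < ρ`. -/
def annulus (ρ : ℝ) : Set ℂ := {l | 1 / ρ < ‖l‖ ∧ ‖l‖ < ρ}

/-- The punctures `p_j = exp(2πij/n)`, `n = 2m+2`. -/
def puncture (m j : ℕ) : ℂ := Complex.exp (2 * Real.pi * Complex.I * j / (2 * m + 2 : ℕ))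

/-- `D = diag(exp(iπm/n), exp(-iπm/n))`, `n = 2m+2`. -/
def symD (m : ℕ) : Matrix (Fin 2) (Fin 2) ℂ :=
  !![Complex.exp (Complex.I * Real.pi * m / (2 * m + 2 : ℕ)), 0;
     0, Complex.exp (-(Complex.I * Real.pi * m / (2 * m + 2 : ℕ)))]

/-- The residues: `A_0 = (a, λ⁻¹b; λc, -a)` and `A_{j+1}(λ) = D⁻¹ A_j(-λ) D`. -/
def residue (m : ℕ) (x : Param ρ) : ℕ → ℂ → Matrix (Fin 2) (Fin 2) ℂ
  | 0, l => !![x.a.eval l, l⁻¹ * x.b.eval l; l * x.c.eval l, -x.a.eval l]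
  | j + 1, l => (symD m)⁻¹ * residue m x j (-l) * symD m

/-- The coefficient of `dz` in the potential `η_t^𝐱(z, λ)`. -/
def potential (m : ℕ) (t : ℝ) (x : Param ρ) (z l : ℂ) : Matrix (Fin 2) (Fin 2) ℂ :=
  !![0, 0; (m : ℂ) * x.r * z ^ (m - 1), 0] +
    (t : ℂ) • ∑ j ∈ Finset.range (2 * m + 2), (z - puncture m j)⁻¹ • residue m x j l

/-- The loop `γ_0(s)`, `0 ≤ s ≤ 1`, based at `0`: the petal with polar equation
`R = 2 cos(nθ/2)`, `-π/n ≤ θ ≤ π/n`, `n = 2m+2`, traversed counterclockwise. It is a simple closed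
curve enclosing the puncture `p_0 = 1` and no other puncture. -/
def loop (m : ℕ) (s : ℝ) : ℂ :=
  2 * Real.sin (Real.pi * s) *
    Complex.exp (Complex.I * Real.pi * (2 * s - 1) / (2 * m + 2 : ℕ))

/-- `Y` is the continuation along `γ_0` of the solution of `dΦ = Φ η_t^𝐱`, `Φ(0) = Id`
(for one fixed `λ`), i.e. `Y(s) = Φ(γ_0(s))`; the ODE is written entrywise. -/
def IsSolutionAlongLoop (m : ℕ) (t : ℝ) (x : Param ρ) (l : ℂ)
    (Y : ℝ → Matrix (Fin 2) (Fin 2) ℂ) : Prop :=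
  Y 0 = 1 ∧ ∀ s ∈ Set.Icc (0 : ℝ) 1, ∀ i j,
    HasDerivWithinAt (fun u => Y u i j)
      ((Y s * (deriv (loop m) s • potential m t x (loop m s) l)) i j) (Set.Icc 0 1) s

open Classical in
/-- The monodromy `M(t)(λ)` along `γ_0` of the solution of `dΦ = Φ η_t^𝐱`, `Φ(0) = Id`: the
value at the end point of `γ_0` of the solution continued along `γ_0`. -/
def monodromy (m : ℕ) (t : ℝ) (x : Param ρ) (l : ℂ) : Matrix (Fin 2) (Fin 2) ℂ :=
  if h : ∃ Y, IsSolutionAlongLoop m t x l Y then h.choose 1 else 1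

/-- The logarithm near the identity, by its power series. -/
def matrixLog (X : Matrix (Fin 2) (Fin 2) ℂ) : Matrix (Fin 2) (Fin 2) ℂ :=
  ∑' k : ℕ, ((-1 : ℂ) ^ k / (k + 1)) • (X - 1) ^ (k + 1)

/-- `M̃(t) = t⁻¹ log M(t)`, extended to `t = 0` by `M̃(0) = M'(0)`. -/
def logMonodromy (m : ℕ) (t : ℝ) (x : Param ρ) (l : ℂ) : Matrix (Fin 2) (Fin 2) ℂ :=
  if t = 0 then Matrix.of fun i j => deriv (fun s : ℝ => monodromy m s x l i j) 0
  else (t : ℂ)⁻¹ • matrixLog (monodromy m t x l)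

/-- The involution `f*(λ) = conj (f (1 / conj λ))`. -/
def starInv (f : ℂ → ℂ) (l : ℂ) : ℂ := starRingEnd ℂ (f (1 / starRingEnd ℂ l))

def calF (m : ℕ) (t : ℝ) (x : Param ρ) (l : ℂ) : ℂ :=
  1 / (2 * Real.pi * Complex.I) *
    (logMonodromy m t x l 0 0 + starInv (fun u => logMonodromy m t x u 0 0) l)

def calG (m : ℕ) (t : ℝ) (x : Param ρ) (l : ℂ) : ℂ :=
  1 / (2 * Real.pi * Complex.I) *
    (logMonodromy m t x l 1 0 + starInv (fun u => logMonodromy m t x u 0 1) l)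

def calH₁ (m : ℕ) (t : ℝ) (x : Param ρ) : ℂ :=
  1 / (2 * Real.pi * Complex.I) * logMonodromy m t x 1 0 1

def calH₂ (m : ℕ) (t : ℝ) (x : Param ρ) : ℂ :=
  1 / (2 * Real.pi * Complex.I) * logMonodromy m t x (-1) 0 1

/-- `-det A_0` at `λ = 0`, that is `(a⁰)² + b⁰c⁰`. -/
def calK (x : Param ρ) : ℝ := x.a.coeff 0 ^ 2 + x.b.coeff 0 * x.c.coeff 0

/-- The equations of the monodromy problem: `F = 0`, `G = 0` (as loops), `H₁ = H₂ = 0`, `K = 1`. -/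
def SolvesMonodromyProblem (m : ℕ) (t : ℝ) (x : Param ρ) : Prop :=
  (∀ l ∈ annulus ρ, calF m t x l = 0) ∧ (∀ l ∈ annulus ρ, calG m t x l = 0) ∧
    calH₁ m t x = 0 ∧ calH₂ m t x = 0 ∧ calK x = 1

/-- A family `𝐱(t)` through the central value at `t = 0`, continuous there, that solves the
monodromy problem for all `t` close to `0`. -/
def IsSolutionFamily (m : ℕ) (x : ℝ → Param ρ) : Prop :=
  x 0 = Param.central ρ ∧ ContinuousAt x 0 ∧ ∀ᶠ t in 𝓝 (0 : ℝ), SolvesMonodromyProblem m t (x t)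

/-- `η_{-t}^𝐲(z, -λ) = η_t^𝐱(z, λ)` for all `λ` in the annulus and all `z` off the punctures. -/
def PotentialParity (m : ℕ) (t : ℝ) (x y : Param ρ) : Prop :=
  ∀ l ∈ annulus ρ, ∀ z : ℂ, (∀ j < 2 * m + 2, z ≠ puncture m j) →
    potential m (-t) y z (-l) = potential m t x z l

/-- With `𝐱 = (r, a, b, c)` and `𝐲 = (r̂, â, b̂, ĉ)`: `â(-λ) = -a(λ)`, `b̂(-λ) = b(λ)`,
`ĉ(-λ) = c(λ)`, `r̂ = r`. -/
def ParamParity (x y : Param ρ) : Prop :=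
  (∀ l : ℂ, ‖l‖ < ρ → y.a.eval (-l) = -x.a.eval l) ∧
  (∀ l : ℂ, ‖l‖ < ρ → y.b.eval (-l) = x.b.eval l) ∧
  (∀ l : ℂ, ‖l‖ < ρ → y.c.eval (-l) = x.c.eval l) ∧
  y.r = x.r

end

end DPW

open DPW

/-!
Loops in `λ` are treated as elements of the two-sided Wiener algebra of Laurent series `∑ v_k λ^k`
with `∑ |v_k| ρ^|k| < ∞`. Gauging `η_t` by the explicit solution `(1, 0; r z^m, 1)` of the equation
at `t = 0` leaves an equation whose coefficient is `t` times a polynomial in `𝐱`; its Neumann series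
shows that the monodromy is `1 + t Q(t, 𝐱)` with `Q` analytic, so `M̃ = t⁻¹ log M` extends
analytically through `t = 0`. At `t = 0` it is `2πi` times the residue at `p_0 = 1` of the gauged
form, an explicit polynomial in `𝐱`.

Conjugation reverses `γ_0`, so `M̃ / 2πi` has real coefficients in `λ`. Splitting the unitarity
conditions into powers of `λ` of either sign turns the equations into the zero set of one analytic
map between real Banach spaces, whose derivative in `𝐱` at the central value is a finite invertible
matrix on the low-order coefficients and the identity, up to signs and triangular terms, on the
others. The implicit function theorem gives the family.

The potential is unchanged when `(t, λ)` is replaced by `(-t, -λ)` and `𝐱` by its parity, so the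
parity of a solution at time `-t` is a solution at time `t`, and local uniqueness gives
`𝐱(-t) = parity (𝐱(t))`. Conversely the residue of the potential at `p_0` and its remaining
`z^(m-1)` part recover `𝐱`.
-/

namespace DPW

noncomputable section

variable {ρ : ℝ} [Fact (1 < ρ)]

section Annulus

theorem radius_pos : 0 < ρ := one_pos.trans Fact.out

theorem one_le_radius : 1 ≤ ρ := (Fact.out : 1 < ρ).le

theorem radius_pow_nonneg (k : ℕ) : 0 ≤ ρ ^ k := pow_nonneg radius_pos.le k

theorem ofReal_radius_pow_ne_zero (k : ℕ) : (ρ : ℂ) ^ k ≠ 0 :=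
  pow_ne_zero k (Complex.ofReal_ne_zero.mpr radius_pos.ne')

theorem norm_ofReal_radius_pow (k : ℕ) : ‖(ρ : ℂ) ^ k‖ = ρ ^ k := by
  rw [norm_pow, Complex.norm_of_nonneg radius_pos.le]

theorem mem_annulus_of_norm_eq_one {l : ℂ} (hl : ‖l‖ = 1) : l ∈ annulus ρ := by
  have hρ : 1 < ρ := Fact.out
  exact ⟨by rwa [hl, div_lt_one radius_pos], by rwa [hl]⟩

theorem norm_pos_of_mem_annulus {l : ℂ} (hl : l ∈ annulus ρ) : 0 < ‖l‖ :=
  (one_div_pos.mpr radius_pos).trans hl.1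

theorem ne_zero_of_mem_annulus {l : ℂ} (hl : l ∈ annulus ρ) : l ≠ 0 :=
  norm_pos_iff.mp (norm_pos_of_mem_annulus hl)

theorem inv_mem_annulus {l : ℂ} (hl : l ∈ annulus ρ) : l⁻¹ ∈ annulus ρ := by
  have h0 := norm_pos_of_mem_annulus hl
  refine ⟨?_, ?_⟩
  · rw [norm_inv, one_div]
    exact inv_strictAnti₀ h0 hl.2
  · rw [norm_inv, inv_lt_comm₀ h0 radius_pos, ← one_div]
    exact hl.1

theorem neg_mem_annulus {ρ : ℝ} {l : ℂ} (hl : l ∈ annulus ρ) : -l ∈ annulus ρ := by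
  simpa only [annulus, Set.mem_ofPred_eq, norm_neg] using hl

theorem conj_mem_annulus {ρ : ℝ} {l : ℂ} (hl : l ∈ annulus ρ) : starRingEnd ℂ l ∈ annulus ρ := by
  simpa only [annulus, Set.mem_ofPred_eq, RCLike.norm_conj] using hl

theorem norm_zpow_le_of_mem_annulus {l : ℂ} (hl : l ∈ annulus ρ) (k : ℤ) :
    ‖l ^ k‖ ≤ ρ ^ k.natAbs := by
  obtain ⟨n, rfl | rfl⟩ := k.eq_nat_or_neg
  · rw [zpow_natCast, norm_pow, Int.natAbs_natCast]
    exact pow_le_pow_left₀ (norm_nonneg l) hl.2.le n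
  · rw [zpow_neg, ← inv_zpow, zpow_natCast, norm_pow, Int.natAbs_neg, Int.natAbs_natCast]
    exact pow_le_pow_left₀ (norm_nonneg _) (inv_mem_annulus hl).2.le n

end Annulus

section Fourier

/-- The Fourier coefficients are recovered from the uniformly convergent series by pairing with
the orthonormal system `fourier k` in `L²`. -/
theorem eq_zero_of_tsum_smul_fourier_eq_zero {T : ℝ} [Fact (0 < T)] {c : ℤ → ℂ}
    (hc : Summable fun k => ‖c k‖)
    (h : ∑' k, c k • (fourier k : C(AddCircle T, ℂ)) = 0) (k : ℤ) : c k = 0 := by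
  have hsum : Summable fun k => c k • (fourier k : C(AddCircle T, ℂ)) :=
    Summable.of_norm (by simpa only [norm_smul, fourier_norm, mul_one] using hc)
  have hpair := ((h ▸ hsum.hasSum).mapL (ContinuousMap.toLp (E := ℂ) 2
    AddCircle.haarAddCircle ℂ)).mapL (innerSL ℂ (fourierLp (T := T) 2 k))
  simp only [map_smul, map_zero, innerSL_apply_apply, smul_eq_mul] at hpair
  have hδ := orthonormal_iff_ite.mp (orthonormal_fourier (T := T)) k
  refine HasSum.unique (hasSum_ite_eq k (c k)) (hpair.congr_fun fun j => ?_)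
  rw [hδ j, mul_ite, mul_one, mul_zero]
  split_ifs with hkj hjk hjk
  · rw [hkj]
  · exact absurd hkj.symm hjk
  · exact absurd hjk.symm hkj
  · rfl

theorem eq_zero_of_tsum_mul_zpow_eq_zero {c : ℤ → ℂ} (hc : Summable fun k => ‖c k‖)
    (h : ∀ z : ℂ, ‖z‖ = 1 → ∑' k, c k * z ^ k = 0) (k : ℤ) : c k = 0 := by
  have : Fact (0 < (1 : ℝ)) := ⟨one_pos⟩
  refine eq_zero_of_tsum_smul_fourier_eq_zero (T := 1) hc (ContinuousMap.ext fun x => ?_) k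
  have hsum : Summable fun k => c k • (fourier k : C(AddCircle (1 : ℝ), ℂ)) :=
    Summable.of_norm (by simpa only [norm_smul, fourier_norm, mul_one] using hc)
  rw [← ContinuousMap.tsum_apply hsum, ContinuousMap.zero_apply,
    ← h (AddCircle.toCircle x) (Circle.norm_coe _)]
  refine tsum_congr fun j => ?_
  rw [ContinuousMap.smul_apply, smul_eq_mul, fourier_apply, AddCircle.toCircle_zsmul,
    Circle.coe_zpow]

end Fourier

/-- The two-sided Wiener algebra of Laurent series `∑ v_k λ^k` with `∑ |v_k| ρ^|k| < ∞`, encoded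
by the `ℓ¹` sequence `v_k ρ^|k|`. All loops of the problem live in it. -/
def Laurent (ρ : ℝ) [Fact (1 < ρ)] : Type := lp (fun _ : ℤ => ℂ) 1

namespace Laurent

instance : NormedAddCommGroup (Laurent ρ) :=
  inferInstanceAs (NormedAddCommGroup (lp (fun _ : ℤ => ℂ) 1))

instance : NormedSpace ℂ (Laurent ρ) := inferInstanceAs (NormedSpace ℂ (lp (fun _ : ℤ => ℂ) 1))

instance : CompleteSpace (Laurent ρ) := inferInstanceAs (CompleteSpace (lp (fun _ : ℤ => ℂ) 1))

/-- The monomial `λ^k`. -/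
def T (k : ℤ) : Laurent ρ := lp.single (E := fun _ : ℤ => ℂ) 1 k ((ρ : ℂ) ^ k.natAbs)

/-- The coefficient of `λ^k`. -/
def coeff (k : ℤ) : Laurent ρ →L[ℂ] ℂ :=
  ((ρ : ℂ) ^ k.natAbs)⁻¹ • lp.evalCLM ℂ (fun _ : ℤ => ℂ) 1 k

theorem coeff_real_smul (k : ℤ) (c : ℝ) (v : Laurent ρ) : coeff k (c • v) = c * coeff k v :=
  map_real_smul (coeff k) (coeff k).continuous c v

theorem radius_pow_mul_coeff (k : ℤ) (v : Laurent ρ) :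
    (ρ : ℂ) ^ k.natAbs * coeff k v = (v : lp (fun _ : ℤ => ℂ) 1).1 k :=
  mul_inv_cancel_left₀ (ofReal_radius_pow_ne_zero _) _

theorem coeff_T (j k : ℤ) : coeff k (T j : Laurent ρ) = if k = j then 1 else 0 := by
  refine mul_left_cancel₀ (ofReal_radius_pow_ne_zero (ρ := ρ) k.natAbs) ?_
  rw [radius_pow_mul_coeff]
  change (lp.single (E := fun _ : ℤ => ℂ) 1 j ((ρ : ℂ) ^ j.natAbs)).1 k = _
  rw [lp.coeFn_single]
  split_ifs with h
  · rw [h, Pi.single_eq_same, mul_one]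
  · rw [Pi.single_eq_of_ne h, mul_zero]

theorem hasSum_norm (v : Laurent ρ) :
    HasSum (fun k : ℤ => ‖coeff k v‖ * ρ ^ k.natAbs) ‖v‖ := by
  have h := lp.hasSum_norm (p := 1) (by simp) (v : lp (fun _ : ℤ => ℂ) 1)
  simp only [ENNReal.toReal_one, Real.rpow_one] at h
  refine h.congr_fun fun k => ?_
  rw [← radius_pow_mul_coeff, norm_mul, norm_ofReal_radius_pow, mul_comm]

theorem hasSum_T (v : Laurent ρ) : HasSum (fun k : ℤ => coeff k v • (T k : Laurent ρ)) v := by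
  have h := lp.hasSum_single (p := 1) (by simp) (v : lp (fun _ : ℤ => ℂ) 1)
  refine h.congr_fun fun k => ?_
  rw [← radius_pow_mul_coeff, mul_comm, ← smul_eq_mul]
  exact (lp.single_smul (E := fun _ : ℤ => ℂ) 1 k (coeff k v) ((ρ : ℂ) ^ k.natAbs)).symm

theorem norm_T (k : ℤ) : ‖(T k : Laurent ρ)‖ = ρ ^ k.natAbs :=
  (lp.norm_single (E := fun _ : ℤ => ℂ) (p := 1) one_pos k _).trans (norm_ofReal_radius_pow _)

@[ext]
theorem ext {v w : Laurent ρ} (h : ∀ k, coeff k v = coeff k w) : v = w := by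
  have hw := hasSum_T w
  simp only [← h] at hw
  exact (hasSum_T v).unique hw

theorem clm_ext {F : Type*} [AddCommMonoid F] [Module ℂ F] [TopologicalSpace F] [T2Space F]
    {f g : Laurent ρ →L[ℂ] F} (h : ∀ k, f (T k) = g (T k)) : f = g := by
  refine ContinuousLinearMap.ext fun v => ?_
  have hf := (hasSum_T v).mapL f
  have hg := (hasSum_T v).mapL g
  simp only [map_smul, h] at hf hg
  exact hf.unique hg

section lift

variable {E : Type*} [NormedAddCommGroup E] [NormedSpace ℂ E]
  (u : ℤ → E) (C : ℝ) (hu : ∀ k, ‖u k‖ ≤ C * ρ ^ k.natAbs)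

include hu in
theorem norm_coeff_smul_le (v : Laurent ρ) (k : ℤ) :
    ‖coeff k v • u k‖ ≤ C * (‖coeff k v‖ * ρ ^ k.natAbs) := by
  rw [norm_smul, mul_left_comm]
  exact mul_le_mul_of_nonneg_left (hu k) (norm_nonneg _)

variable [CompleteSpace E]

include hu in
theorem summable_coeff_smul (v : Laurent ρ) : Summable fun k => coeff k v • u k :=
  Summable.of_norm_bounded ((hasSum_norm v).summable.mul_left C) (norm_coeff_smul_le u C hu v)

/-- The continuous linear map with prescribed values `u k` on the monomials `T k`. -/
def lift : Laurent ρ →L[ℂ] E :=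
  LinearMap.mkContinuous
    { toFun := fun v => ∑' k, coeff k v • u k
      map_add' := fun v w => by
        simp only [map_add, add_smul]
        exact (summable_coeff_smul u C hu v).tsum_add (summable_coeff_smul u C hu w)
      map_smul' := fun c v => by
        simp only [map_smul, smul_assoc, RingHom.id_apply]
        exact (summable_coeff_smul u C hu v).tsum_const_smul c } C
    (fun v => tsum_of_norm_bounded ((hasSum_norm v).mul_left C) (norm_coeff_smul_le u C hu v))

theorem lift_apply (v : Laurent ρ) : lift u C hu v = ∑' k, coeff k v • u k := rfl

@[simp]
theorem lift_T (k : ℤ) : lift u C hu (T k : Laurent ρ) = u k := by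
  rw [lift_apply, tsum_eq_single k fun j hj => by rw [coeff_T, if_neg hj, zero_smul], coeff_T,
    if_pos rfl, one_smul]

theorem norm_lift_le (hC : 0 ≤ C) : ‖lift u C hu‖ ≤ C :=
  LinearMap.mkContinuous_norm_le _ hC _

end lift

/-- Multiplication by `λ^j`. -/
def shift (j : ℤ) : Laurent ρ →L[ℂ] Laurent ρ :=
  lift (fun k => T (j + k)) (ρ ^ j.natAbs) fun k => by
    rw [norm_T, ← pow_add]
    exact pow_le_pow_right₀ one_le_radius (Int.natAbs_add_le j k)

/-- Multiplication of Laurent series, as a continuous bilinear map. -/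
def mulL : Laurent ρ →L[ℂ] Laurent ρ →L[ℂ] Laurent ρ :=
  lift shift 1 fun k => by
    rw [one_mul]
    exact norm_lift_le _ _ _ (radius_pow_nonneg _)

theorem mulL_T_T (j k : ℤ) : mulL (T j) (T k : Laurent ρ) = T (j + k) := by
  simp only [mulL, shift, lift_T]

theorem mulL_comm (v w : Laurent ρ) : mulL v w = mulL w v := by
  have : (mulL : Laurent ρ →L[ℂ] _) = mulL.flip :=
    clm_ext fun j => clm_ext fun k => by
      rw [ContinuousLinearMap.flip_apply, mulL_T_T, mulL_T_T, add_comm]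
  exact DFunLike.congr_fun (DFunLike.congr_fun this v) w

theorem one_mulL (v : Laurent ρ) : mulL (T 0) v = v := by
  have : mulL (T 0) = ContinuousLinearMap.id ℂ (Laurent ρ) :=
    clm_ext fun k => by rw [mulL_T_T, zero_add, ContinuousLinearMap.id_apply]
  rw [this, ContinuousLinearMap.id_apply]

theorem mulL_assoc (u v w : Laurent ρ) : mulL (mulL u v) w = mulL u (mulL v w) := by
  have hT (i j : ℤ) : mulL (mulL (T i) (T j)) = (mulL (T i)).comp (mulL (T j : Laurent ρ)) :=
    clm_ext fun k => by
      rw [ContinuousLinearMap.comp_apply, mulL_T_T, mulL_T_T, mulL_T_T, mulL_T_T, add_assoc]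
  have hTv (i : ℤ) : mulL.comp (mulL (T i)) =
      (ContinuousLinearMap.compL ℂ (Laurent ρ) _ _ (mulL (T i))).comp (mulL (ρ := ρ)) :=
    clm_ext fun j => hT i j
  have huv : mulL.comp (mulL.flip v) =
      ((ContinuousLinearMap.compL ℂ (Laurent ρ) _ _).flip (mulL v)).comp (mulL (ρ := ρ)) :=
    clm_ext fun i => DFunLike.congr_fun (hTv i) v
  exact DFunLike.congr_fun (DFunLike.congr_fun huv u) w

instance : NormedCommRing (Laurent ρ) where
  __ := (inferInstance : NormedAddCommGroup (Laurent ρ))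
  mul v w := mulL v w
  one := T 0
  left_distrib u v w := map_add (mulL u) v w
  right_distrib u v w := DFunLike.congr_fun (map_add mulL u v) w
  zero_mul v := DFunLike.congr_fun (map_zero mulL) v
  mul_zero v := map_zero (mulL v)
  mul_assoc := mulL_assoc
  one_mul := one_mulL
  mul_one v := (mulL_comm _ _).trans (one_mulL v)
  mul_comm := mulL_comm
  norm_mul_le v w := by
    refine (mulL.le_opNorm₂ v w).trans (mul_le_mul_of_nonneg_right ?_ (norm_nonneg w))
    exact mul_le_of_le_one_left (norm_nonneg v) (norm_lift_le _ _ _ zero_le_one)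

instance : NormedAlgebra ℂ (Laurent ρ) where
  __ := Algebra.ofModule (fun c v w => DFunLike.congr_fun (map_smul mulL c v) w)
    (fun c v w => map_smul (mulL v) c w)
  norm_smul_le c v := norm_smul_le c v

theorem one_eq_T : (1 : Laurent ρ) = T 0 := rfl

theorem coeff_T_mul (j k : ℤ) (v : Laurent ρ) : coeff k (T j * v) = coeff (k - j) v := by
  have : (coeff k).comp (mulL (T j : Laurent ρ)) = coeff (k - j) :=
    clm_ext fun i => by
      rw [ContinuousLinearMap.comp_apply, mulL_T_T, coeff_T, coeff_T]
      exact if_congr (by omega) rfl rfl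
  exact DFunLike.congr_fun this v

/-- The substitution `λ ↦ 1/λ`. -/
def substInv : Laurent ρ →L[ℂ] Laurent ρ :=
  lift (fun k => T (-k)) 1 fun k => by rw [norm_T, one_mul, Int.natAbs_neg]

theorem coeff_substInv (k : ℤ) (v : Laurent ρ) : coeff k (substInv v) = coeff (-k) v := by
  have : (coeff k).comp (substInv : Laurent ρ →L[ℂ] _) = coeff (-k) :=
    clm_ext fun j => by
      rw [ContinuousLinearMap.comp_apply, substInv, lift_T, coeff_T, coeff_T]
      exact if_congr (by omega) rfl rfl
  exact DFunLike.congr_fun this v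

/-- The substitution `λ ↦ -λ`. -/
def substNeg : Laurent ρ →L[ℂ] Laurent ρ :=
  lift (fun k => (-1 : ℂ) ^ k • T k) 1 fun k => by
    rw [norm_smul, norm_T, norm_zpow, norm_neg, norm_one, one_zpow]

theorem coeff_substNeg (k : ℤ) (v : Laurent ρ) :
    coeff k (substNeg v) = (-1) ^ k * coeff k v := by
  have : (coeff k).comp (substNeg : Laurent ρ →L[ℂ] _) = (-1 : ℂ) ^ k • coeff k :=
    clm_ext fun j => by
      rw [ContinuousLinearMap.comp_apply, substNeg, lift_T, map_smul,
        smul_apply, coeff_T]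
      split_ifs with h
      · rw [h]
      · rw [smul_zero, smul_zero]
  exact DFunLike.congr_fun this v

section eval

variable {l : ℂ} (hl : l ∈ annulus ρ)

/-- Evaluation of Laurent series at a point of the annulus. -/
def eval : Laurent ρ →A[ℂ] ℂ :=
  let φ : Laurent ρ →L[ℂ] ℂ := lift (fun k => l ^ k) 1 (fun k => by
    rw [one_mul]
    exact norm_zpow_le_of_mem_annulus hl k)
  have φ_T (k : ℤ) : φ (T k) = l ^ k := lift_T _ _ _ k
  { AlgHom.ofLinearMap φ.toLinearMap ((φ_T 0).trans (zpow_zero l))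
      (fun v w => by
        have hT (j : ℤ) : φ.comp (mulL (T j)) = l ^ j • φ := clm_ext fun k => by
          rw [ContinuousLinearMap.comp_apply, mulL_T_T, smul_apply, φ_T, φ_T,
            zpow_add₀ (ne_zero_of_mem_annulus hl), smul_eq_mul]
        have hw : φ.comp (mulL.flip w) = φ w • φ := clm_ext fun j => by
          rw [smul_apply, φ_T, smul_eq_mul, mul_comm]
          exact DFunLike.congr_fun (hT j) w
        exact (DFunLike.congr_fun hw v).trans (mul_comm _ _)) with
    cont := φ.continuous }

theorem eval_eq_tsum (v : Laurent ρ) : eval hl v = ∑' k, coeff k v * l ^ k := rfl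

theorem eval_T (k : ℤ) : eval hl (T k) = l ^ k := by
  rw [eval_eq_tsum, tsum_eq_single k fun j hj => by rw [coeff_T, if_neg hj, zero_mul], coeff_T,
    if_pos rfl, one_mul]

theorem eval_real_smul (c : ℝ) (v : Laurent ρ) : eval hl (c • v) = c * eval hl v :=
  map_real_smul (eval hl) (eval hl).continuous c v

theorem norm_eval_le (v : Laurent ρ) : ‖eval hl v‖ ≤ ‖v‖ := by
  rw [eval_eq_tsum]
  refine tsum_of_norm_bounded (hasSum_norm v) fun k => ?_
  rw [norm_mul]
  exact mul_le_mul_of_nonneg_left (norm_zpow_le_of_mem_annulus hl k) (norm_nonneg _)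

theorem eval_substInv (v : Laurent ρ) : eval hl (substInv v) = eval (inv_mem_annulus hl) v := by
  have : (eval hl).toContinuousLinearMap.comp substInv =
      (eval (inv_mem_annulus hl)).toContinuousLinearMap :=
    clm_ext fun k => by
      change eval hl (substInv (T k)) = eval (inv_mem_annulus hl) (T k)
      rw [substInv, lift_T, eval_T, eval_T, inv_zpow']
  exact DFunLike.congr_fun this v

end eval

theorem summable_norm_coeff (v : Laurent ρ) : Summable fun k => ‖coeff k v‖ :=
  Summable.of_nonneg_of_le (fun _ => norm_nonneg _)
    (fun _ => le_mul_of_one_le_right (norm_nonneg _) (one_le_pow₀ one_le_radius))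
    (hasSum_norm v).summable

theorem eq_zero_of_eval_eq_zero {v : Laurent ρ} (h : ∀ l (hl : l ∈ annulus ρ), eval hl v = 0) :
    v = 0 := by
  refine ext fun k => ?_
  rw [map_zero]
  exact eq_zero_of_tsum_mul_zpow_eq_zero (summable_norm_coeff v)
    (fun z hz => h z (mem_annulus_of_norm_eq_one hz)) k

theorem conj_eval_conj {l : ℂ} (hl : l ∈ annulus ρ) (v : Laurent ρ) :
    starRingEnd ℂ (eval (conj_mem_annulus hl) v) = ∑' k, starRingEnd ℂ (coeff k v) * l ^ k := by
  rw [eval_eq_tsum, Complex.conj_tsum]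
  refine tsum_congr fun k => ?_
  rw [map_mul, map_zpow₀, Complex.conj_conj]

theorem conj_coeff_of_conj_eval_conj {v : Laurent ρ}
    (h : ∀ l (hl : l ∈ annulus ρ), starRingEnd ℂ (eval (conj_mem_annulus hl) v) = eval hl v)
    (k : ℤ) : starRingEnd ℂ (coeff k v) = coeff k v := by
  have hs : Summable fun k => ‖starRingEnd ℂ (coeff k v)‖ := by
    simpa only [RCLike.norm_conj] using summable_norm_coeff v
  refine sub_eq_zero.mp (eq_zero_of_tsum_mul_zpow_eq_zero
    (c := fun k => starRingEnd ℂ (coeff k v) - coeff k v) ?_ (fun z hz => ?_) k)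
  · exact (hs.add (summable_norm_coeff v)).of_nonneg_of_le (fun _ => norm_nonneg _)
      fun k => norm_sub_le _ _
  · have hz' := mem_annulus_of_norm_eq_one (ρ := ρ) hz
    have hmul {c : ℤ → ℂ} (hc : Summable fun k => ‖c k‖) : Summable fun k => c k * z ^ k :=
      Summable.of_norm (by simpa only [norm_mul, norm_zpow, hz, one_zpow, mul_one] using hc)
    simp only [sub_mul]
    rw [(hmul hs).tsum_sub (hmul (summable_norm_coeff v)), ← conj_eval_conj hz', h z hz',
      eval_eq_tsum, sub_self]

end Laurent

namespace W

theorem norm_coeff_smul_T (f : W ρ) (k : ℕ) :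
    ‖f.coeff k • (Laurent.T k : Laurent ρ)‖ = |f.coeff k| * ρ ^ k := by
  rw [norm_smul, Laurent.norm_T, Int.natAbs_natCast, Real.norm_eq_abs]

theorem summable_coeff_smul_T (f : W ρ) :
    Summable fun k : ℕ => f.coeff k • (Laurent.T k : Laurent ρ) :=
  Summable.of_norm (f.summable.congr fun k => (norm_coeff_smul_T f k).symm)

/-- The inclusion of power series into Laurent series. -/
def toLaurent : W ρ →L[ℝ] Laurent ρ :=
  LinearMap.mkContinuous
    { toFun := fun f => ∑' k : ℕ, f.coeff k • (Laurent.T k : Laurent ρ)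
      map_add' := fun f g => by
        simp only [W.coeff_add, add_smul]
        exact (summable_coeff_smul_T f).tsum_add (summable_coeff_smul_T g)
      map_smul' := fun c f => by
        simp only [W.coeff_smul, mul_smul, RingHom.id_apply]
        exact (summable_coeff_smul_T f).tsum_const_smul c } 1
    fun f => (tsum_of_norm_bounded f.summable.hasSum fun k => (norm_coeff_smul_T f k).le).trans_eq
      (one_mul _).symm

theorem hasSum_toLaurent (f : W ρ) :
    HasSum (fun k : ℕ => f.coeff k • (Laurent.T k : Laurent ρ)) (toLaurent f) :=
  (summable_coeff_smul_T f).hasSum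

theorem coeff_toLaurent (f : W ρ) (j : ℤ) :
    Laurent.coeff j (toLaurent f) = if 0 ≤ j then (f.coeff j.toNat : ℂ) else 0 := by
  have h := (hasSum_toLaurent f).mapL ((Laurent.coeff j).restrictScalars ℝ)
  simp only [ContinuousLinearMap.coe_restrictScalars', Laurent.coeff_real_smul,
    Laurent.coeff_T] at h
  split_ifs with hj
  · refine h.unique ?_
    convert hasSum_single j.toNat fun k hk => ?_ using 1
    · rw [if_pos (Int.toNat_of_nonneg hj).symm, mul_one]
    · rw [if_neg (by omega), mul_zero]
  · refine h.unique (hasSum_zero.congr_fun fun k => ?_)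
    rw [if_neg (by omega), mul_zero]

theorem coeff_natCast_toLaurent (f : W ρ) (k : ℕ) :
    Laurent.coeff (k : ℤ) (toLaurent f) = f.coeff k := by
  rw [coeff_toLaurent, if_pos (Int.natCast_nonneg k), Int.toNat_natCast]

/-- The `k`-th coefficient as a continuous linear functional. -/
def coeffL (k : ℕ) : W ρ →L[ℝ] ℝ :=
  Complex.reCLM ∘L (Laurent.coeff (k : ℤ)).restrictScalars ℝ ∘L toLaurent

theorem coeffL_apply (k : ℕ) (f : W ρ) : coeffL k f = f.coeff k :=
  congrArg Complex.re (coeff_natCast_toLaurent f k)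

theorem coeff_neg (f : W ρ) (k : ℕ) : (-f).coeff k = -f.coeff k := by
  rw [← coeffL_apply, map_neg, coeffL_apply]

theorem coeff_toLaurent_of_neg (f : W ρ) {j : ℤ} (hj : j < 0) :
    Laurent.coeff j (toLaurent f) = 0 := by
  rw [coeff_toLaurent, if_neg (not_le.mpr hj)]

theorem eval_toLaurent {l : ℂ} (hl : l ∈ annulus ρ) (f : W ρ) :
    Laurent.eval hl (toLaurent f) = f.eval l := by
  have h := (hasSum_toLaurent f).mapL ((Laurent.eval hl).toContinuousLinearMap.restrictScalars ℝ)
  refine (h.congr_fun fun k => ?_).tsum_eq.symm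
  change _ = Laurent.eval hl (f.coeff k • Laurent.T k)
  rw [Laurent.eval_real_smul, Laurent.eval_T, zpow_natCast]

theorem eq_of_eval_eq_on_annulus {f g : W ρ} (h : ∀ l ∈ annulus ρ, f.eval l = g.eval l) :
    f = g := by
  have h0 : toLaurent f - toLaurent g = 0 := Laurent.eq_zero_of_eval_eq_zero fun l hl => by
    rw [map_sub, eval_toLaurent, eval_toLaurent, h l hl, sub_self]
  refine W.ext fun k => Complex.ofReal_injective ?_
  rw [← coeff_natCast_toLaurent, sub_eq_zero.mp h0, coeff_natCast_toLaurent]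

theorem summable_nonnegPart (v : Laurent ρ) :
    Summable fun k : ℕ => |(Laurent.coeff (k : ℤ) v).re| * ρ ^ k :=
  ((Laurent.hasSum_norm v).summable.comp_injective Nat.cast_injective).of_nonneg_of_le
    (fun k => mul_nonneg (abs_nonneg _) (radius_pow_nonneg k))
    (fun k => mul_le_mul_of_nonneg_right (Complex.abs_re_le_norm _) (radius_pow_nonneg k))

/-- The projection `∑ v_k λ^k ↦ ∑_{k ≥ 0} Re(v_k) λ^k`. -/
def nonnegPart : Laurent ρ →L[ℝ] W ρ :=
  LinearMap.mkContinuous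
    { toFun := fun v => (⟨fun k => (Laurent.coeff (k : ℤ) v).re, summable_nonnegPart v⟩ :
        wSubmodule ρ)
      map_add' := fun v w => W.ext fun k => by
        change (Laurent.coeff (k : ℤ) (v + w)).re = _ + _
        rw [map_add, Complex.add_re]
      map_smul' := fun r v => W.ext fun k => by
        change (Laurent.coeff (k : ℤ) (r • v)).re = r * _
        rw [Laurent.coeff_real_smul, Complex.re_ofReal_mul] } 1 fun v => by
    rw [one_mul, ← (Laurent.hasSum_norm v).tsum_eq]
    refine (summable_nonnegPart v).tsum_le_tsum_of_inj (fun k : ℕ => (k : ℤ)) Nat.cast_injective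
      ?_ ?_ (Laurent.hasSum_norm v).summable
    · exact fun k _ => mul_nonneg (norm_nonneg _) (radius_pow_nonneg _)
    · exact fun k => mul_le_mul_of_nonneg_right (Complex.abs_re_le_norm _) (radius_pow_nonneg k)

theorem coeff_nonnegPart (v : Laurent ρ) (k : ℕ) :
    (nonnegPart v).coeff k = (Laurent.coeff (k : ℤ) v).re := rfl

/-- The projection `∑ v_k λ^k ↦ ∑_{k ≥ 0} Re(v_{k+1}) λ^k`. -/
def posPart : Laurent ρ →L[ℝ] W ρ :=
  nonnegPart ∘L (Laurent.mulL (Laurent.T (-1))).restrictScalars ℝ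

theorem coeff_posPart (v : Laurent ρ) (k : ℕ) :
    (posPart v).coeff k = (Laurent.coeff (k + 1 : ℤ) v).re := by
  change (Laurent.coeff (k : ℤ) (Laurent.T (-1) * v)).re = _
  rw [Laurent.coeff_T_mul, sub_neg_eq_add]

theorem nonnegPart_toLaurent (f : W ρ) : nonnegPart (toLaurent f) = f :=
  W.ext fun k => by rw [coeff_nonnegPart, coeff_natCast_toLaurent, Complex.ofReal_re]

/-- `W ρ` is complete as a continuous linear retract of the complete space `Laurent ρ`. -/
instance : CompleteSpace (W ρ) := by
  refine Metric.complete_of_cauchySeq_tendsto fun u hu => ?_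
  obtain ⟨v, hv⟩ := cauchySeq_tendsto_of_complete
    ((toLaurent (ρ := ρ)).uniformContinuous.comp_cauchySeq hu)
  exact ⟨nonnegPart v, ((nonnegPart.continuous.tendsto v).comp hv).congr fun n =>
    nonnegPart_toLaurent (u n)⟩

/-- The substitution `λ ↦ -λ`. -/
def substNeg : W ρ →L[ℝ] W ρ := nonnegPart ∘L Laurent.substNeg.restrictScalars ℝ ∘L toLaurent

theorem coeff_substNeg (f : W ρ) (k : ℕ) : (substNeg f).coeff k = (-1) ^ k * f.coeff k := by
  change (Laurent.coeff (k : ℤ) (Laurent.substNeg (toLaurent f))).re = _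
  rw [Laurent.coeff_substNeg, coeff_natCast_toLaurent, zpow_natCast]
  exact_mod_cast rfl

theorem eval_substNeg (f : W ρ) (l : ℂ) : (substNeg f).eval l = f.eval (-l) := by
  refine tsum_congr fun k => ?_
  rw [coeff_substNeg, neg_pow l]
  push_cast
  ring

theorem substNeg_substNeg (f : W ρ) : substNeg (substNeg f) = f :=
  W.ext fun k => by
    rw [coeff_substNeg, coeff_substNeg, ← mul_assoc, ← mul_pow, neg_one_mul, neg_neg, one_pow,
      one_mul]

/-- The power series `f ↦ (f - f₀) / λ`. -/
def tail : W ρ →L[ℝ] W ρ := posPart ∘L toLaurent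

theorem coeff_tail (f : W ρ) (k : ℕ) : (tail f).coeff k = f.coeff (k + 1) := by
  change (posPart (toLaurent f)).coeff k = _
  rw [coeff_posPart, ← Nat.cast_add_one, coeff_natCast_toLaurent, Complex.ofReal_re]

/-- The power series `p + λ f`, linear in `(p, f)`. -/
def cons : ℝ × W ρ →L[ℝ] W ρ :=
  (nonnegPart ∘L .toSpanSingleton ℝ 1).coprod
    (nonnegPart ∘L (Laurent.mulL (Laurent.T 1)).restrictScalars ℝ ∘L toLaurent)

theorem cons_apply (p : ℝ) (f : W ρ) :
    cons (p, f) = nonnegPart (p • 1) + nonnegPart (Laurent.T 1 * toLaurent f) := rfl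

theorem coeff_cons_zero (p : ℝ) (f : W ρ) : (cons (p, f)).coeff 0 = p := by
  rw [cons_apply, coeff_add, coeff_nonnegPart, coeff_nonnegPart, Laurent.coeff_T_mul,
    coeff_toLaurent_of_neg f (by decide), Laurent.coeff_real_smul, Laurent.one_eq_T,
    Laurent.coeff_T, if_pos Nat.cast_zero, mul_one, Complex.ofReal_re, Complex.zero_re, add_zero]

theorem coeff_cons_succ (p : ℝ) (f : W ρ) (k : ℕ) : (cons (p, f)).coeff (k + 1) = f.coeff k := by
  rw [cons_apply, coeff_add, coeff_nonnegPart, coeff_nonnegPart, Laurent.coeff_T_mul,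
    Nat.cast_add_one, add_sub_cancel_right, coeff_natCast_toLaurent, Laurent.coeff_real_smul,
    Laurent.one_eq_T, Laurent.coeff_T, if_neg (by omega), mul_zero, Complex.zero_re, zero_add,
    Complex.ofReal_re]

theorem ext_zero_succ {f g : W ρ} (h0 : f.coeff 0 = g.coeff 0)
    (hsucc : ∀ k, f.coeff (k + 1) = g.coeff (k + 1)) : f = g :=
  W.ext fun k => k.casesOn h0 hsucc

theorem cons_coeff_zero_tail (f : W ρ) : cons (f.coeff 0, tail f) = f :=
  ext_zero_succ (coeff_cons_zero _ _) fun k => by rw [coeff_cons_succ, coeff_tail]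

theorem exists_eq_cons (f : W ρ) : ∃ p g, f = cons (p, g) :=
  ⟨f.coeff 0, tail f, (cons_coeff_zero_tail f).symm⟩

theorem cons_eq_zero_iff {p : ℝ} {f : W ρ} : cons (p, f) = 0 ↔ p = 0 ∧ f = 0 := by
  refine ⟨fun h => ⟨?_, W.ext fun k => ?_⟩,
    fun ⟨hp, hf⟩ => by rw [hp, hf, ← Prod.zero_eq_mk, map_zero]⟩
  · rw [← coeff_cons_zero p f, h, coeff_zero]
  · rw [← coeff_cons_succ p f, h, coeff_zero, coeff_zero]

theorem substNeg_cons (p : ℝ) (f : W ρ) : substNeg (cons (p, f)) = cons (p, -substNeg f) := by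
  refine ext_zero_succ ?_ fun k => ?_
  · rw [coeff_substNeg, coeff_cons_zero, coeff_cons_zero, pow_zero, one_mul]
  · rw [coeff_substNeg, coeff_cons_succ, coeff_cons_succ, coeff_neg, coeff_substNeg, pow_succ]
    ring

theorem summable_eval (f : W ρ) {l : ℂ} (hl : ‖l‖ ≤ ρ) :
    Summable fun k => (f.coeff k : ℂ) * l ^ k := by
  refine Summable.of_norm_bounded f.summable fun k => ?_
  rw [norm_mul, norm_pow, Complex.norm_real, Real.norm_eq_abs]
  exact mul_le_mul_of_nonneg_left (pow_le_pow_left₀ (norm_nonneg l) hl k) (abs_nonneg _)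

theorem eval_cons (p : ℝ) (f : W ρ) {l : ℂ} (hl : ‖l‖ ≤ ρ) :
    (cons (p, f)).eval l = p + l * f.eval l := by
  rw [eval, (summable_eval _ hl).tsum_eq_zero_add, coeff_cons_zero, pow_zero, mul_one, eval,
    ← tsum_mul_left]
  congr 1
  refine tsum_congr fun k => ?_
  rw [coeff_cons_succ, pow_succ]
  ring

theorem ofPoly_C_add_X_mul (p : ℝ) (q : Polynomial ℝ) :
    (ofPoly (Polynomial.C p + Polynomial.X * q) : W ρ) = cons (p, ofPoly q) := by
  refine ext_zero_succ ?_ fun k => ?_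
  · rw [coeff_cons_zero]
    change (Polynomial.C p + Polynomial.X * q).coeff 0 = p
    simp
  · rw [coeff_cons_succ]
    change (Polynomial.C p + Polynomial.X * q).coeff (k + 1) = q.coeff k
    simp

end W

section Logarithm

variable {A : Type*} [NormedRing A] [NormedAlgebra ℂ A]

/-- The coefficients of `log (1 + X) / X`. -/
def logCoeff (k : ℕ) : ℂ := (-1) ^ k / (k + 1)

/-- The power series `∑ (-1)^k X^k / (k + 1)` of `log (1 + X) / X`. -/
def logQuot (X : A) : A := ∑' k : ℕ, logCoeff k • X ^ k

theorem norm_logCoeff (k : ℕ) : ‖logCoeff k‖ = ((k : ℝ) + 1)⁻¹ := by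
  have h : ‖(k + 1 : ℂ)‖ = k + 1 := by exact_mod_cast Complex.norm_natCast (k + 1)
  rw [logCoeff, norm_div, norm_pow, norm_neg, norm_one, one_pow, one_div, h]

theorem norm_logCoeff_le_one (k : ℕ) : ‖logCoeff k‖ ≤ 1 := by
  rw [norm_logCoeff]
  exact inv_le_one_of_one_le₀ (by linarith [Nat.cast_nonneg (α := ℝ) k])

theorem tendsto_norm_logCoeff_succ_div :
    Filter.Tendsto (fun k => ‖logCoeff k.succ‖ / ‖logCoeff k‖) Filter.atTop (𝓝 1) := by
  refine ((tendsto_natCast_div_add_atTop (1 : ℝ)).comp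
    (Filter.tendsto_add_atTop_nat 1)).congr fun k => ?_
  rw [norm_logCoeff, norm_logCoeff, inv_div_inv]
  simp only [Function.comp_apply, Nat.succ_eq_add_one, Nat.cast_add, Nat.cast_one]

theorem logQuot_zero : logQuot (0 : A) = 1 := by
  rw [logQuot, tsum_eq_single 0 fun k hk => by rw [zero_pow hk, smul_zero]]
  simp [logCoeff]

theorem norm_neg_smul_lt_one {P : A} (hP : ‖P‖ < 1) {u : ℝ} (hu : u ∈ Set.Icc (0 : ℝ) 1) :
    ‖-(u • P)‖ < 1 := by
  rw [norm_neg, norm_smul, Real.norm_of_nonneg hu.1]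
  exact lt_of_le_of_lt (mul_le_of_le_one_left (norm_nonneg _) hu.2) hP

variable [CompleteSpace A]

theorem hasSum_logQuot {X : A} (hX : ‖X‖ < 1) :
    HasSum (fun k : ℕ => logCoeff k • X ^ k) (logQuot X) := by
  refine (Summable.of_norm_bounded (summable_norm_geometric_of_norm_lt_one hX) fun k => ?_).hasSum
  rw [norm_smul]
  exact mul_le_of_le_one_left (norm_nonneg _) (norm_logCoeff_le_one k)

theorem contDiffAt_logQuot : ContDiffAt ℂ ω (logQuot : A → A) 0 := by
  have radius_ge := FormalMultilinearSeries.inv_le_ofScalars_radius_of_tendsto A logCoeff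
    one_ne_zero tendsto_norm_logCoeff_succ_div
  have series := (FormalMultilinearSeries.ofScalars A logCoeff).hasFPowerSeriesOnBall
    (lt_of_lt_of_le (by simp) radius_ge)
  rw [show (FormalMultilinearSeries.ofScalars A logCoeff).sum = logQuot from
    FormalMultilinearSeries.ofScalarsSum_eq_tsum (E := A) logCoeff] at series
  exact series.analyticAt.contDiffAt

theorem hasSum_mul_inverse_one_add_smul {P : A} (hP : ‖P‖ < 1) {u : ℝ}
    (hu : u ∈ Set.Icc (0 : ℝ) 1) :
    HasSum (fun k : ℕ => (-u) ^ k • P ^ (k + 1)) (P * Ring.inverse (1 + u • P)) := by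
  have h := (hasSum_geom_series_inverse _ (norm_neg_smul_lt_one hP hu)).mul_left P
  rw [sub_neg_eq_add] at h
  refine h.congr_fun fun k => ?_
  rw [← neg_smul, smul_pow, mul_smul_comm, pow_succ']

theorem integral_neg_pow_smul (P : A) (k : ℕ) :
    ∫ u in (0 : ℝ)..1, (-u) ^ k • P ^ (k + 1) = P * (logCoeff k • P ^ k) := by
  have h : ∫ u in (0 : ℝ)..1, (-u) ^ k = (-1) ^ k / (k + 1) := by
    rw [funext fun u : ℝ => neg_pow u k, intervalIntegral.integral_const_mul, integral_pow]
    simp [div_eq_mul_inv]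
  rw [intervalIntegral.integral_smul_const, mul_smul_comm, ← pow_succ', h, ← Complex.coe_smul,
    logCoeff]
  push_cast
  rfl

theorem mul_logQuot_eq_integral {P : A} (hP : ‖P‖ < 1) :
    P * logQuot P = ∫ u in (0 : ℝ)..1, P * Ring.inverse (1 + u • P) := by
  have h := intervalIntegral.hasSum_integral_of_dominated_convergence (a := 0) (b := 1)
    (μ := MeasureTheory.volume) (F := fun (k : ℕ) (u : ℝ) => (-u) ^ k • P ^ (k + 1))
    (f := fun u : ℝ => P * Ring.inverse (1 + u • P)) (fun k _ => ‖P‖ ^ (k + 1))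
    (fun k => Continuous.aestronglyMeasurable (by fun_prop))
    (fun k => .of_forall fun u hu => by
      rw [Set.uIoc_of_le zero_le_one] at hu
      rw [norm_smul, norm_pow, norm_neg, Real.norm_of_nonneg hu.1.le]
      exact (mul_le_of_le_one_left (norm_nonneg _) (pow_le_one₀ hu.1.le hu.2)).trans
        (norm_pow_le' P k.succ_pos))
    (.of_forall fun u _ => (summable_nat_add_iff 1).mpr
      (summable_geometric_of_lt_one (norm_nonneg _) hP))
    intervalIntegrable_const
    (.of_forall fun u hu => hasSum_mul_inverse_one_add_smul hP
      (Set.Ioc_subset_Icc_self (by rwa [Set.uIoc_of_le zero_le_one] at hu)))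
  simp_rw [integral_neg_pow_smul] at h
  exact ((hasSum_logQuot hP).mul_left P).unique h

/-- With `R = (1 + P)⁻¹` one has `1 + u (R - 1) = (1 + (1 - u) P) R`. -/
theorem mul_inverse_one_add_smul_of_inverse {P R : A} (hP : ‖P‖ < 1) (hl : R * (1 + P) = 1)
    (hr : (1 + P) * R = 1) {u : ℝ} (hu : u ∈ Set.Icc (0 : ℝ) 1) :
    (R - 1) * Ring.inverse (1 + u • (R - 1)) = -(P * Ring.inverse (1 + (1 - u) • P)) := by
  let V : Aˣ := Units.oneSub _ (norm_neg_smul_lt_one hP (Set.Icc.mem_iff_one_sub_mem.mp hu))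
  let R' : Aˣ := ⟨R, 1 + P, hl, hr⟩
  have hV : (V : A) = 1 + (1 - u) • P := by rw [Units.val_oneSub, sub_neg_eq_add]
  have hPR : P * R = 1 - R := by rw [← hr, add_mul, one_mul, add_sub_cancel_left]
  have hVR : ((V * R' : Aˣ) : A) = 1 + u • (R - 1) := by
    rw [Units.val_mul, hV]
    change (1 + (1 - u) • P) * R = _
    rw [add_mul, one_mul, smul_mul_assoc, hPR]
    module
  rw [← hVR, Ring.inverse_unit, ← hV, Ring.inverse_unit, mul_inv_rev, Units.val_mul]
  change (R - 1) * ((1 + P) * _) = _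
  rw [← mul_assoc, sub_mul, hl, one_mul, sub_add_cancel_left, neg_mul]

theorem mul_logQuot_of_inverse {P R : A} (hP : ‖P‖ < 1) (hR : ‖R - 1‖ < 1)
    (hl : R * (1 + P) = 1) (hr : (1 + P) * R = 1) :
    (R - 1) * logQuot (R - 1) = -(P * logQuot P) := by
  have reflect := intervalIntegral.integral_comp_sub_left (a := 0) (b := 1)
    (fun u : ℝ => -(P * Ring.inverse (1 + u • P))) 1
  rw [sub_zero, sub_self] at reflect
  rw [mul_logQuot_eq_integral hP, mul_logQuot_eq_integral hR, ← intervalIntegral.integral_neg,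
    ← reflect]
  refine intervalIntegral.integral_congr fun u hu => ?_
  rw [Set.uIcc_of_le zero_le_one] at hu
  exact mul_inverse_one_add_smul_of_inverse hP hl hr hu

end Logarithm

section Primitive

variable {E : Type*} [NormedAddCommGroup E] [NormedSpace ℂ E]

/-- The primitive, vanishing at `0`, of a continuous function on the unit interval; outside the
interval the function is extended by its end values. -/
def primitive (f : C(unitInterval, E)) (s : ℝ) : E :=
  ∫ u in (0 : ℝ)..s, Set.IccExtend zero_le_one f u

omit [NormedSpace ℂ E] in
theorem continuous_IccExtend (f : C(unitInterval, E)) :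
    Continuous (Set.IccExtend (zero_le_one (α := ℝ)) f) :=
  f.continuous.Icc_extend'

theorem hasDerivAt_primitive [CompleteSpace E] (f : C(unitInterval, E)) (s : ℝ) :
    HasDerivAt (primitive f) (Set.IccExtend zero_le_one f s) s :=
  ((continuous_IccExtend f).integral_hasStrictDerivAt 0 s).hasDerivAt

theorem primitive_zero (f : C(unitInterval, E)) : primitive f 0 = 0 :=
  intervalIntegral.integral_same

theorem norm_primitive_le (f : C(unitInterval, E)) (s : unitInterval) : ‖primitive f s‖ ≤ ‖f‖ := by
  refine (intervalIntegral.norm_integral_le_of_norm_le_const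
    fun u _ => ContinuousMap.norm_coe_le_norm f _).trans ?_
  rw [sub_zero, abs_of_nonneg s.2.1]
  exact mul_le_of_le_one_right (norm_nonneg f) s.2.2

/-- Taking primitives, as an operator on the continuous functions on the unit interval. -/
def primitiveL [CompleteSpace E] : C(unitInterval, E) →L[ℂ] C(unitInterval, E) :=
  LinearMap.mkContinuous
    { toFun := fun f => ⟨fun s => primitive f s,
        (continuous_iff_continuousAt.mpr fun s => (hasDerivAt_primitive f s).continuousAt).comp
          continuous_subtype_val⟩
      map_add' := fun f g => by
        ext s
        exact intervalIntegral.integral_add ((continuous_IccExtend f).intervalIntegrable _ _)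
          ((continuous_IccExtend g).intervalIntegrable _ _)
      map_smul' := fun c f => by
        ext s
        exact intervalIntegral.integral_smul c _ } 1
    (fun f => by
      rw [one_mul]
      exact (ContinuousMap.norm_le _ (norm_nonneg f)).mpr (norm_primitive_le f))

theorem primitiveL_apply [CompleteSpace E] (f : C(unitInterval, E)) (s : unitInterval) :
    primitiveL f s = primitive f s := rfl

end Primitive

section Resolvent

variable {X : Type*} [NormedRing X] [NormedAlgebra ℂ X]

/-- The operator `N ↦ J (N * B)`, as a function of `B`. -/
def volterra (J : X →L[ℂ] X) : X →L[ℂ] (X →L[ℂ] X) :=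
  ContinuousLinearMap.compL ℂ X X X J ∘L (ContinuousLinearMap.mul ℂ X).flip

theorem volterra_apply (J : X →L[ℂ] X) (B N : X) : volterra J B N = J (N * B) := rfl

/-- The solution `N = (1 - t • volterra J B)⁻¹ 1` of `N = 1 + t • J (N * B)`, meaningful when
`t • volterra J B` is small. -/
def volterraSol (J : X →L[ℂ] X) (t : ℂ) (B : X) : X := Ring.inverse (1 - t • volterra J B) 1

theorem one_sub_zero_smul_volterra (J : X →L[ℂ] X) (B : X) :
    (1 : X →L[ℂ] X) - (0 : ℂ) • volterra J B = 1 := by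
  module

theorem volterraSol_zero (J : X →L[ℂ] X) (B : X) : volterraSol J 0 B = 1 := by
  rw [volterraSol, one_sub_zero_smul_volterra, Ring.inverse_one]
  rfl

variable [CompleteSpace X]

theorem volterraSol_eq {J : X →L[ℂ] X} {t : ℂ} {B : X} (h : ‖t • volterra J B‖ < 1) :
    volterraSol J t B = 1 + t • J (volterraSol J t B * B) := by
  have inverse := congrArg (fun T : X →L[ℂ] X => T 1)
    (Ring.mul_inverse_cancel _ (isUnit_one_sub_of_norm_lt_one h))
  have resolvent : volterraSol J t B - t • volterra J B (volterraSol J t B) = 1 := inverse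
  rw [volterra_apply] at resolvent
  rw [← resolvent, sub_add_cancel]

theorem contDiffAt_volterraSol (J : X →L[ℂ] X) (B : X) :
    ContDiffAt ℂ ω (fun p : ℂ × X => volterraSol J p.1 p.2) (0, B) := by
  have affine : ContDiffAt ℂ ω (fun p : ℂ × X => (1 : X →L[ℂ] X) - p.1 • volterra J p.2) (0, B) :=
    contDiffAt_const.sub (contDiffAt_fst.smul
      ((volterra J).contDiff.contDiffAt.comp (0, B) contDiffAt_snd))
  refine (ContDiffAt.comp (g := (Ring.inverse : (X →L[ℂ] X) → _)) (0, B) ?_ affine).clm_apply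
    contDiffAt_const
  simp only [one_sub_zero_smul_volterra]
  exact contDiffAt_ringInverse ℂ (1 : (X →L[ℂ] X)ˣ)

omit [CompleteSpace X] in
theorem eventually_norm_smul_volterra_lt_one (J : X →L[ℂ] X) (B : X) :
    ∀ᶠ p : ℂ × X in 𝓝 (0, B), ‖p.1 • volterra J p.2‖ < 1 := by
  have cont : ContinuousAt (fun p : ℂ × X => ‖p.1 • volterra J p.2‖) (0, B) :=
    (continuousAt_fst.smul
      ((volterra J).continuous.continuousAt.comp (x := (0, B)) continuousAt_snd)).norm
  refine cont.eventually_lt_const ?_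
  simp only [show (0 : ℂ) • volterra J B = 0 by module, norm_zero, zero_lt_one]

end Resolvent

section LinearODE

variable {A : Type*} [NormedRing A] [NormedAlgebra ℂ A] [CompleteSpace A]

/-- The solution on the unit interval of `N' = t N B`, `N(0) = 1`, for small `t B`. -/
def fundSol (t : ℂ) (B : C(unitInterval, A)) : C(unitInterval, A) := volterraSol primitiveL t B

/-- The difference quotient `(N(1) - 1) / t` of the end value of `N = fundSol t B`, written so that
it makes sense at `t = 0`. -/
def endQuot (t : ℂ) (B : C(unitInterval, A)) : A := primitiveL (fundSol t B * B) 1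

/-- The quotient `log N(1) / t` for the end value of `N = fundSol t B`, written so that it makes
sense at `t = 0`. -/
def logEndQuot (t : ℂ) (B : C(unitInterval, A)) : A := endQuot t B * logQuot (t • endQuot t B)

theorem fundSol_eq {t : ℂ} {B : C(unitInterval, A)} (h : ‖t • volterra primitiveL B‖ < 1) :
    fundSol t B = 1 + t • primitiveL (fundSol t B * B) := volterraSol_eq h

theorem fundSol_apply {t : ℂ} {B : C(unitInterval, A)} (h : ‖t • volterra primitiveL B‖ < 1)
    (s : unitInterval) : fundSol t B s = 1 + t • primitive (fundSol t B * B) s := by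
  conv_lhs => rw [fundSol_eq h]
  rfl

theorem fundSol_apply_zero {t : ℂ} {B : C(unitInterval, A)}
    (h : ‖t • volterra primitiveL B‖ < 1) : fundSol t B 0 = 1 := by
  rw [fundSol_apply h, Set.Icc.coe_zero, primitive_zero, smul_zero, add_zero]

theorem fundSol_apply_one {t : ℂ} {B : C(unitInterval, A)}
    (h : ‖t • volterra primitiveL B‖ < 1) : fundSol t B 1 = 1 + t • endQuot t B :=
  fundSol_apply h 1

theorem hasDerivWithinAt_fundSol {t : ℂ} {B : C(unitInterval, A)}
    (h : ‖t • volterra primitiveL B‖ < 1) {s : ℝ} (hs : s ∈ Set.Icc (0 : ℝ) 1) :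
    HasDerivWithinAt (Set.IccExtend zero_le_one (fundSol t B))
      (t • (fundSol t B ⟨s, hs⟩ * B ⟨s, hs⟩)) (Set.Icc 0 1) s := by
  have deriv_rhs := (((hasDerivAt_primitive (fundSol t B * B) s).const_smul
    t).const_add 1).hasDerivWithinAt (s := Set.Icc (0 : ℝ) 1)
  rw [Set.IccExtend_of_mem _ _ hs] at deriv_rhs
  have integral_eq : ∀ u ∈ Set.Icc (0 : ℝ) 1, Set.IccExtend zero_le_one (fundSol t B) u =
      1 + t • primitive (fundSol t B * B) u := fun u hu => by
    rw [Set.IccExtend_of_mem _ _ hu]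
    exact fundSol_apply h ⟨u, hu⟩
  exact deriv_rhs.congr integral_eq (integral_eq s hs)

theorem endQuot_zero (B : C(unitInterval, A)) : endQuot 0 B = primitive B 1 := by
  rw [endQuot, fundSol, volterraSol_zero, one_mul, primitiveL_apply, Set.Icc.coe_one]

theorem contDiffAt_endQuot (B : C(unitInterval, A)) :
    ContDiffAt ℂ ω (fun p : ℂ × C(unitInterval, A) => endQuot p.1 p.2) (0, B) := by
  have integrand := (contDiffAt_volterraSol primitiveL B).mul contDiffAt_snd
  exact (ContinuousMap.evalCLM ℂ (M := A) (1 : unitInterval)).contDiff.contDiffAt.comp _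
    (primitiveL.contDiff.contDiffAt.comp _ integrand)

theorem contDiffAt_smul_endQuot (B : C(unitInterval, A)) :
    ContDiffAt ℂ ω (fun p : ℂ × C(unitInterval, A) => p.1 • endQuot p.1 p.2) (0, B) :=
  contDiffAt_fst.smul (contDiffAt_endQuot B)

theorem logEndQuot_zero (B : C(unitInterval, A)) : logEndQuot 0 B = primitive B 1 := by
  rw [logEndQuot, zero_smul, logQuot_zero, mul_one, endQuot_zero]

theorem contDiffAt_logEndQuot (B : C(unitInterval, A)) :
    ContDiffAt ℂ ω (fun p : ℂ × C(unitInterval, A) => logEndQuot p.1 p.2) (0, B) := by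
  refine (contDiffAt_endQuot B).mul
    (ContDiffAt.comp (g := logQuot) (0, B) ?_ (contDiffAt_smul_endQuot B))
  simp only [zero_smul]
  exact contDiffAt_logQuot

theorem eventually_norm_smul_endQuot_lt (B : C(unitInterval, A)) {ε : ℝ} (hε : 0 < ε) :
    ∀ᶠ p : ℂ × C(unitInterval, A) in 𝓝 (0, B), ‖p.1 • endQuot p.1 p.2‖ < ε :=
  (contDiffAt_smul_endQuot B).continuousAt.norm.eventually_lt_const
    (by simpa only [zero_smul, norm_zero] using hε)

end LinearODE

theorem one_sub_mul_exp_mem_slitPlane {R θ : ℝ} (hR : 0 ≤ R) (hθ : θ ∈ Set.Ioo (-(2 * Real.pi)) 0) :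
    1 - (R : ℂ) * Complex.exp (θ * Complex.I) ∈ Complex.slitPlane := by
  rw [Complex.mem_slitPlane_iff]
  by_contra! h
  simp only [Complex.sub_re, Complex.one_re, Complex.re_ofReal_mul, Complex.exp_ofReal_mul_I_re,
    Complex.sub_im, Complex.one_im, Complex.im_ofReal_mul, Complex.exp_ofReal_mul_I_im] at h
  obtain ⟨re_le, im_eq⟩ := h
  have cos_pos : 0 < Real.cos θ := by
    by_contra! hc
    nlinarith
  have R_ne : R ≠ 0 := by
    rintro rfl
    linarith
  have sin_eq : Real.sin θ = 0 :=
    (mul_eq_zero.mp (show R * Real.sin θ = 0 by linarith)).resolve_left R_ne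
  have cos_eq : Real.cos θ = 1 :=
    (Real.sin_eq_zero_iff_cos_eq.mp sin_eq).resolve_right fun h => by linarith
  rw [Real.cos_eq_one_iff_of_lt_of_lt hθ.1 (by linarith [hθ.2, Real.pi_pos])] at cos_eq
  exact hθ.2.ne cos_eq

theorem integral_inv_mul_deriv_eq_sub_log {f f' : ℝ → ℂ} {a b : ℝ} (hab : a ≤ b)
    (hf : ∀ s ∈ Set.Icc a b, HasDerivAt f (f' s) s) (hf' : ContinuousOn f' (Set.Icc a b)) {c : ℂ}
    (hc : c ≠ 0) (h : ∀ s ∈ Set.Icc a b, c * f s ∈ Complex.slitPlane) :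
    ∫ s in a..b, (f s)⁻¹ * f' s = Complex.log (c * f b) - Complex.log (c * f a) := by
  rw [← Set.uIcc_of_le hab] at hf hf' h
  have f_ne : ∀ s ∈ Set.uIcc a b, f s ≠ 0 := fun s hs =>
    right_ne_zero_of_mul (Complex.slitPlane_ne_zero (h s hs))
  refine intervalIntegral.integral_eq_sub_of_hasDerivAt
    (f := fun s => Complex.log (c * f s)) (fun s hs => ?_)
    ((ContinuousOn.inv₀ (fun s hs => (hf s hs).continuousAt.continuousWithinAt) f_ne).mul
      hf').intervalIntegrable
  have deriv_log := ((hf s hs).const_mul c).clog_real (h s hs)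
  rwa [mul_div_mul_left _ _ hc, div_eq_inv_mul] at deriv_log

section Loop

variable (m : ℕ)

theorem card_pos : (0 : ℝ) < (2 * m + 2 : ℕ) := by positivity

theorem loop_eq (s : ℝ) : loop m s =
    ((2 * Real.sin (Real.pi * s) : ℝ) : ℂ) *
      Complex.exp ((Real.pi * (2 * s - 1) / (2 * m + 2 : ℕ) : ℝ) * Complex.I) := by
  rw [loop]
  push_cast
  congr 2
  ring

theorem contDiff_loop : ContDiff ℝ ∞ (loop m) := by
  rw [funext (loop_eq m)]
  have modulus : ContDiff ℝ ∞ fun s : ℝ => ((2 * Real.sin (Real.pi * s) : ℝ) : ℂ) :=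
    Complex.ofRealCLM.contDiff.comp
      (contDiff_const.mul (Real.contDiff_sin.comp (contDiff_const.mul contDiff_id)))
  have argument : ContDiff ℝ ∞ fun s : ℝ =>
      ((Real.pi * (2 * s - 1) / (2 * m + 2 : ℕ) : ℝ) : ℂ) :=
    Complex.ofRealCLM.contDiff.comp
      ((contDiff_const.mul ((contDiff_const.mul contDiff_id).sub contDiff_const)).div_const _)
  exact modulus.mul (argument.mul contDiff_const).cexp

theorem hasDerivAt_loop (s : ℝ) : HasDerivAt (loop m) (deriv (loop m) s) s :=
  ((contDiff_loop m).differentiable (by simp) s).hasDerivAt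

theorem continuous_loop : Continuous (loop m) := (contDiff_loop m).continuous

theorem continuous_deriv_loop : Continuous (deriv (loop m)) :=
  (contDiff_loop m).continuous_deriv (by simp)

theorem loop_zero : loop m 0 = 0 := by simp [loop]

theorem loop_one : loop m 1 = 0 := by simp [loop]

theorem loop_one_half : loop m (1 / 2) = 2 := by
  rw [loop_eq, show Real.pi * (1 / 2) = Real.pi / 2 by ring, Real.sin_pi_div_two]
  norm_num

theorem loop_one_sub (s : ℝ) : loop m (1 - s) = starRingEnd ℂ (loop m s) := by
  rw [loop_eq, loop_eq, map_mul, Complex.conj_ofReal, ← Complex.exp_conj, map_mul,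
    Complex.conj_ofReal, Complex.conj_I, mul_sub, mul_one, Real.sin_pi_sub]
  congr 2
  push_cast
  ring

theorem conj_deriv_loop_one_sub (s : ℝ) :
    starRingEnd ℂ (deriv (loop m) (1 - s)) = -deriv (loop m) s := by
  have reversed : HasDerivAt (fun u => starRingEnd ℂ (loop m (1 - u)))
      (starRingEnd ℂ (-deriv (loop m) (1 - s))) s := by
    have h := (hasDerivAt_loop m (1 - s)).scomp s ((hasDerivAt_id s).const_sub 1)
    rw [neg_one_smul] at h
    exact h.star
  simp only [loop_one_sub, Complex.conj_conj] at reversed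
  rw [reversed.deriv, map_neg, neg_neg]

theorem puncture_eq (j : ℕ) : puncture m j =
    Complex.exp ((2 * Real.pi * j / (2 * m + 2 : ℕ) : ℝ) * Complex.I) := by
  rw [puncture]
  push_cast
  congr 1
  ring

theorem puncture_zero : puncture m 0 = 1 := by simp [puncture]

theorem puncture_ne_zero (j : ℕ) : puncture m j ≠ 0 := Complex.exp_ne_zero _

theorem norm_puncture (j : ℕ) : ‖puncture m j‖ = 1 := by
  rw [puncture_eq, Complex.norm_exp_ofReal_mul_I]

theorem one_sub_loop_div_puncture_mem_slitPlane {s : ℝ} (hs : s ∈ Set.Icc (0 : ℝ) 1) {j : ℕ}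
    (hj₀ : 0 < j) (hj : j < 2 * m + 2) : 1 - loop m s / puncture m j ∈ Complex.slitPlane := by
  have hπ := Real.pi_pos
  have hn := card_pos m
  have one_le : (1 : ℝ) ≤ j := by exact_mod_cast hj₀
  have le_card : (j : ℝ) + 1 ≤ (2 * m + 2 : ℕ) := by exact_mod_cast hj
  have sin_nonneg : 0 ≤ Real.sin (Real.pi * s) :=
    Real.sin_nonneg_of_nonneg_of_le_pi (mul_nonneg hπ.le hs.1) (mul_le_of_le_one_right hπ.le hs.2)
  rw [loop_eq, puncture_eq, mul_div_assoc, ← Complex.exp_sub, ← sub_mul, ← Complex.ofReal_sub,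
    ← sub_div]
  refine one_sub_mul_exp_mem_slitPlane (by positivity) ⟨?_, ?_⟩
  · rw [lt_div_iff₀ hn]
    nlinarith [hs.1, hs.2]
  · exact div_neg_of_neg_of_pos (by nlinarith [hs.1, hs.2]) hn

theorem im_loop_neg {s : ℝ} (hs : s ∈ Set.Ioo (0 : ℝ) (1 / 2)) : (loop m s).im < 0 := by
  have hπ := Real.pi_pos
  have hn := card_pos m
  have one_le_card : (1 : ℝ) ≤ (2 * m + 2 : ℕ) := by exact_mod_cast (by omega : 1 ≤ 2 * m + 2)
  have modulus_pos : 0 < Real.sin (Real.pi * s) :=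
    Real.sin_pos_of_pos_of_lt_pi (mul_pos hπ hs.1) (by nlinarith [hs.2])
  have sin_neg : Real.sin (Real.pi * (2 * s - 1) / (2 * m + 2 : ℕ)) < 0 := by
    refine Real.sin_neg_of_neg_of_neg_pi_lt ?_ ?_
    · exact div_neg_of_neg_of_pos (by nlinarith [hs.2]) hn
    · rw [lt_div_iff₀ hn]
      nlinarith [hs.1]
  rw [loop_eq, Complex.im_ofReal_mul, Complex.exp_ofReal_mul_I_im]
  nlinarith [mul_neg_of_pos_of_neg modulus_pos sin_neg]

theorem I_mul_loop_sub_one_mem_slitPlane {s : ℝ} (hs : s ∈ Set.Icc (0 : ℝ) (1 / 2)) :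
    Complex.I * (loop m s - 1) ∈ Complex.slitPlane := by
  rw [Complex.mem_slitPlane_iff]
  rcases eq_or_lt_of_le hs.1 with rfl | pos
  · right
    simp [loop_zero]
  rcases eq_or_lt_of_le hs.2 with rfl | lt_half
  · right
    rw [loop_one_half]
    norm_num
  · left
    simpa using im_loop_neg m ⟨pos, lt_half⟩

theorem neg_I_mul_loop_sub_one_mem_slitPlane {s : ℝ} (hs : s ∈ Set.Icc (1 / 2 : ℝ) 1) :
    -Complex.I * (loop m s - 1) ∈ Complex.slitPlane := by
  have h := I_mul_loop_sub_one_mem_slitPlane m (s := 1 - s)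
    ⟨by linarith [hs.2], by linarith [hs.1]⟩
  have conj_eq : -Complex.I * (loop m s - 1) =
      starRingEnd ℂ (Complex.I * (loop m (1 - s) - 1)) := by
    rw [loop_one_sub, map_mul, map_sub, Complex.conj_conj, Complex.conj_I, map_one]
  rw [conj_eq]
  rw [Complex.mem_slitPlane_iff] at h ⊢
  rwa [Complex.conj_re, Complex.conj_im, neg_ne_zero]

theorem loop_sub_puncture_ne_zero {s : ℝ} (hs : s ∈ Set.Icc (0 : ℝ) 1) {j : ℕ}
    (hj : j < 2 * m + 2) : loop m s - puncture m j ≠ 0 := by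
  rcases Nat.eq_zero_or_pos j with rfl | hj₀
  · rw [puncture_zero]
    rcases le_total s (1 / 2) with le_half | half_le
    · exact right_ne_zero_of_mul (Complex.slitPlane_ne_zero
        (I_mul_loop_sub_one_mem_slitPlane m ⟨hs.1, le_half⟩))
    · exact right_ne_zero_of_mul (Complex.slitPlane_ne_zero
        (neg_I_mul_loop_sub_one_mem_slitPlane m ⟨half_le, hs.2⟩))
  · intro h
    have := one_sub_loop_div_puncture_mem_slitPlane m hs hj₀ hj
    rw [sub_eq_zero.mp h, div_self (puncture_ne_zero m j), sub_self] at this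
    exact Complex.zero_notMem_slitPlane this

/-- The pullback of `dz / (z - p_j)` to the loop. -/
def logForm (j : ℕ) (s : ℝ) : ℂ := (loop m s - puncture m j)⁻¹ * deriv (loop m) s

theorem continuousOn_logForm {j : ℕ} (hj : j < 2 * m + 2) :
    ContinuousOn (logForm m j) (Set.Icc 0 1) :=
  (((continuous_loop m).continuousOn.sub continuousOn_const).inv₀ fun _ hs =>
    loop_sub_puncture_ne_zero m hs hj).mul (continuous_deriv_loop m).continuousOn

theorem integral_logForm_eq_sub_log {a b : ℝ} (hab : a ≤ b) {j : ℕ} {c : ℂ} (hc : c ≠ 0)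
    (h : ∀ s ∈ Set.Icc a b, c * (loop m s - puncture m j) ∈ Complex.slitPlane) :
    ∫ s in a..b, logForm m j s =
      Complex.log (c * (loop m b - puncture m j)) - Complex.log (c * (loop m a - puncture m j)) :=
  integral_inv_mul_deriv_eq_sub_log hab (fun s _ => (hasDerivAt_loop m s).sub_const _)
    (continuous_deriv_loop m).continuousOn hc h

theorem integral_logForm_zero : ∫ s in (0 : ℝ)..1, logForm m 0 s = 2 * Real.pi * Complex.I := by
  have integrable : ∀ a ∈ Set.Icc (0 : ℝ) 1, ∀ b ∈ Set.Icc (0 : ℝ) 1,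
      IntervalIntegrable (logForm m 0) MeasureTheory.volume a b := fun a ha b hb =>
    ((continuousOn_logForm m (Nat.succ_pos _)).mono (Set.uIcc_subset_Icc ha hb)).intervalIntegrable
  have lower_half : ∫ s in (0 : ℝ)..1 / 2, logForm m 0 s = Real.pi * Complex.I := by
    rw [integral_logForm_eq_sub_log m (by norm_num) Complex.I_ne_zero fun s hs => by
        rw [puncture_zero]
        exact I_mul_loop_sub_one_mem_slitPlane m hs,
      puncture_zero, loop_zero, loop_one_half, show Complex.I * (2 - 1) = Complex.I by ring,
      show Complex.I * (0 - 1) = -Complex.I by ring, Complex.log_I, Complex.log_neg_I]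
    ring
  have upper_half : ∫ s in (1 / 2 : ℝ)..1, logForm m 0 s = Real.pi * Complex.I := by
    rw [integral_logForm_eq_sub_log m (by norm_num) (neg_ne_zero.mpr Complex.I_ne_zero)
        fun s hs => by
        rw [puncture_zero]
        exact neg_I_mul_loop_sub_one_mem_slitPlane m hs,
      puncture_zero, loop_one, loop_one_half, show -Complex.I * (2 - 1) = -Complex.I by ring,
      show -Complex.I * (0 - 1) = Complex.I by ring, Complex.log_I, Complex.log_neg_I]
    ring
  rw [← intervalIntegral.integral_add_adjacent_intervals (b := 1 / 2)
    (integrable _ (by norm_num) _ (by norm_num)) (integrable _ (by norm_num) _ (by norm_num)),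
    lower_half, upper_half]
  ring

theorem integral_logForm_of_pos {j : ℕ} (hj₀ : 0 < j) (hj : j < 2 * m + 2) :
    ∫ s in (0 : ℝ)..1, logForm m j s = 0 := by
  have hp := puncture_ne_zero m j
  rw [integral_logForm_eq_sub_log m zero_le_one (neg_ne_zero.mpr (inv_ne_zero hp)) fun s hs => ?_,
    loop_one, loop_zero, sub_self]
  convert one_sub_loop_div_puncture_mem_slitPlane m hs hj₀ hj using 1
  field_simp
  ring

theorem integral_loop_pow_mul_deriv (k : ℕ) :
    ∫ s in (0 : ℝ)..1, loop m s ^ k * deriv (loop m) s = 0 := by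
  have hk : (k : ℂ) + 1 ≠ 0 := Nat.cast_add_one_ne_zero k
  have cont : Continuous fun s => loop m s ^ k * deriv (loop m) s :=
    ((continuous_loop m).pow k).mul (continuous_deriv_loop m)
  rw [intervalIntegral.integral_eq_sub_of_hasDerivAt
    (f := fun s => loop m s ^ (k + 1) / (k + 1)) (fun s _ => ?_) (cont.intervalIntegrable _ _),
    loop_one, loop_zero, sub_self]
  have h := ((hasDerivAt_loop m s).pow (k + 1)).div_const ((k : ℂ) + 1)
  rwa [Nat.add_sub_cancel, Nat.cast_add_one, mul_assoc, mul_div_cancel_left₀ _ hk] at h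

theorem integral_loop_pow_mul_logForm {j : ℕ} (hj : j < 2 * m + 2) (k : ℕ) :
    ∫ s in (0 : ℝ)..1, loop m s ^ k * logForm m j s =
      puncture m j ^ k * ∫ s in (0 : ℝ)..1, logForm m j s := by
  induction k with
  | zero => simp only [pow_zero, one_mul]
  | succ k ih =>
    have split : Set.EqOn (fun s => loop m s ^ (k + 1) * logForm m j s)
        (fun s => loop m s ^ k * deriv (loop m) s +
          puncture m j * (loop m s ^ k * logForm m j s)) (Set.uIcc 0 1) := fun s hs => by
      rw [Set.uIcc_of_le zero_le_one] at hs
      have := loop_sub_puncture_ne_zero m hs hj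
      simp only [logForm]
      field_simp
      ring
    rw [intervalIntegral.integral_congr split, intervalIntegral.integral_add,
      integral_loop_pow_mul_deriv, intervalIntegral.integral_const_mul, ih, zero_add, pow_succ',
      mul_assoc]
    · exact (((continuous_loop m).pow k).mul (continuous_deriv_loop m)).intervalIntegrable _ _
    · refine ContinuousOn.intervalIntegrable ?_
      rw [Set.uIcc_of_le zero_le_one]
      exact continuousOn_const.mul (((continuous_loop m).pow k).continuousOn.mul
        (continuousOn_logForm m hj))

end Loop

theorem W.conj_eval (f : W ρ) (l : ℂ) :
    starRingEnd ℂ (f.eval l) = f.eval (starRingEnd ℂ l) := by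
  rw [W.eval, W.eval, Complex.conj_tsum]
  refine tsum_congr fun k => ?_
  rw [map_mul, map_pow, Complex.conj_ofReal]

section Residue

variable (m : ℕ)

/-- The square `exp(2πim/n)` of the first diagonal entry of `D`. -/
def twist : ℂ := Complex.exp ((2 * Real.pi * m / (2 * m + 2 : ℕ) : ℝ) * Complex.I)

theorem card_ne_zero : ((2 * m + 2 : ℕ) : ℂ) ≠ 0 := Nat.cast_ne_zero.mpr (by omega)

theorem twist_pow_card : twist m ^ (2 * m + 2) = 1 := by
  have := card_ne_zero m
  rw [twist, ← Complex.exp_nat_mul, Complex.exp_eq_one_iff]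
  refine ⟨m, ?_⟩
  push_cast at this ⊢
  field_simp

theorem conj_twist : starRingEnd ℂ (twist m) = (twist m)⁻¹ := by
  rw [twist, ← Complex.exp_conj, map_mul, Complex.conj_ofReal, Complex.conj_I, mul_neg,
    Complex.exp_neg]

theorem puncture_card : puncture m (2 * m + 2) = puncture m 0 := by
  rw [puncture_zero, puncture, mul_div_assoc, div_self (card_ne_zero m), mul_one,
    Complex.exp_two_pi_mul_I]

theorem conj_puncture {j : ℕ} (hj : j ≤ 2 * m + 2) :
    starRingEnd ℂ (puncture m j) = puncture m (2 * m + 2 - j) := by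
  have := card_ne_zero m
  rw [puncture_eq, puncture, ← Complex.exp_conj, map_mul, Complex.conj_ofReal, Complex.conj_I,
    Complex.exp_eq_exp_iff_exists_int]
  refine ⟨-1, ?_⟩
  rw [Nat.cast_sub hj]
  push_cast at this ⊢
  field_simp
  ring

theorem inv_diagonal_mul_mul {u v : ℂ} (huv : u * v = 1) (p q r s : ℂ) :
    !![u, 0; 0, v]⁻¹ * !![p, q; r, s] * !![u, 0; 0, v] =
      !![p, (u * u)⁻¹ * q; u * u * r, s] := by
  have inv_diagonal : !![u, 0; 0, v]⁻¹ = !![v, 0; 0, u] :=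
    Matrix.inv_eq_right_inv (by simp [Matrix.one_fin_two, huv, mul_comm v])
  rw [inv_diagonal, mul_inv, DivisionMonoid.inv_eq_of_mul u v huv]
  simp only [Matrix.mul_fin_two, mul_zero, zero_mul, add_zero, zero_add]
  congrm !![?_, ?_; ?_, ?_]
  · linear_combination p * huv
  · ring
  · ring
  · linear_combination s * huv

theorem symD_inv_mul_mul (p q r s : ℂ) : (symD m)⁻¹ * !![p, q; r, s] * symD m =
    !![p, (twist m)⁻¹ * q; twist m * r, s] := by
  rw [symD, inv_diagonal_mul_mul (by rw [← Complex.exp_add, add_neg_cancel, Complex.exp_zero]),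
    ← Complex.exp_add, twist]
  push_cast
  ring_nf

theorem residue_eq (x : Param ρ) (j : ℕ) (l : ℂ) : residue m x j l =
    !![x.a.eval ((-1) ^ j * l), (twist m ^ j)⁻¹ * (((-1) ^ j * l)⁻¹ * x.b.eval ((-1) ^ j * l));
      twist m ^ j * (((-1) ^ j * l) * x.c.eval ((-1) ^ j * l)), -x.a.eval ((-1) ^ j * l)] := by
  induction j generalizing l with
  | zero => simp only [residue, pow_zero, one_mul, inv_one]
  | succ j ih =>
    rw [residue, ih, symD_inv_mul_mul, show (-1 : ℂ) ^ j * -l = (-1) ^ (j + 1) * l by ring,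
      ← mul_assoc (twist m)⁻¹, ← mul_inv, ← mul_assoc (twist m), ← pow_succ']

theorem residue_card (x : Param ρ) (l : ℂ) : residue m x (2 * m + 2) l = residue m x 0 l := by
  rw [residue_eq, residue_eq, twist_pow_card, pow_zero, pow_zero,
    Even.neg_one_pow ⟨m + 1, by ring⟩]

theorem conj_residue (x : Param ρ) {j : ℕ} (hj : j ≤ 2 * m + 2) (l : ℂ) :
    (residue m x j l).map (starRingEnd ℂ) =
      residue m x (2 * m + 2 - j) (starRingEnd ℂ l) := by
  have twist_pow_sub : twist m ^ (2 * m + 2 - j) = (twist m ^ j)⁻¹ :=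
    eq_inv_of_mul_eq_one_left (by rw [← pow_add, Nat.sub_add_cancel hj, twist_pow_card])
  have neg_one_pow_sub : (-1 : ℂ) ^ (2 * m + 2 - j) = (-1) ^ j :=
    neg_one_pow_congr (by grind)
  rw [residue_eq, residue_eq, twist_pow_sub, neg_one_pow_sub]
  ext i k
  fin_cases i <;> fin_cases k <;> simp [W.conj_eval, conj_twist]

theorem conj_sum_residue (x : Param ρ) (z l : ℂ) :
    (∑ j ∈ Finset.range (2 * m + 2), (z - puncture m j)⁻¹ • residue m x j l).map
        (starRingEnd ℂ) =
      ∑ j ∈ Finset.range (2 * m + 2),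
        (starRingEnd ℂ z - puncture m j)⁻¹ • residue m x j (starRingEnd ℂ l) := by
  set pole : ℕ → Matrix (Fin 2) (Fin 2) ℂ := fun j =>
    (starRingEnd ℂ z - puncture m j)⁻¹ • residue m x j (starRingEnd ℂ l)
  have conj_pole : ∀ j ≤ 2 * m + 2,
      ((z - puncture m j)⁻¹ • residue m x j l).map (starRingEnd ℂ) =
        pole (2 * m + 2 - j) := fun j hj => by
    rw [Matrix.map_smul' _ _ _ fun a b => map_mul _ a b, conj_residue m x hj, map_inv₀, map_sub,
      conj_puncture m hj]
  have periodic : pole (2 * m + 2) = pole 0 := by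
    simp only [pole, puncture_card, residue_card]
  have shift : ∑ j ∈ Finset.range (2 * m + 2), pole (j + 1) =
      ∑ j ∈ Finset.range (2 * m + 2), pole j := by
    rw [← add_left_inj (pole 0), ← Finset.sum_range_succ', Finset.sum_range_succ, periodic]
  rw [← shift, ← RingHom.mapMatrix_apply, map_sum, ← Finset.sum_range_reflect]
  refine Finset.sum_congr rfl fun j hj => ?_
  have := Finset.mem_range.mp hj
  rw [RingHom.mapMatrix_apply, conj_pole _ (by omega)]
  congr 1
  omega

theorem conj_potential (t : ℝ) (x : Param ρ) (z l : ℂ) :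
    (potential m t x z l).map (starRingEnd ℂ) =
      potential m t x (starRingEnd ℂ z) (starRingEnd ℂ l) := by
  rw [potential, potential, Matrix.map_add _ (map_add _),
    Matrix.map_smul' _ _ _ fun a b => map_mul _ a b, conj_sum_residue, Complex.conj_ofReal]
  congr 1
  ext i k
  fin_cases i <;> fin_cases k <;> simp

end Residue

theorem eqOn_of_hasDerivWithinAt_mul {A : Type*} [NormedRing A] [NormedAlgebra ℝ A] {a b : ℝ}
    {C Y Z : ℝ → A} (hC : ContinuousOn C (Set.Icc a b))
    (hY : ∀ s ∈ Set.Icc a b, HasDerivWithinAt Y (Y s * C s) (Set.Icc a b) s)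
    (hZ : ∀ s ∈ Set.Icc a b, HasDerivWithinAt Z (Z s * C s) (Set.Icc a b) s)
    (ha : Y a = Z a) : Set.EqOn Y Z (Set.Icc a b) := by
  obtain ⟨K, hK⟩ := isCompact_Icc.exists_bound_of_continuousOn hC
  have lipschitz : ∀ s ∈ Set.Ico a b,
      LipschitzOnWith K.toNNReal (fun y => y * C s) Set.univ := fun s hs =>
    LipschitzOnWith.of_dist_le_mul fun y _ z _ => by
      rw [dist_eq_norm, dist_eq_norm, ← sub_mul, mul_comm _ ‖y - z‖]
      refine (norm_mul_le _ _).trans (mul_le_mul_of_nonneg_left ?_ (norm_nonneg _))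
      exact (hK s ⟨hs.1, hs.2.le⟩).trans (Real.le_coe_toNNReal K)
  have right_derivative : ∀ {X : ℝ → A},
      (∀ s ∈ Set.Icc a b, HasDerivWithinAt X (X s * C s) (Set.Icc a b) s) →
      ∀ s ∈ Set.Ico a b, HasDerivWithinAt X (X s * C s) (Set.Ici s) s := fun hX s hs =>
    (hX s ⟨hs.1, hs.2.le⟩).mono_of_mem_nhdsWithin (Icc_mem_nhdsGE_of_mem hs)
  exact ODE_solution_unique_of_mem_Icc_right (v := fun s y => y * C s) (s := fun _ => Set.univ)
    lipschitz (fun s hs => (hY s hs).continuousWithinAt) (right_derivative hY)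
    (fun _ _ => Set.mem_univ _) (fun s hs => (hZ s hs).continuousWithinAt) (right_derivative hZ)
    (fun _ _ => Set.mem_univ _) ha

section

attribute [local instance] Matrix.linftyOpNormedRing Matrix.linftyOpNormedAlgebra

theorem eqOn_of_hasDerivWithinAt_matrix_mul {ι : Type*} [Fintype ι] {a b : ℝ}
    {C Y Z : ℝ → Matrix ι ι ℂ} (hC : ∀ i j, ContinuousOn (fun s => C s i j) (Set.Icc a b))
    (hY : ∀ s ∈ Set.Icc a b, ∀ i j,
      HasDerivWithinAt (fun u => Y u i j) ((Y s * C s) i j) (Set.Icc a b) s)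
    (hZ : ∀ s ∈ Set.Icc a b, ∀ i j,
      HasDerivWithinAt (fun u => Z u i j) ((Z s * C s) i j) (Set.Icc a b) s)
    (ha : Y a = Z a) : Set.EqOn Y Z (Set.Icc a b) := by
  classical
  exact eqOn_of_hasDerivWithinAt_mul
    (continuousOn_pi.mpr fun i => continuousOn_pi.mpr fun j => hC i j)
    (fun s hs => hasDerivWithinAt_pi.mpr fun i => hasDerivWithinAt_pi.mpr fun j => hY s hs i j)
    (fun s hs => hasDerivWithinAt_pi.mpr fun i => hasDerivWithinAt_pi.mpr fun j => hZ s hs i j) ha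

end

section Monodromy

variable (m : ℕ)

/-- The coefficient matrix of the differential equation along the loop. -/
def loopCoeff (t : ℝ) (x : Param ρ) (l : ℂ) (s : ℝ) : Matrix (Fin 2) (Fin 2) ℂ :=
  deriv (loop m) s • potential m t x (loop m s) l

theorem continuousOn_loopCoeff (t : ℝ) (x : Param ρ) (l : ℂ) :
    ContinuousOn (loopCoeff m t x l) (Set.Icc 0 1) := by
  have regular : Continuous fun s =>
      (!![0, 0; (m : ℂ) * x.r * loop m s ^ (m - 1), 0] : Matrix (Fin 2) (Fin 2) ℂ) := by
    have lower_left := ((continuous_loop m).pow (m - 1)).const_mul ((m : ℂ) * x.r)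
    refine continuous_matrix fun i j => ?_
    fin_cases i <;> fin_cases j <;> first | exact continuous_const | exact lower_left
  have poles : ContinuousOn (fun s => ∑ j ∈ Finset.range (2 * m + 2),
      (loop m s - puncture m j)⁻¹ • residue m x j l) (Set.Icc 0 1) :=
    continuousOn_finsetSum _ fun j hj =>
      (((continuous_loop m).continuousOn.sub continuousOn_const).inv₀ fun _ hs =>
        loop_sub_puncture_ne_zero m hs (Finset.mem_range.mp hj)).smul continuousOn_const
  exact (continuous_deriv_loop m).continuousOn.smul
    (regular.continuousOn.add (poles.const_smul (t : ℂ)))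

theorem IsSolutionAlongLoop.unique {t : ℝ} {x : Param ρ} {l : ℂ}
    {Y Z : ℝ → Matrix (Fin 2) (Fin 2) ℂ} (hY : IsSolutionAlongLoop m t x l Y)
    (hZ : IsSolutionAlongLoop m t x l Z) : Set.EqOn Y Z (Set.Icc 0 1) :=
  eqOn_of_hasDerivWithinAt_matrix_mul (C := loopCoeff m t x l)
    (fun i j => (continuous_id.matrix_elem i j).comp_continuousOn (continuousOn_loopCoeff m t x l))
    hY.2 hZ.2 (hY.1.trans hZ.1.symm)

theorem monodromy_eq {t : ℝ} {x : Param ρ} {l : ℂ} {Y : ℝ → Matrix (Fin 2) (Fin 2) ℂ}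
    (hY : IsSolutionAlongLoop m t x l Y) : monodromy m t x l = Y 1 := by
  have h : ∃ Y, IsSolutionAlongLoop m t x l Y := ⟨Y, hY⟩
  rw [monodromy, dif_pos h]
  exact h.choose_spec.unique m hY ⟨zero_le_one, le_rfl⟩

theorem conj_loopCoeff (t : ℝ) (x : Param ρ) (l : ℂ) (s : ℝ) :
    (loopCoeff m t x (starRingEnd ℂ l) (1 - s)).map (starRingEnd ℂ) = -loopCoeff m t x l s := by
  rw [loopCoeff, Matrix.map_smul' _ _ _ fun a b => map_mul _ a b, conj_potential,
    conj_deriv_loop_one_sub, loop_one_sub, Complex.conj_conj, Complex.conj_conj, neg_smul,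
    loopCoeff]

theorem hasDerivWithinAt_conj_solution_one_sub {t : ℝ} {x : Param ρ} {l : ℂ}
    {Y : ℝ → Matrix (Fin 2) (Fin 2) ℂ} (hY : IsSolutionAlongLoop m t x (starRingEnd ℂ l) Y)
    {s : ℝ} (hs : s ∈ Set.Icc (0 : ℝ) 1) (i j : Fin 2) :
    HasDerivWithinAt (fun u => (Y (1 - u)).map (starRingEnd ℂ) i j)
      (((Y (1 - s)).map (starRingEnd ℂ) * loopCoeff m t x l s) i j) (Set.Icc 0 1) s := by
  have reversed := ((hY.2 (1 - s) ⟨by linarith [hs.2], by linarith [hs.1]⟩ i j).scomp s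
    (((hasDerivAt_id s).const_sub 1).hasDerivWithinAt (s := Set.Icc (0 : ℝ) 1))
    fun u hu => ⟨by simpa using hu.2, by simpa using hu.1⟩).star
  refine reversed.congr_deriv ?_
  rw [neg_one_smul, star_neg, neg_eq_iff_eq_neg, ← Matrix.neg_apply, ← mul_neg, ← conj_loopCoeff,
    ← Matrix.map_mul, Matrix.map_apply]
  rfl

theorem conj_monodromy_mul {t : ℝ} {x : Param ρ} {l : ℂ}
    (hl : ∃ Y, IsSolutionAlongLoop m t x l Y)
    (hl' : ∃ Y, IsSolutionAlongLoop m t x (starRingEnd ℂ l) Y) :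
    (monodromy m t x (starRingEnd ℂ l)).map (starRingEnd ℂ) * monodromy m t x l = 1 := by
  obtain ⟨Y, hY⟩ := hl'
  obtain ⟨V, hV⟩ := hl
  have translated : ∀ s ∈ Set.Icc (0 : ℝ) 1, ∀ i j,
      HasDerivWithinAt (fun u => ((Y 1).map (starRingEnd ℂ) * V u) i j)
        (((Y 1).map (starRingEnd ℂ) * V s * loopCoeff m t x l s) i j) (Set.Icc 0 1) s :=
    fun s hs i j => by
      simp only [Matrix.mul_assoc]
      simp only [Matrix.mul_apply (M := (Y 1).map (starRingEnd ℂ))]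
      exact HasDerivWithinAt.fun_sum fun k _ => (hV.2 s hs k j).const_mul _
  -- Reversing the loop and conjugating solves the same equation as `V`, from `conj (Y 1)`.
  have conj_reversed_eq := eqOn_of_hasDerivWithinAt_matrix_mul
    (fun i j => (continuous_id.matrix_elem i j).comp_continuousOn (continuousOn_loopCoeff m t x l))
    (fun s hs i j => hasDerivWithinAt_conj_solution_one_sub m hY hs i j) translated
    (by rw [sub_zero, hV.1, mul_one])
  have at_one := conj_reversed_eq (Set.right_mem_Icc.mpr zero_le_one)
  simp only [sub_self, hY.1] at at_one
  rw [monodromy_eq m hY, monodromy_eq m hV, ← at_one]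
  exact map_one (starRingEnd ℂ).mapMatrix

end Monodromy

section Parity

variable (m : ℕ)

/-- The parameter `(r, -a(-λ), b(-λ), c(-λ))`. -/
def Param.parity (x : Param ρ) : Param ρ :=
  (x.r, -W.substNeg x.a, W.substNeg x.b, W.substNeg x.c)

theorem Param.parity_r (x : Param ρ) : x.parity.r = x.r := rfl

theorem Param.parity_a (x : Param ρ) : x.parity.a = -W.substNeg x.a := rfl

theorem Param.parity_b (x : Param ρ) : x.parity.b = W.substNeg x.b := rfl

theorem Param.parity_c (x : Param ρ) : x.parity.c = W.substNeg x.c := rfl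

theorem W.eval_neg (f : W ρ) (l : ℂ) : (-f).eval l = -f.eval l := by
  simp only [W.eval, W.coeff_neg, Complex.ofReal_neg, neg_mul, tsum_neg]

theorem continuous_parity : Continuous (Param.parity : Param ρ → Param ρ) := by
  unfold Param.parity Param.r Param.a Param.b Param.c
  fun_prop

theorem residue_parity (x : Param ρ) (j : ℕ) (l : ℂ) :
    residue m x.parity j l = -residue m x j (-l) := by
  rw [residue_eq, residue_eq, Param.parity_a, Param.parity_b, Param.parity_c, W.eval_neg,
    W.eval_substNeg, W.eval_substNeg, W.eval_substNeg]
  ext i k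
  fin_cases i <;> fin_cases k <;> simp [inv_neg]

theorem potential_parity (t : ℝ) (x : Param ρ) (z l : ℂ) :
    potential m t x.parity z l = potential m (-t) x z (-l) := by
  simp only [potential, residue_parity, Param.parity_r, smul_neg, Finset.sum_neg_distrib,
    Complex.ofReal_neg, neg_smul]

theorem monodromy_parity (t : ℝ) (x : Param ρ) (l : ℂ) :
    monodromy m t x.parity l = monodromy m (-t) x (-l) := by
  have : IsSolutionAlongLoop m t x.parity l = IsSolutionAlongLoop m (-t) x (-l) := by
    funext Y
    simp only [IsSolutionAlongLoop, potential_parity]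
  rw [monodromy, monodromy, this]

theorem logMonodromy_parity (t : ℝ) (x : Param ρ) (l : ℂ) :
    logMonodromy m t x.parity l = -logMonodromy m (-t) x (-l) := by
  rcases eq_or_ne t 0 with rfl | ht
  · rw [logMonodromy, if_pos rfl, logMonodromy, if_pos neg_zero]
    ext i j
    simp only [monodromy_parity, Matrix.of_apply, Matrix.neg_apply]
    rw [deriv_comp_neg (fun s : ℝ => monodromy m s x (-l) i j), neg_zero]
  · rw [logMonodromy, if_neg ht, logMonodromy, if_neg (neg_ne_zero.mpr ht), monodromy_parity,
      Complex.ofReal_neg, inv_neg, neg_smul, neg_neg]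

theorem starInv_comp_neg (f : ℂ → ℂ) (l : ℂ) : starInv (fun u => f (-u)) l = starInv f (-l) := by
  rw [starInv, starInv, map_neg, div_neg]

theorem starInv_neg (f : ℂ → ℂ) (l : ℂ) : starInv (fun u => -f u) l = -starInv f l := by
  rw [starInv, map_neg, starInv]

theorem calF_parity (t : ℝ) (x : Param ρ) (l : ℂ) :
    calF m t x.parity l = -calF m (-t) x (-l) := by
  simp only [calF, logMonodromy_parity, Matrix.neg_apply, starInv_neg,
    starInv_comp_neg fun u => logMonodromy m (-t) x u 0 0]
  ring

theorem calG_parity (t : ℝ) (x : Param ρ) (l : ℂ) :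
    calG m t x.parity l = -calG m (-t) x (-l) := by
  simp only [calG, logMonodromy_parity, Matrix.neg_apply, starInv_neg,
    starInv_comp_neg fun u => logMonodromy m (-t) x u 0 1]
  ring

theorem calH₁_parity (t : ℝ) (x : Param ρ) : calH₁ m t x.parity = -calH₂ m (-t) x := by
  rw [calH₁, calH₂, logMonodromy_parity, Matrix.neg_apply, mul_neg]

theorem calH₂_parity (t : ℝ) (x : Param ρ) : calH₂ m t x.parity = -calH₁ m (-t) x := by
  rw [calH₁, calH₂, logMonodromy_parity, Matrix.neg_apply, mul_neg, neg_neg]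

theorem calK_parity (x : Param ρ) : calK x.parity = calK x := by
  simp only [calK, Param.parity_a, Param.parity_b, Param.parity_c, W.coeff_neg, W.coeff_substNeg,
    pow_zero, one_mul, neg_sq]

theorem SolvesMonodromyProblem.parity {t : ℝ} {x : Param ρ}
    (h : SolvesMonodromyProblem m (-t) x) : SolvesMonodromyProblem m t x.parity := by
  obtain ⟨hF, hG, h₁, h₂, hK⟩ := h
  refine ⟨fun l hl => ?_, fun l hl => ?_, ?_, ?_, ?_⟩
  · rw [calF_parity, hF _ (neg_mem_annulus hl), neg_zero]
  · rw [calG_parity, hG _ (neg_mem_annulus hl), neg_zero]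
  · rw [calH₁_parity, h₂, neg_zero]
  · rw [calH₂_parity, h₁, neg_zero]
  · rw [calK_parity, hK]

theorem W.eq_substNeg_of_eval_neg_eq {f g : W ρ}
    (h : ∀ l ∈ annulus ρ, g.eval (-l) = f.eval l) : g = W.substNeg f := by
  rw [← W.substNeg_substNeg g]
  congr 1
  exact W.eq_of_eval_eq_on_annulus fun l hl => by rw [W.eval_substNeg, h l hl]

theorem Param.eq_parity_of_eval {x y : Param ρ} (hr : y.r = x.r)
    (ha : ∀ l ∈ annulus ρ, y.a.eval (-l) = -x.a.eval l)
    (hb : ∀ l ∈ annulus ρ, y.b.eval (-l) = x.b.eval l)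
    (hc : ∀ l ∈ annulus ρ, y.c.eval (-l) = x.c.eval l) : y = x.parity := by
  have a_eq : y.a = -W.substNeg x.a := by
    rw [← map_neg]
    exact W.eq_substNeg_of_eval_neg_eq fun l hl => by rw [ha l hl, W.eval_neg]
  exact Prod.ext hr (Prod.ext a_eq (Prod.ext (W.eq_substNeg_of_eval_neg_eq hb)
    (W.eq_substNeg_of_eval_neg_eq hc)))

theorem paramParity_iff {x y : Param ρ} : ParamParity x y ↔ y = x.parity := by
  constructor
  · rintro ⟨ha, hb, hc, hr⟩
    exact Param.eq_parity_of_eval hr (fun l hl => ha l hl.2) (fun l hl => hb l hl.2)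
      fun l hl => hc l hl.2
  · rintro rfl
    refine ⟨fun l _ => ?_, fun l _ => ?_, fun l _ => ?_, rfl⟩
    · rw [Param.parity_a, W.eval_neg, W.eval_substNeg, neg_neg]
    · rw [Param.parity_b, W.eval_substNeg, neg_neg]
    · rw [Param.parity_c, W.eval_substNeg, neg_neg]

theorem potentialParity_parity (t : ℝ) (x : Param ρ) : PotentialParity m t x x.parity := by
  intro l _ z _
  rw [potential_parity, neg_neg, neg_neg]

theorem puncture_ne_one {j : ℕ} (hj₀ : 0 < j) (hj : j < 2 * m + 2) : puncture m j ≠ 1 := by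
  intro h
  -- The point `2 = γ₀(1/2)` lies on the ray from `0` through `1`.
  have off_ray := one_sub_loop_div_puncture_mem_slitPlane m (s := 1 / 2) (by norm_num) hj₀ hj
  rw [loop_one_half, h, Complex.mem_slitPlane_iff] at off_ray
  norm_num at off_ray

theorem eventually_ne_puncture :
    ∀ᶠ z in 𝓝[≠] (1 : ℂ), ∀ j < 2 * m + 2, z ≠ puncture m j := by
  have finite : (puncture m '' Set.Iio (2 * m + 2) \ {1}).Finite :=
    ((Set.finite_Iio _).image _).sdiff
  filter_upwards [nhdsWithin_le_nhds (finite.isClosed.isOpen_compl.mem_nhds (x := 1) (by simp)),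
    self_mem_nhdsWithin] with z hz hz₁ j hj rfl
  exact hz ⟨⟨j, hj, rfl⟩, hz₁⟩

theorem tendsto_sub_one_smul_potential (t : ℝ) (x : Param ρ) (l : ℂ) :
    Filter.Tendsto (fun z => (z - 1) • potential m t x z l) (𝓝[≠] 1)
      (𝓝 ((t : ℂ) • residue m x 0 l)) := by
  have regular : ContinuousAt (fun z : ℂ =>
      (!![0, 0; (m : ℂ) * x.r * z ^ (m - 1), 0] : Matrix (Fin 2) (Fin 2) ℂ)) 1 := by
    have lower_left : Continuous fun z : ℂ => (m : ℂ) * x.r * z ^ (m - 1) := by fun_prop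
    refine (continuous_matrix fun i j => ?_).continuousAt
    fin_cases i <;> fin_cases j <;> first | exact continuous_const | exact lower_left
  have other_poles : ContinuousAt (fun z : ℂ => ∑ j ∈ Finset.range (2 * m + 1),
      (z - puncture m (j + 1))⁻¹ • residue m x (j + 1) l) 1 :=
    tendsto_finsetSum _ fun j hj => ((continuousAt_id.sub continuousAt_const).inv₀
      (sub_ne_zero.mpr (puncture_ne_one m j.succ_pos
        (by have := Finset.mem_range.mp hj; omega)).symm)).smul continuousAt_const
  have extension : ContinuousAt (fun z : ℂ => (z - 1) •
      (!![0, 0; (m : ℂ) * x.r * z ^ (m - 1), 0] + (t : ℂ) • ∑ j ∈ Finset.range (2 * m + 1),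
        (z - puncture m (j + 1))⁻¹ • residue m x (j + 1) l) + (t : ℂ) • residue m x 0 l) 1 :=
    ((continuousAt_id.sub continuousAt_const).smul
      (regular.add (other_poles.const_smul (t : ℂ)))).add continuousAt_const
  have limit := extension.tendsto.mono_left (nhdsWithin_le_nhds (s := {1}ᶜ))
  simp only [sub_self, zero_smul, zero_add] at limit
  refine limit.congr' ?_
  filter_upwards [self_mem_nhdsWithin] with z hz
  rw [potential, Finset.sum_range_succ' _ (2 * m + 1), puncture_zero, smul_add (t : ℂ),
    smul_comm (t : ℂ), ← add_assoc, smul_add (z - 1) (_ + _) (_ • _),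
    smul_inv_smul₀ (sub_ne_zero.mpr hz)]

theorem PotentialParity.residue_zero_eq {t : ℝ} (ht : t ≠ 0) {x y : Param ρ}
    (h : PotentialParity m t x y) {l : ℂ} (hl : l ∈ annulus ρ) :
    residue m y 0 (-l) = -residue m x 0 l := by
  have limit := tendsto_sub_one_smul_potential m (-t) y (-l)
  have limits_eq := tendsto_nhds_unique (tendsto_sub_one_smul_potential m t x l) <|
    limit.congr' <| by
      filter_upwards [eventually_ne_puncture m] with z hz
      rw [h l hl z hz]
  rw [Complex.ofReal_neg, neg_smul, ← smul_neg] at limits_eq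
  rw [smul_right_injective _ (Complex.ofReal_ne_zero.mpr ht) limits_eq, neg_neg]

theorem PotentialParity.residue_eq {t : ℝ} (ht : t ≠ 0) {x y : Param ρ}
    (h : PotentialParity m t x y) (j : ℕ) {l : ℂ} (hl : l ∈ annulus ρ) :
    residue m y j (-l) = -residue m x j l := by
  induction j generalizing l with
  | zero => exact h.residue_zero_eq m ht hl
  | succ j ih => rw [residue, residue, ih (neg_mem_annulus hl), mul_neg, neg_mul]

theorem PotentialParity.r_eq (hm : 1 ≤ m) {t : ℝ} (ht : t ≠ 0) {x y : Param ρ}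
    (h : PotentialParity m t x y) : y.r = x.r := by
  have one_mem : (1 : ℂ) ∈ annulus ρ := mem_annulus_of_norm_eq_one norm_one
  have two_ne : ∀ j < 2 * m + 2, (2 : ℂ) ≠ puncture m j := fun j _ hj => by
    have := congrArg norm hj
    norm_num [norm_puncture] at this
  have at_two := congrFun (congrFun (h 1 one_mem 2 two_ne) 1) 0
  simp only [potential, h.residue_eq m ht _ one_mem, smul_neg, Finset.sum_neg_distrib,
    Complex.ofReal_neg, neg_smul, neg_neg, Matrix.add_apply, add_left_inj] at at_two
  have r_eq : (m : ℂ) * y.r * 2 ^ (m - 1) = (m : ℂ) * x.r * 2 ^ (m - 1) := at_two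
  have m_ne_zero : (m : ℂ) ≠ 0 := Nat.cast_ne_zero.mpr (by omega)
  exact_mod_cast mul_left_cancel₀ m_ne_zero
    (mul_right_cancel₀ (pow_ne_zero (m - 1) two_ne_zero) r_eq)

theorem PotentialParity.eq_parity (hm : 1 ≤ m) {t : ℝ} (ht : t ≠ 0) {x y : Param ρ}
    (h : PotentialParity m t x y) : y = x.parity := by
  have entry_eq : ∀ l ∈ annulus ρ, ∀ i k, residue m y 0 (-l) i k = -residue m x 0 l i k :=
    fun l hl i k => by rw [h.residue_zero_eq m ht hl, Matrix.neg_apply]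
  refine Param.eq_parity_of_eval (h.r_eq m hm ht) (fun l hl => entry_eq l hl 0 0)
    (fun l hl => ?_) fun l hl => ?_
  · have upper_right : (-l)⁻¹ * y.b.eval (-l) = -(l⁻¹ * x.b.eval l) := entry_eq l hl 0 1
    rw [inv_neg, neg_mul, neg_inj] at upper_right
    exact mul_left_cancel₀ (inv_ne_zero (ne_zero_of_mem_annulus hl)) upper_right
  · have lower_left : (-l) * y.c.eval (-l) = -(l * x.c.eval l) := entry_eq l hl 1 0
    rw [neg_mul, neg_inj] at lower_left
    exact mul_left_cancel₀ (ne_zero_of_mem_annulus hl) lower_left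

end Parity

/-- The Banach algebra of `2 × 2` matrices of Laurent series, with the operator norm for the sup
norm on columns. -/
def LoopMat (ρ : ℝ) [Fact (1 < ρ)] : Type := Matrix (Fin 2) (Fin 2) (Laurent ρ)

namespace LoopMat

instance : NormedRing (LoopMat ρ) :=
  (Matrix.linftyOpNormedRing : NormedRing (Matrix (Fin 2) (Fin 2) (Laurent ρ)))

instance : NormedAlgebra ℂ (LoopMat ρ) :=
  @Matrix.linftyOpNormedAlgebra ℂ (Fin 2) (Laurent ρ) _ _ _ _ _

instance : CompleteSpace (LoopMat ρ) :=
  inferInstanceAs (CompleteSpace (Matrix (Fin 2) (Fin 2) (Laurent ρ)))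

/-- The `(i, j)` entry, as a continuous linear map. -/
def entryL (i j : Fin 2) : LoopMat ρ →L[ℂ] Laurent ρ where
  toFun X := (X : Matrix (Fin 2) (Fin 2) (Laurent ρ)) i j
  map_add' _ _ := rfl
  map_smul' _ _ := rfl
  cont := (continuous_id (X := Matrix (Fin 2) (Fin 2) (Laurent ρ))).matrix_elem i j

/-- Entrywise evaluation at a point of the annulus. -/
def eval {l : ℂ} (hl : l ∈ annulus ρ) : LoopMat ρ →A[ℂ] Matrix (Fin 2) (Fin 2) ℂ :=
  { (Laurent.eval hl : Laurent ρ →ₐ[ℂ] ℂ).mapMatrix with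
    cont := continuous_matrix fun i j => (Laurent.eval hl).continuous.comp (entryL i j).continuous }

theorem eval_apply {l : ℂ} (hl : l ∈ annulus ρ) (X : LoopMat ρ) (i j : Fin 2) :
    eval hl X i j = Laurent.eval hl (entryL i j X) := rfl

/-- Matrices of complex numbers, as constant loops. -/
def const : Matrix (Fin 2) (Fin 2) ℂ →ₐ[ℂ] LoopMat ρ := (Algebra.ofId ℂ (Laurent ρ)).mapMatrix

theorem eval_const {l : ℂ} (hl : l ∈ annulus ρ) (X : Matrix (Fin 2) (Fin 2) ℂ) :
    eval hl (const X) = X := by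
  ext i j
  exact AlgHomClass.commutes (Laurent.eval hl) (X i j)

end LoopMat

/-- `Param.parity` as a continuous linear map. -/
def Param.parityL : Param ρ →L[ℝ] Param ρ where
  toFun := Param.parity
  map_add' x y := by
    simp only [Param.parity, Param.r, Param.a, Param.b, Param.c, Prod.fst_add, Prod.snd_add,
      map_add, neg_add, Prod.mk_add_mk]
  map_smul' c x := by
    simp only [Param.parity, Param.r, Param.a, Param.b, Param.c, Prod.smul_fst, Prod.smul_snd,
      map_smul, Prod.smul_mk, smul_neg, RingHom.id_apply]
  cont := continuous_parity

/-- The residue `A_0` as a matrix of Laurent series, linear in the parameters. -/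
def residueZeroL : Param ρ →L[ℝ] LoopMat ρ where
  toFun x := (!![W.toLaurent x.a, Laurent.T (-1) * W.toLaurent x.b;
    Laurent.T 1 * W.toLaurent x.c, -W.toLaurent x.a] : Matrix (Fin 2) (Fin 2) (Laurent ρ))
  map_add' x y := by
    refine Matrix.ext fun i k => ?_
    simp only [Param.a, Param.b, Param.c, Prod.fst_add, Prod.snd_add, map_add, mul_add, neg_add]
    fin_cases i <;> fin_cases k <;> rfl
  map_smul' c x := by
    refine Matrix.ext fun i k => ?_
    simp only [Param.a, Param.b, Param.c, Prod.smul_fst, Prod.smul_snd, map_smul, mul_smul_comm,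
      ← smul_neg]
    fin_cases i <;> fin_cases k <;> rfl
  cont := by
    have a_cont : Continuous fun x : Param ρ => W.toLaurent x.a := by unfold Param.a; fun_prop
    have b_cont : Continuous fun x : Param ρ => W.toLaurent x.b := by unfold Param.b; fun_prop
    have c_cont : Continuous fun x : Param ρ => W.toLaurent x.c := by unfold Param.c; fun_prop
    refine continuous_matrix fun i k => ?_
    fin_cases i <;> fin_cases k
    exacts [a_cont, continuous_const.mul b_cont, continuous_const.mul c_cont, a_cont.neg]

/-- The residue `A_j` as a matrix of Laurent series, linear in the parameters. Since
`A_j(-λ) = -Â_j(λ)` for the parameter `x.parity`, the recursion `A_{j+1}(λ) = D⁻¹ A_j(-λ) D` needs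
no substitution in `λ`. -/
def residueL (m : ℕ) : ℕ → Param ρ →L[ℝ] LoopMat ρ
  | 0 => residueZeroL
  | j + 1 => -(ContinuousLinearMap.mulLeftRight ℝ (LoopMat ρ) (LoopMat.const (symD m)⁻¹)
      (LoopMat.const (symD m)) ∘L residueL m j ∘L Param.parityL)

theorem residueL_succ_apply (m j : ℕ) (x : Param ρ) : residueL m (j + 1) x =
    -(LoopMat.const (symD m)⁻¹ * residueL m j x.parity * LoopMat.const (symD m)) := rfl

theorem eval_residueZeroL (m : ℕ) (x : Param ρ) {l : ℂ} (hl : l ∈ annulus ρ) :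
    LoopMat.eval hl (residueZeroL x) = residue m x 0 l := by
  have eval_T_mul (k : ℤ) (f : W ρ) :
      Laurent.eval hl (Laurent.T k * W.toLaurent f) = l ^ k * f.eval l := by
    rw [map_mul, Laurent.eval_T, W.eval_toLaurent]
  have entries : residue m x 0 l =
      !![Laurent.eval hl (W.toLaurent x.a), Laurent.eval hl (Laurent.T (-1) * W.toLaurent x.b);
        Laurent.eval hl (Laurent.T 1 * W.toLaurent x.c), Laurent.eval hl (-W.toLaurent x.a)] := by
    rw [eval_T_mul, eval_T_mul, map_neg, W.eval_toLaurent, zpow_neg_one, zpow_one, residue]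
  exact (Matrix.eta_fin_two _).trans entries.symm

theorem eval_residueL (m j : ℕ) (x : Param ρ) {l : ℂ} (hl : l ∈ annulus ρ) :
    LoopMat.eval hl (residueL m j x) = residue m x j l := by
  induction j generalizing x with
  | zero => exact eval_residueZeroL m x hl
  | succ j ih =>
    rw [residueL_succ_apply, map_neg, map_mul, map_mul, ih, LoopMat.eval_const,
      LoopMat.eval_const, residue_parity, mul_neg, neg_mul, neg_neg, residue]

section Path

variable {A : Type*} [NormedRing A] [NormedAlgebra ℂ A]

/-- The path `s ↦ h(s) X`. -/
def pathL (h : C(unitInterval, ℂ)) : A →L[ℂ] C(unitInterval, A) where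
  toFun X := ⟨fun s => h s • X, h.continuous.smul continuous_const⟩
  map_add' X Y := ContinuousMap.ext fun s => smul_add (h s) X Y
  map_smul' c X := ContinuousMap.ext fun s => smul_comm (h s) c X
  cont := by
    refine ContinuousMap.continuous_of_continuous_uncurry _ ?_
    exact (h.continuous.comp continuous_snd).smul continuous_fst

theorem pathL_apply (h : C(unitInterval, ℂ)) (X : A) (s : unitInterval) :
    pathL h X s = h s • X := rfl

theorem primitive_pathL [CompleteSpace A] (h : C(unitInterval, ℂ)) (X : A) :
    primitive (pathL h X) 1 = primitive h 1 • X :=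
  intervalIntegral.integral_smul_const _ _

end Path

section Gauged

variable (m : ℕ)

/-- The pullback of `z^{mk} dz / (z - p_j)` to the loop. -/
def momentForm (k : ℕ) (j : Fin (2 * m + 2)) : C(unitInterval, ℂ) where
  toFun s := loop m s ^ (m * k) * logForm m j s
  continuous_toFun := (((continuous_loop m).pow (m * k)).comp continuous_subtype_val).mul
    (continuousOn_logForm m j.2).domRestrict

theorem momentForm_apply (k : ℕ) (j : Fin (2 * m + 2)) (s : unitInterval) :
    momentForm m k j s = loop m s ^ (m * k) * logForm m j s := rfl

theorem primitive_momentForm (k : ℕ) (j : Fin (2 * m + 2)) :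
    primitive (momentForm m k j) 1 =
      puncture m j ^ (m * k) * ∫ s in (0 : ℝ)..1, logForm m j s := by
  rw [← integral_loop_pow_mul_logForm m j.2]
  refine intervalIntegral.integral_congr fun s hs => ?_
  rw [Set.uIcc_of_le zero_le_one] at hs
  exact Set.IccExtend_of_mem _ _ hs

theorem primitive_momentForm_zero (k : ℕ) :
    primitive (momentForm m k 0) 1 = 2 * Real.pi * Complex.I := by
  rw [primitive_momentForm, Fin.val_zero, puncture_zero, one_pow, one_mul, integral_logForm_zero]

theorem primitive_momentForm_of_ne_zero (k : ℕ) {j : Fin (2 * m + 2)} (hj : j ≠ 0) :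
    primitive (momentForm m k j) 1 = 0 := by
  rw [primitive_momentForm, integral_logForm_of_pos m (Fin.pos_iff_ne_zero.mpr hj) j.2, mul_zero]

/-- The elementary matrix `(0, 0; 1, 0)`. -/
def lowerUnit : LoopMat ρ := LoopMat.const !![0, 0; 1, 0]

/-- The potential `t⁻¹ η_t` along the loop, gauged by the solution `(1, 0; r z^m, 1)` at `t = 0`:
the sum of the forms `(1 + r z^m N) A_j (1 - r z^m N) dz / (z - p_j)`, where `N = lowerUnit`. -/
def gauged (x : Param ρ) : C(unitInterval, LoopMat ρ) :=
  ∑ j : Fin (2 * m + 2),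
    (pathL (momentForm m 0 j) (residueL m j x) +
      pathL (momentForm m 1 j)
        ((x.r : ℂ) • (lowerUnit * residueL m j x - residueL m j x * lowerUnit)) -
      pathL (momentForm m 2 j) ((x.r : ℂ) ^ 2 • (lowerUnit * residueL m j x * lowerUnit)))

theorem contDiff_gauged : ContDiff ℝ ω (gauged m : Param ρ → _) := by
  have r_contDiff : ContDiff ℝ ω fun x : Param ρ => (x.r : ℂ) :=
    Complex.ofRealCLM.contDiff.comp contDiff_fst
  have path_contDiff (h : C(unitInterval, ℂ)) :
      ContDiff ℝ ω (pathL h : LoopMat ρ → C(unitInterval, LoopMat ρ)) :=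
    (pathL h : LoopMat ρ →L[ℂ] C(unitInterval, LoopMat ρ)).contDiff.restrict_scalars ℝ
  refine ContDiff.sum fun j _ => ?_
  have A_contDiff : ContDiff ℝ ω (residueL m j : Param ρ → LoopMat ρ) := (residueL m j).contDiff
  refine (((path_contDiff _).comp A_contDiff).add ((path_contDiff _).comp (r_contDiff.smul ?_))).sub
    ((path_contDiff _).comp ((r_contDiff.pow 2).smul ?_))
  · exact (contDiff_const.mul A_contDiff).sub (A_contDiff.mul contDiff_const)
  · exact (contDiff_const.mul A_contDiff).mul contDiff_const

theorem primitive_gauged (x : Param ρ) :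
    primitive (gauged m x) 1 = (2 * Real.pi * Complex.I) •
      (residueZeroL x + (x.r : ℂ) • (lowerUnit * residueZeroL x - residueZeroL x * lowerUnit) -
        (x.r : ℂ) ^ 2 • (lowerUnit * residueZeroL x * lowerUnit)) := by
  obtain ⟨P, primitive_one⟩ : ∃ P : C(unitInterval, LoopMat ρ) →L[ℂ] LoopMat ρ,
      ∀ f, primitive f 1 = P f := ⟨ContinuousMap.evalCLM ℂ 1 ∘L primitiveL, fun _ => rfl⟩
  have P_pathL (h : C(unitInterval, ℂ)) (X : LoopMat ρ) : P (pathL h X) = primitive h 1 • X :=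
    (primitive_one _).symm.trans (primitive_pathL h X)
  rw [primitive_one, gauged, map_sum]
  simp only [map_add, map_sub, P_pathL]
  rw [Finset.sum_eq_single_of_mem 0 (Finset.mem_univ _) fun j _ hj => by
    simp only [primitive_momentForm_of_ne_zero m _ hj, zero_smul, add_zero, sub_zero]]
  simp only [primitive_momentForm_zero, Fin.val_zero, residueL]
  module

end Gauged

section GaugedSolution

variable (m : ℕ)

theorem gauge_mul_unipotent {R : Type*} [CommRing R] (A : Matrix (Fin 2) (Fin 2) R) (w : R) :
    (A + w • (!![0, 0; 1, 0] * A - A * !![0, 0; 1, 0]) -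
      w ^ 2 • (!![0, 0; 1, 0] * A * !![0, 0; 1, 0])) * !![1, 0; w, 1] =
      !![1, 0; w, 1] * A := by
  rw [Matrix.eta_fin_two A]
  ext i j
  fin_cases i <;> fin_cases j <;> simp [Matrix.mul_apply, Fin.sum_univ_two] <;> ring

theorem gauge_transform {R : Type*} [Ring R] [Algebra ℂ R] (N : R) {A P E S : R} (t : ℂ) {w : ℂ}
    (hA : A * P = P * (w • S)) (hE : P * E = E) :
    (t • (N * A)) * P + N * (w • E) = N * P * (w • (E + t • S)) := by
  rw [smul_mul_assoc, mul_assoc, hA, smul_add, mul_add, mul_assoc N P, mul_assoc N P,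
    mul_smul_comm w P E, hE, smul_comm w t S, mul_smul_comm t P, mul_smul_comm t N, add_comm]

/-- The solution `(1, 0; r z^m, 1)` of the unperturbed equation `dΦ = Φ η_0`, along the loop. -/
def unperturbedSol (x : Param ρ) (s : ℝ) : Matrix (Fin 2) (Fin 2) ℂ :=
  !![1, 0; x.r * loop m s ^ m, 1]

theorem hasDerivAt_unperturbedSol (x : Param ρ) (s : ℝ) (i j : Fin 2) :
    HasDerivAt (fun u => unperturbedSol m x u i j)
      ((deriv (loop m) s • !![0, 0; (m : ℂ) * x.r * loop m s ^ (m - 1), 0] :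
        Matrix (Fin 2) (Fin 2) ℂ) i j) s := by
  have lower_left : HasDerivAt (fun u => (x.r : ℂ) * loop m u ^ m)
      (deriv (loop m) s * (m * x.r * loop m s ^ (m - 1))) s :=
    (((hasDerivAt_loop m s).pow m).const_mul (x.r : ℂ)).congr_deriv (by ring)
  fin_cases i <;> fin_cases j
  · exact (hasDerivAt_const s (1 : ℂ)).congr_deriv (mul_zero _).symm
  · exact (hasDerivAt_const s (0 : ℂ)).congr_deriv (mul_zero _).symm
  · exact lower_left
  · exact (hasDerivAt_const s (1 : ℂ)).congr_deriv (mul_zero _).symm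

theorem unperturbedSol_mul_lower (x : Param ρ) (s : ℝ) (w : ℂ) :
    unperturbedSol m x s * !![0, 0; w, 0] = !![0, 0; w, 0] := by
  rw [unperturbedSol, Matrix.mul_fin_two]
  simp

theorem unperturbedSol_of_loop_eq_zero (hm : 1 ≤ m) (x : Param ρ) {s : ℝ} (hs : loop m s = 0) :
    unperturbedSol m x s = 1 := by
  rw [unperturbedSol, hs, zero_pow (Nat.one_le_iff_ne_zero.mp hm), mul_zero, Matrix.one_fin_two]

theorem eval_gauged_mul_unperturbedSol (x : Param ρ) {l : ℂ} (hl : l ∈ annulus ρ)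
    (s : unitInterval) :
    LoopMat.eval hl (gauged m x s) * unperturbedSol m x s = unperturbedSol m x s *
      (deriv (loop m) s • ∑ j ∈ Finset.range (2 * m + 2),
        (loop m s - puncture m j)⁻¹ • residue m x j l) := by
  have eval_gauged : LoopMat.eval hl (gauged m x s) = ∑ j : Fin (2 * m + 2),
      logForm m j s • (residue m x j l +
        (x.r * loop m s ^ m) • (!![0, 0; 1, 0] * residue m x j l -
          residue m x j l * !![0, 0; 1, 0]) -
        (x.r * loop m s ^ m) ^ 2 • (!![0, 0; 1, 0] * residue m x j l * !![0, 0; 1, 0])) := by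
    rw [gauged, ContinuousMap.sum_apply, map_sum]
    refine Finset.sum_congr rfl fun j _ => ?_
    rw [ContinuousMap.sub_apply, ContinuousMap.add_apply, pathL_apply, pathL_apply, pathL_apply]
    simp only [momentForm_apply, map_add, map_sub, map_smul, map_mul, lowerUnit,
      LoopMat.eval_const, eval_residueL]
    rw [pow_mul _ m 2, mul_zero, mul_one]
    module
  rw [eval_gauged, Finset.sum_mul, Finset.sum_range, Finset.smul_sum, Finset.mul_sum]
  refine Finset.sum_congr rfl fun j _ => ?_
  rw [smul_mul_assoc, unperturbedSol, gauge_mul_unipotent, smul_smul, Matrix.mul_smul, logForm,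
    mul_comm (deriv _ _)]

theorem hasDerivWithinAt_matrix_mul {ι : Type*} [Fintype ι] {Y Z : ℝ → Matrix ι ι ℂ}
    {Y' Z' : Matrix ι ι ℂ} {S : Set ℝ} {s : ℝ}
    (hY : ∀ i j, HasDerivWithinAt (fun u => Y u i j) (Y' i j) S s)
    (hZ : ∀ i j, HasDerivWithinAt (fun u => Z u i j) (Z' i j) S s) (i j : ι) :
    HasDerivWithinAt (fun u => (Y u * Z u) i j) ((Y' * Z s + Y s * Z') i j) S s := by
  simp only [Matrix.mul_apply, Matrix.add_apply, ← Finset.sum_add_distrib]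
  exact HasDerivWithinAt.fun_sum fun k _ => (hY i k).mul (hZ k j)

theorem LoopMat.hasDerivWithinAt_eval {l : ℂ} (hl : l ∈ annulus ρ) {N : ℝ → LoopMat ρ}
    {N' : LoopMat ρ} {S : Set ℝ} {s : ℝ} (hN : HasDerivWithinAt N N' S s) (i j : Fin 2) :
    HasDerivWithinAt (fun u => LoopMat.eval hl (N u) i j) (LoopMat.eval hl N' i j) S s :=
  (((Laurent.eval hl).toContinuousLinearMap.comp
    (LoopMat.entryL i j)).restrictScalars ℝ).hasFDerivAt.comp_hasDerivWithinAt s hN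

/-- The time `t` and the parameter `x` lie in the range where the series for the solution along the
loop and for the logarithm of the monodromy converge. -/
def IsSmall (t : ℝ) (x : Param ρ) : Prop :=
  ‖(t : ℂ) • volterra primitiveL (gauged m x)‖ < 1 ∧ ‖(t : ℂ) • endQuot t (gauged m x)‖ < 1 / 2

theorem isSolutionAlongLoop_mul_unperturbedSol (hm : 1 ≤ m) {t : ℝ} {x : Param ρ}
    (h : IsSmall m t x) {l : ℂ} (hl : l ∈ annulus ρ) : IsSolutionAlongLoop m t x l (fun s =>
      LoopMat.eval hl (Set.IccExtend zero_le_one (fundSol t (gauged m x)) s) *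
        unperturbedSol m x s) := by
  refine ⟨?_, fun s hs i j => ?_⟩
  · beta_reduce
    rw [Set.IccExtend_left]
    exact (congrArg₂ (LoopMat.eval hl · * ·) (fundSol_apply_zero h.1)
      (unperturbedSol_of_loop_eq_zero m hm x (loop_zero m))).trans (by rw [map_one, one_mul])
  · refine (hasDerivWithinAt_matrix_mul
      (LoopMat.hasDerivWithinAt_eval hl (hasDerivWithinAt_fundSol h.1 hs))
      (fun i j => (hasDerivAt_unperturbedSol m x s i j).hasDerivWithinAt) i j).congr_deriv ?_
    have step := gauge_transform (LoopMat.eval hl (fundSol t (gauged m x) ⟨s, hs⟩)) (t : ℂ)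
      (eval_gauged_mul_unperturbedSol m x hl ⟨s, hs⟩)
      (unperturbedSol_mul_lower m x s (m * x.r * loop m s ^ (m - 1)))
    beta_reduce
    rw [Set.IccExtend_of_mem _ _ hs, map_smul, map_mul, step, potential]

theorem monodromy_eq_eval (hm : 1 ≤ m) {t : ℝ} {x : Param ρ} (h : IsSmall m t x) {l : ℂ}
    (hl : l ∈ annulus ρ) :
    monodromy m t x l = LoopMat.eval hl (1 + (t : ℂ) • endQuot t (gauged m x)) := by
  rw [monodromy_eq m (isSolutionAlongLoop_mul_unperturbedSol m hm h hl), Set.IccExtend_right,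
    unperturbedSol_of_loop_eq_zero m hm x (loop_one m), mul_one, ← fundSol_apply_one h.1]
  rfl

end GaugedSolution

section LogLoop

variable (m : ℕ)

/-- The logarithmic monodromy `M̃` as a matrix of Laurent series. -/
def logLoop (t : ℝ) (x : Param ρ) : LoopMat ρ := logEndQuot t (gauged m x)

theorem tendsto_ofReal_prodMk_gauged (x : Param ρ) :
    Filter.Tendsto (fun p : ℝ × Param ρ => ((p.1 : ℂ), gauged m p.2)) (𝓝 (0, x))
      (𝓝 (0, gauged m x)) := by
  have cont : Continuous fun p : ℝ × Param ρ => ((p.1 : ℂ), gauged m p.2) :=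
    (Complex.continuous_ofReal.comp continuous_fst).prodMk
      ((contDiff_gauged m).continuous.comp continuous_snd)
  simpa only [Complex.ofReal_zero] using cont.tendsto (0, x)

theorem eventually_isSmall (x : Param ρ) : ∀ᶠ p : ℝ × Param ρ in 𝓝 (0, x), IsSmall m p.1 p.2 :=
  (tendsto_ofReal_prodMk_gauged m x).eventually
    ((eventually_norm_smul_volterra_lt_one _ _).and
      (eventually_norm_smul_endQuot_lt _ one_half_pos))

theorem contDiffAt_comp_ofReal_prodMk_gauged {E : Type*} [NormedAddCommGroup E] [NormedSpace ℂ E]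
    {f : ℂ × C(unitInterval, LoopMat ρ) → E} {x : Param ρ}
    (hf : ContDiffAt ℂ ω f (0, gauged m x)) :
    ContDiffAt ℝ ω (fun p : ℝ × Param ρ => f ((p.1 : ℂ), gauged m p.2)) (0, x) := by
  have inner : ContDiff ℝ ω (fun p : ℝ × Param ρ => ((p.1 : ℂ), gauged m p.2)) :=
    (Complex.ofRealCLM.contDiff.comp contDiff_fst).prodMk ((contDiff_gauged m).comp contDiff_snd)
  refine ContDiffAt.comp (g := f) (0, x) ?_ inner.contDiffAt
  simpa only [Complex.ofReal_zero] using hf.restrict_scalars ℝ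

theorem contDiffAt_logLoop (x : Param ρ) :
    ContDiffAt ℝ ω (fun p : ℝ × Param ρ => logLoop m p.1 p.2) (0, x) :=
  contDiffAt_comp_ofReal_prodMk_gauged m (contDiffAt_logEndQuot (gauged m x))

theorem logLoop_zero (x : Param ρ) : logLoop m 0 x = (2 * Real.pi * Complex.I) •
    (residueZeroL x + (x.r : ℂ) • (lowerUnit * residueZeroL x - residueZeroL x * lowerUnit) -
      (x.r : ℂ) ^ 2 • (lowerUnit * residueZeroL x * lowerUnit)) := by
  rw [logLoop, Complex.ofReal_zero, logEndQuot_zero, primitive_gauged]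

theorem hasSum_log_eval {X : LoopMat ρ} (hX : ‖X‖ < 1) {l : ℂ} (hl : l ∈ annulus ρ) :
    HasSum (fun k : ℕ => ((-1 : ℂ) ^ k / (k + 1)) • (LoopMat.eval hl (1 + X) - 1) ^ (k + 1))
      (LoopMat.eval hl (X * logQuot X)) := by
  refine (((hasSum_logQuot hX).mul_left X).map (LoopMat.eval hl)
    (LoopMat.eval hl).continuous).congr_fun fun k => ?_
  rw [Function.comp_apply, mul_smul_comm, ← pow_succ', map_smul, map_pow, map_add, map_one,
    add_sub_cancel_left, logCoeff]

theorem logMonodromy_zero_eq_eval (hm : 1 ≤ m) (x : Param ρ) {l : ℂ} (hl : l ∈ annulus ρ) :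
    logMonodromy m 0 x l = LoopMat.eval hl (logLoop m 0 x) := by
  have endQuot_diff : DifferentiableAt ℝ (fun s : ℝ => endQuot (s : ℂ) (gauged m x)) 0 :=
    ((contDiffAt_comp_ofReal_prodMk_gauged m (contDiffAt_endQuot (gauged m x))).comp (0 : ℝ)
      (contDiffAt_id.prodMk contDiffAt_const)).differentiableAt (by simp)
  have hasDeriv : HasDerivAt (fun s : ℝ => (1 : LoopMat ρ) + (s : ℂ) • endQuot s (gauged m x))
      (logLoop m 0 x) 0 := by
    refine ((Complex.ofRealCLM.hasDerivAt.smul endQuot_diff.hasDerivAt).const_add 1).congr_deriv ?_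
    rw [Complex.ofRealCLM_apply, Complex.ofRealCLM_apply, Complex.ofReal_zero, Complex.ofReal_one,
      zero_smul, zero_add, one_smul, logLoop, Complex.ofReal_zero, logEndQuot_zero, endQuot_zero]
  have small : ∀ᶠ s in 𝓝 (0 : ℝ), IsSmall m s x :=
    (Continuous.prodMk_left x).continuousAt.eventually (eventually_isSmall m x)
  rw [logMonodromy, if_pos rfl]
  ext i j
  rw [Matrix.of_apply, Filter.EventuallyEq.deriv_eq
    (small.mono fun s hs => by rw [monodromy_eq_eval m hm hs hl])]
  exact (LoopMat.hasDerivWithinAt_eval hl hasDeriv.hasDerivWithinAt i j).hasDerivAt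
    Filter.univ_mem |>.deriv

theorem logMonodromy_eq_eval (hm : 1 ≤ m) {t : ℝ} {x : Param ρ} (h : IsSmall m t x) {l : ℂ}
    (hl : l ∈ annulus ρ) : logMonodromy m t x l = LoopMat.eval hl (logLoop m t x) := by
  obtain rfl | ht := eq_or_ne t 0
  · exact logMonodromy_zero_eq_eval m hm x hl
  · rw [logMonodromy, if_neg ht, monodromy_eq_eval m hm h hl, matrixLog,
      (hasSum_log_eval (h.2.trans one_half_lt_one) hl).tsum_eq, smul_mul_assoc, map_smul,
      inv_smul_smul₀ (Complex.ofReal_ne_zero.mpr ht), logLoop, logEndQuot]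

end LogLoop

section Reality

attribute [local instance] Matrix.linftyOpNormedRing Matrix.linftyOpNormedAlgebra

theorem LoopMat.norm_eval_le {l : ℂ} (hl : l ∈ annulus ρ) (X : LoopMat ρ) :
    ‖LoopMat.eval hl X‖ ≤ ‖X‖ := by
  have norm_eq : ‖X‖ = _ := Matrix.linfty_opNorm_def (α := Laurent ρ) X
  rw [norm_eq, Matrix.linfty_opNorm_def]
  exact NNReal.coe_le_coe.mpr (Finset.sup_mono_fun fun i _ =>
    Finset.sum_le_sum fun j _ => Laurent.norm_eval_le hl _)

theorem norm_map_conj (X : Matrix (Fin 2) (Fin 2) ℂ) : ‖X.map (starRingEnd ℂ)‖ = ‖X‖ := by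
  simp [Matrix.linfty_opNorm_def]

theorem matrixLog_one_add {P : Matrix (Fin 2) (Fin 2) ℂ} (hP : ‖P‖ < 1) :
    matrixLog (1 + P) = P * logQuot P := by
  rw [matrixLog, ← ((hasSum_logQuot hP).mul_left P).tsum_eq]
  refine tsum_congr fun k => ?_
  rw [add_sub_cancel_left, mul_smul_comm, ← pow_succ', logCoeff]

theorem matrixLog_of_mul_eq_one {P R : Matrix (Fin 2) (Fin 2) ℂ} (hP : ‖P‖ < 1) (hR : ‖R‖ < 1)
    (h : (1 + R) * (1 + P) = 1) : matrixLog (1 + R) = -matrixLog (1 + P) := by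
  have log_inverse := mul_logQuot_of_inverse hP (by rwa [add_sub_cancel_left]) h
    (mul_eq_one_comm.mp h)
  rwa [add_sub_cancel_left, ← matrixLog_one_add hR, ← matrixLog_one_add hP] at log_inverse

theorem matrixLog_map_conj (X : Matrix (Fin 2) (Fin 2) ℂ) :
    matrixLog (X.map (starRingEnd ℂ)) = (matrixLog X).map (starRingEnd ℂ) := by
  have conj_conj : Function.LeftInverse ((starRingEnd ℂ).mapMatrix (m := Fin 2))
      (starRingEnd ℂ).mapMatrix := fun Y => by ext; simp
  have cont : Continuous ((starRingEnd ℂ).mapMatrix (m := Fin 2)) :=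
    continuous_id.matrix_map Complex.continuous_conj
  change matrixLog ((starRingEnd ℂ).mapMatrix X) = (starRingEnd ℂ).mapMatrix (matrixLog X)
  rw [matrixLog, matrixLog, Function.LeftInverse.map_tsum _ cont cont conj_conj]
  refine tsum_congr fun k => ?_
  rw [← map_one ((starRingEnd ℂ).mapMatrix (m := Fin 2)), ← map_sub, ← map_pow]
  ext i j
  simp

theorem conj_logMonodromy (m : ℕ) (hm : 1 ≤ m) {t : ℝ} (ht : t ≠ 0) {x : Param ρ}
    (h : IsSmall m t x) {l : ℂ} (hl : l ∈ annulus ρ) :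
    (logMonodromy m t x (starRingEnd ℂ l)).map (starRingEnd ℂ) = -logMonodromy m t x l := by
  have exists_small {u : ℂ} (hu : u ∈ annulus ρ) : ∃ P, ‖P‖ < 1 ∧ monodromy m t x u = 1 + P :=
    ⟨_, (LoopMat.norm_eval_le hu _).trans_lt (h.2.trans one_half_lt_one), by
      rw [monodromy_eq_eval m hm h hu, map_add, map_one]⟩
  have hc := conj_mem_annulus hl
  obtain ⟨P, hP, monodromy_eq_P⟩ := exists_small hl
  obtain ⟨Q, hQ, monodromy_eq_Q⟩ := exists_small hc
  have conj_one_add : (1 + Q).map (starRingEnd ℂ) = 1 + Q.map (starRingEnd ℂ) := by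
    rw [Matrix.map_add _ (map_add _), Matrix.map_one _ (map_zero _) (map_one _)]
  have unitary := conj_monodromy_mul m ⟨_, isSolutionAlongLoop_mul_unperturbedSol m hm h hl⟩
    ⟨_, isSolutionAlongLoop_mul_unperturbedSol m hm h hc⟩
  rw [monodromy_eq_P, monodromy_eq_Q, conj_one_add] at unitary
  have log_eq := matrixLog_of_mul_eq_one hP ((norm_map_conj Q).trans_lt hQ) unitary
  rw [← conj_one_add, matrixLog_map_conj, ← monodromy_eq_P, ← monodromy_eq_Q] at log_eq
  rw [logMonodromy, if_neg ht, logMonodromy, if_neg ht, ← smul_neg, ← log_eq]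
  ext i j
  simp

end Reality

section LogEntry

variable (m : ℕ)

theorem conj_one_div_two_pi_I :
    starRingEnd ℂ (1 / (2 * Real.pi * Complex.I)) = -(1 / (2 * Real.pi * Complex.I)) := by
  rw [map_div₀, map_mul, map_mul, map_one, Complex.conj_ofReal, Complex.conj_I,
    Complex.conj_ofNat, mul_neg, div_neg]

/-- The `(i, j)` entry of `M̃ / 2πi` as a Laurent series. -/
def logEntry (i j : Fin 2) (t : ℝ) (x : Param ρ) : Laurent ρ :=
  (1 / (2 * Real.pi * Complex.I)) • LoopMat.entryL i j (logLoop m t x)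

theorem eval_logEntry (hm : 1 ≤ m) {t : ℝ} {x : Param ρ} (h : IsSmall m t x) {l : ℂ}
    (hl : l ∈ annulus ρ) (i j : Fin 2) : Laurent.eval hl (logEntry m i j t x) =
      1 / (2 * Real.pi * Complex.I) * logMonodromy m t x l i j := by
  rw [logMonodromy_eq_eval m hm h hl, logEntry, map_smul, smul_eq_mul, LoopMat.eval_apply]

theorem contDiffAt_logEntry (i j : Fin 2) (x : Param ρ) :
    ContDiffAt ℝ ω (fun p : ℝ × Param ρ => logEntry m i j p.1 p.2) (0, x) :=
  (((1 / (2 * Real.pi * Complex.I)) • (LoopMat.entryL i j : LoopMat ρ →L[ℂ] Laurent ρ)).contDiff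
    |>.restrict_scalars ℝ).contDiffAt.comp (0, x) (contDiffAt_logLoop m x)

theorem entryL_mul (X Y : LoopMat ρ) (i j : Fin 2) : LoopMat.entryL i j (X * Y) =
    LoopMat.entryL i 0 X * LoopMat.entryL 0 j Y + LoopMat.entryL i 1 X * LoopMat.entryL 1 j Y :=
  (Matrix.mul_apply (M := X) (N := Y)).trans (Fin.sum_univ_two _)

theorem entryL_lowerUnit (i j : Fin 2) : LoopMat.entryL i j (lowerUnit : LoopMat ρ) =
    algebraMap ℂ (Laurent ρ) ((!![0, 0; 1, 0] : Matrix (Fin 2) (Fin 2) ℂ) i j) := rfl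

theorem logEntry_zero (x : Param ρ) :
    logEntry m 0 0 0 x = W.toLaurent x.a - x.r • (Laurent.T (-1) * W.toLaurent x.b) ∧
    logEntry m 0 1 0 x = Laurent.T (-1) * W.toLaurent x.b ∧
    logEntry m 1 0 0 x = Laurent.T 1 * W.toLaurent x.c + (2 * x.r) • W.toLaurent x.a -
      x.r ^ 2 • (Laurent.T (-1) * W.toLaurent x.b) := by
  have a_entry : LoopMat.entryL 0 0 (residueZeroL x) = W.toLaurent x.a := rfl
  have b_entry : LoopMat.entryL 0 1 (residueZeroL x) = Laurent.T (-1) * W.toLaurent x.b := rfl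
  have c_entry : LoopMat.entryL 1 0 (residueZeroL x) = Laurent.T 1 * W.toLaurent x.c := rfl
  have d_entry : LoopMat.entryL 1 1 (residueZeroL x) = -W.toLaurent x.a := rfl
  simp only [logEntry, logLoop_zero, map_smul, smul_smul, one_div,
    inv_mul_cancel₀ Complex.two_pi_I_ne_zero, one_smul, map_add, map_sub, entryL_mul,
    entryL_lowerUnit, a_entry, b_entry, c_entry, d_entry, Matrix.of_apply, Matrix.cons_val',
    Matrix.cons_val_zero, Matrix.cons_val_one, Matrix.cons_val_fin_one, map_zero, map_one,
    zero_mul, mul_zero, one_mul, mul_one, add_zero, zero_add]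
  refine ⟨?_, ?_, ?_⟩ <;> simp only [← Complex.ofReal_pow, Complex.coe_smul] <;> module

theorem conj_coeff_logEntry_of_ne_zero (hm : 1 ≤ m) {t : ℝ} (ht : t ≠ 0) {x : Param ρ}
    (h : IsSmall m t x) (i j : Fin 2) (k : ℤ) :
    starRingEnd ℂ (Laurent.coeff k (logEntry m i j t x)) =
      Laurent.coeff k (logEntry m i j t x) := by
  refine Laurent.conj_coeff_of_conj_eval_conj (fun l hl => ?_) k
  have entry := congrFun (congrFun (conj_logMonodromy m hm ht h hl) i) j
  rw [Matrix.map_apply, Matrix.neg_apply] at entry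
  rw [eval_logEntry m hm h, eval_logEntry m hm h, map_mul, conj_one_div_two_pi_I, entry,
    neg_mul_neg]

theorem conj_coeff_logEntry (hm : 1 ≤ m) {t : ℝ} {x : Param ρ} (h : IsSmall m t x)
    (i j : Fin 2) (k : ℤ) : starRingEnd ℂ (Laurent.coeff k (logEntry m i j t x)) =
      Laurent.coeff k (logEntry m i j t x) := by
  obtain rfl | ht := eq_or_ne t 0
  swap
  · exact conj_coeff_logEntry_of_ne_zero m hm ht h i j k
  have cont : ContinuousAt (fun t : ℝ => Laurent.coeff k (logEntry m i j t x)) 0 :=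
    (Laurent.coeff k).continuous.continuousAt.comp
      (ContinuousAt.comp (f := fun t : ℝ => (t, x)) (contDiffAt_logEntry m i j x).continuousAt
        (Continuous.prodMk_left x).continuousAt)
  have small : ∀ᶠ t in 𝓝 (0 : ℝ), IsSmall m t x :=
    (Continuous.prodMk_left x).continuousAt.eventually (eventually_isSmall m x)
  refine tendsto_nhds_unique_of_eventuallyEq (l := 𝓝[≠] (0 : ℝ))
    ((Complex.continuous_conj.continuousAt.comp cont).tendsto.mono_left nhdsWithin_le_nhds)
    (cont.tendsto.mono_left nhdsWithin_le_nhds) ?_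
  filter_upwards [small.filter_mono nhdsWithin_le_nhds, self_mem_nhdsWithin] with t ht ht0
  exact conj_coeff_logEntry_of_ne_zero m hm ht0 ht i j k

end LogEntry

namespace Laurent

theorem substInv_substInv (v : Laurent ρ) : substInv (substInv v) = v :=
  ext fun k => by rw [coeff_substInv, coeff_substInv, neg_neg]

section RealCoefficients

variable {v : Laurent ρ} (hv : ∀ k, starRingEnd ℂ (coeff k v) = coeff k v)
include hv

theorem conj_eval {l : ℂ} (hl : l ∈ annulus ρ) :
    starRingEnd ℂ (eval (conj_mem_annulus hl) v) = eval hl v := by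
  rw [conj_eval_conj hl, eval_eq_tsum]
  simp only [hv]

theorem im_eval_of_conj_eq {l : ℂ} (hl : l ∈ annulus ρ) (h : starRingEnd ℂ l = l) :
    (eval hl v).im = 0 := by
  refine Complex.conj_eq_iff_im.mp (Eq.trans ?_ (conj_eval hv hl))
  simp only [eval_eq_tsum, h]

theorem coeff_eq_zero_of_re (k : ℤ) (h : (coeff k v).re = 0) : coeff k v = 0 :=
  Complex.ext h (Complex.conj_eq_iff_im.mp (hv k))

theorem eq_zero_iff_nonnegPart : v = 0 ↔
    W.nonnegPart v = 0 ∧ W.posPart (substInv v) = 0 := by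
  refine ⟨?_, fun ⟨nonneg_eq, neg_eq⟩ => ext fun k => ?_⟩
  · rintro rfl
    simp only [map_zero, and_self]
  · rw [map_zero]
    refine coeff_eq_zero_of_re hv k ?_
    obtain k | k := k
    · exact congrArg (W.coeff · k) nonneg_eq
    · have re_eq := congrArg (W.coeff · k) neg_eq
      simp only [W.coeff_posPart, coeff_substInv, W.coeff_zero] at re_eq
      exact re_eq

theorem sub_substInv_eq_zero_iff_nonnegPart : v - substInv v = 0 ↔
    W.posPart (v - substInv v) = 0 := by
  refine ⟨fun h => by rw [h, map_zero], fun h => ext fun k => ?_⟩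
  have coeff_eq (k : ℤ) : coeff k (v - substInv v) = coeff k v - coeff (-k) v := by
    rw [map_sub, coeff_substInv]
  have pos_eq (k : ℕ) : coeff (k + 1 : ℤ) v = coeff (-(k + 1) : ℤ) v := by
    refine sub_eq_zero.mp (Complex.ext ?_ ?_)
    · have re_eq := congrArg (W.coeff · k) h
      simp only [W.coeff_posPart, coeff_eq, W.coeff_zero] at re_eq
      exact re_eq
    · rw [Complex.sub_im, Complex.conj_eq_iff_im.mp (hv _), Complex.conj_eq_iff_im.mp (hv _),
        sub_zero, Complex.zero_im]
  rw [map_zero, coeff_eq, sub_eq_zero]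
  obtain (_ | k) | k := k
  · rfl
  · exact pos_eq k
  · exact (pos_eq k).symm

end RealCoefficients

end Laurent

theorem one_mem_annulus : (1 : ℂ) ∈ annulus ρ := mem_annulus_of_norm_eq_one (by simp)

theorem neg_one_mem_annulus : (-1 : ℂ) ∈ annulus ρ := mem_annulus_of_norm_eq_one (by simp)

section Equations

variable (m : ℕ)

/-- The Laurent series of `F` (for `i = 0`) and of `G` (for `i = 1`). -/
def unitarityDefect (i : Fin 2) (t : ℝ) (x : Param ρ) : Laurent ρ :=
  logEntry m i 0 t x - Laurent.substInv (logEntry m 0 i t x)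

theorem conj_coeff_unitarityDefect (hm : 1 ≤ m) {t : ℝ} {x : Param ρ} (h : IsSmall m t x)
    (i : Fin 2) (k : ℤ) : starRingEnd ℂ (Laurent.coeff k (unitarityDefect m i t x)) =
      Laurent.coeff k (unitarityDefect m i t x) := by
  rw [unitarityDefect, map_sub, map_sub, Laurent.coeff_substInv, conj_coeff_logEntry m hm h,
    conj_coeff_logEntry m hm h]

theorem starInv_logMonodromy (hm : 1 ≤ m) {t : ℝ} {x : Param ρ} (h : IsSmall m t x)
    (i j : Fin 2) {l : ℂ} (hl : l ∈ annulus ρ) :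
    1 / (2 * Real.pi * Complex.I) * starInv (fun u => logMonodromy m t x u i j) l =
      -Laurent.eval hl (Laurent.substInv (logEntry m i j t x)) := by
  have hinv := inv_mem_annulus hl
  rw [Laurent.eval_substInv, ← Laurent.conj_eval (conj_coeff_logEntry m hm h i j) hinv,
    eval_logEntry m hm h, map_mul, conj_one_div_two_pi_I, starInv, map_inv₀,
    one_div (starRingEnd ℂ l), neg_mul, neg_neg]

theorem eval_unitarityDefect (hm : 1 ≤ m) {t : ℝ} {x : Param ρ} (h : IsSmall m t x)
    (i : Fin 2) {l : ℂ} (hl : l ∈ annulus ρ) : Laurent.eval hl (unitarityDefect m i t x) =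
      1 / (2 * Real.pi * Complex.I) *
        (logMonodromy m t x l i 0 + starInv (fun u => logMonodromy m t x u 0 i) l) := by
  rw [unitarityDefect, map_sub, eval_logEntry m hm h, mul_add, starInv_logMonodromy m hm h 0 i hl,
    sub_eq_add_neg]

theorem unitarityDefect_eq_zero_iff (hm : 1 ≤ m) {t : ℝ} {x : Param ρ} (h : IsSmall m t x)
    (i : Fin 2) : unitarityDefect m i t x = 0 ↔ ∀ l ∈ annulus ρ, 1 / (2 * Real.pi * Complex.I) *
      (logMonodromy m t x l i 0 + starInv (fun u => logMonodromy m t x u 0 i) l) = 0 := by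
  refine ⟨fun h0 l hl => ?_, fun h0 => Laurent.eq_zero_of_eval_eq_zero fun l hl => ?_⟩
  · rw [← eval_unitarityDefect m hm h i hl, h0, map_zero]
  · rw [eval_unitarityDefect m hm h i hl, h0 l hl]

theorem re_eval_logEntry_eq_zero_iff (hm : 1 ≤ m) {t : ℝ} {x : Param ρ} (h : IsSmall m t x)
    (i j : Fin 2) {l : ℂ} (hl : l ∈ annulus ρ) (hreal : starRingEnd ℂ l = l) :
    (Laurent.eval hl (logEntry m i j t x)).re = 0 ↔
      1 / (2 * Real.pi * Complex.I) * logMonodromy m t x l i j = 0 := by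
  rw [← eval_logEntry m hm h hl, Complex.ext_iff,
    Laurent.im_eval_of_conj_eq (conj_coeff_logEntry m hm h i j) hl hreal, Complex.zero_re,
    Complex.zero_im, eq_self, and_true]

/-- The real part of the value of a Laurent series at a point of the annulus. -/
def Laurent.reEvalL {l : ℂ} (hl : l ∈ annulus ρ) : Laurent ρ →L[ℝ] ℝ :=
  Complex.reCLM ∘L (Laurent.eval hl).toContinuousLinearMap.restrictScalars ℝ

/-- The target space of the equations. -/
abbrev EqSpace (ρ : ℝ) [Fact (1 < ρ)] : Type := W ρ × W ρ × W ρ × ℝ × ℝ × ℝ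

/-- The left-hand sides of the equations `F = 0`, `G = 0`, `H₁ = H₂ = 0`, `K = 1`, with redundant
Fourier coefficients removed: `F` is antisymmetric under `λ ↦ 1/λ`, so only its positive powers
are kept, whereas `G` is split into its nonnegative and its negative powers. -/
def loopEq (p : ℝ × Param ρ) : EqSpace ρ :=
  (W.posPart (unitarityDefect m 0 p.1 p.2),
    W.nonnegPart (unitarityDefect m 1 p.1 p.2),
    W.posPart (Laurent.substInv (unitarityDefect m 1 p.1 p.2)),
    Laurent.reEvalL one_mem_annulus (logEntry m 0 1 p.1 p.2),
    Laurent.reEvalL neg_one_mem_annulus (logEntry m 0 1 p.1 p.2), calK p.2 - 1)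

theorem contDiff_calK : ContDiff ℝ ω (calK : Param ρ → ℝ) := by
  have coeff_contDiff : ContDiff ℝ ω fun f : W ρ => f.coeff 0 :=
    funext (W.coeffL_apply (ρ := ρ) 0) ▸ (W.coeffL 0).contDiff
  exact ((coeff_contDiff.comp contDiff_snd.fst).pow 2).add
    ((coeff_contDiff.comp contDiff_snd.snd.fst).mul (coeff_contDiff.comp contDiff_snd.snd.snd))

theorem contDiffAt_loopEq (x : Param ρ) : ContDiffAt ℝ ω (loopEq m) (0, x) := by
  have entry (i j : Fin 2) := contDiffAt_logEntry m i j x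
  have defect (i : Fin 2) :
      ContDiffAt ℝ ω (fun p : ℝ × Param ρ => unitarityDefect m i p.1 p.2) (0, x) :=
    (entry i 0).sub ((Laurent.substInv.restrictScalars ℝ).contDiff.contDiffAt.comp _ (entry 0 i))
  have clm {F : Type} [NormedAddCommGroup F] [NormedSpace ℝ F] (φ : Laurent ρ →L[ℝ] F)
      {u : ℝ × Param ρ → Laurent ρ} (hu : ContDiffAt ℝ ω u (0, x)) :
      ContDiffAt ℝ ω (fun p => φ (u p)) (0, x) := φ.contDiff.contDiffAt.comp _ hu
  exact (clm _ (defect 0)).prodMk <| (clm _ (defect 1)).prodMk <|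
    (clm (W.posPart ∘L Laurent.substInv.restrictScalars ℝ) (defect 1)).prodMk <|
    (clm _ (entry 0 1)).prodMk <| (clm _ (entry 0 1)).prodMk <|
    (contDiff_calK.contDiffAt.comp _ contDiffAt_snd).sub contDiffAt_const

theorem solvesMonodromyProblem_iff_loopEq (hm : 1 ≤ m) {t : ℝ} {x : Param ρ}
    (h : IsSmall m t x) : SolvesMonodromyProblem m t x ↔ loopEq m (t, x) = 0 := by
  have F_iff : (∀ l ∈ annulus ρ, calF m t x l = 0) ↔
      W.posPart (unitarityDefect m 0 t x) = 0 :=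
    (unitarityDefect_eq_zero_iff m hm h 0).symm.trans
      (Laurent.sub_substInv_eq_zero_iff_nonnegPart (conj_coeff_logEntry m hm h 0 0))
  have G_iff : (∀ l ∈ annulus ρ, calG m t x l = 0) ↔
      W.nonnegPart (unitarityDefect m 1 t x) = 0 ∧
        W.posPart (Laurent.substInv (unitarityDefect m 1 t x)) = 0 :=
    (unitarityDefect_eq_zero_iff m hm h 1).symm.trans
      (Laurent.eq_zero_iff_nonnegPart (conj_coeff_unitarityDefect m hm h 1))
  have H₁_iff := re_eval_logEntry_eq_zero_iff m hm h 0 1 one_mem_annulus (map_one _)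
  have H₂_iff := re_eval_logEntry_eq_zero_iff m hm h 0 1 neg_one_mem_annulus
    (by rw [map_neg, map_one])
  rw [SolvesMonodromyProblem, F_iff, G_iff, calH₁, calH₂, ← H₁_iff, ← H₂_iff, loopEq]
  simp only [Prod.mk_eq_zero, sub_eq_zero (b := (1 : ℝ)), and_assoc]
  rfl

end Equations

namespace W

theorem tail_cons (p : ℝ) (f : W ρ) : tail (cons (p, f)) = f :=
  W.ext fun k => by rw [coeff_tail, coeff_cons_succ]

theorem posPart_toLaurent (f : W ρ) : posPart (toLaurent f) = tail f := rfl

theorem nonnegPart_T_neg_one_mul_toLaurent (f : W ρ) :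
    nonnegPart (Laurent.T (-1) * toLaurent f) = tail f := rfl

theorem nonnegPart_T_one_mul_toLaurent (f : W ρ) :
    nonnegPart (Laurent.T 1 * toLaurent f) = cons (0, f) := by
  rw [cons_apply, zero_smul, map_zero, zero_add]

theorem posPart_T_neg_one_mul_toLaurent (f : W ρ) :
    posPart (Laurent.T (-1) * toLaurent f) = tail (tail f) := by
  refine W.ext fun k => ?_
  rw [coeff_posPart, Laurent.coeff_T_mul, coeff_tail, coeff_tail, sub_neg_eq_add,
    ← Nat.cast_add_one, ← Nat.cast_add_one, coeff_natCast_toLaurent, Complex.ofReal_re]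

theorem posPart_substInv_toLaurent (f : W ρ) : posPart (Laurent.substInv (toLaurent f)) = 0 :=
  W.ext fun k => by
    rw [coeff_posPart, Laurent.coeff_substInv, coeff_toLaurent_of_neg f (by omega),
      Complex.zero_re, coeff_zero]

theorem posPart_substInv_T_one_mul_toLaurent (f : W ρ) :
    posPart (Laurent.substInv (Laurent.T 1 * toLaurent f)) = 0 :=
  W.ext fun k => by
    rw [coeff_posPart, Laurent.coeff_substInv, Laurent.coeff_T_mul,
      coeff_toLaurent_of_neg f (by omega), Complex.zero_re, coeff_zero]

theorem posPart_substInv_T_neg_one_mul_toLaurent (f : W ρ) :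
    posPart (Laurent.substInv (Laurent.T (-1) * toLaurent f)) = cons (f.coeff 0, 0) := by
  refine ext_zero_succ ?_ fun k => ?_
  · rw [coeff_posPart, Laurent.coeff_substInv, Laurent.coeff_T_mul, coeff_cons_zero,
      show (-((0 : ℕ) + 1 : ℤ) - -1) = (0 : ℕ) from rfl, coeff_natCast_toLaurent,
      Complex.ofReal_re]
  · rw [coeff_posPart, Laurent.coeff_substInv, Laurent.coeff_T_mul, coeff_cons_succ,
      coeff_toLaurent_of_neg f (by omega), Complex.zero_re, coeff_zero]

theorem nonnegPart_substInv_T_neg_one_mul_toLaurent (f : W ρ) :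
    nonnegPart (Laurent.substInv (Laurent.T (-1) * toLaurent f)) =
      cons (f.coeff 1, cons (f.coeff 0, 0)) := by
  refine ext_zero_succ ?_ fun k => ?_
  · rw [coeff_nonnegPart, Laurent.coeff_substInv, Laurent.coeff_T_mul, coeff_cons_zero,
      show (-((0 : ℕ) : ℤ) - -1) = (1 : ℕ) from rfl, coeff_natCast_toLaurent, Complex.ofReal_re]
  · rw [coeff_cons_succ, ← posPart_substInv_T_neg_one_mul_toLaurent, coeff_posPart,
      coeff_nonnegPart, Nat.cast_add_one]

/-- The real part of the value of a power series at a point of the annulus. -/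
def reEvalL {l : ℂ} (hl : l ∈ annulus ρ) : W ρ →L[ℝ] ℝ := Laurent.reEvalL hl ∘L toLaurent

theorem reEvalL_cons {l : ℂ} (hl : l ∈ annulus ρ) (hreal : l.im = 0) (p : ℝ) (f : W ρ) :
    reEvalL hl (cons (p, f)) = p + l.re * reEvalL hl f := by
  have re_eval (g : W ρ) : reEvalL hl g = (g.eval l).re :=
    congrArg Complex.re (eval_toLaurent hl g)
  rw [re_eval, re_eval, eval_cons p f hl.2.le, Complex.add_re, Complex.mul_re, hreal, zero_mul,
    sub_zero, Complex.ofReal_re]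

end W

section Linearisation

variable (m : ℕ)

theorem loopEq_zero (x : Param ρ) : loopEq m (0, x) =
    (W.tail x.a - x.r • (W.tail (W.tail x.b) - W.cons (x.b.coeff 0, 0)),
      W.cons (0, x.c) + (2 * x.r) • x.a - x.r ^ 2 • W.tail x.b -
        W.cons (x.b.coeff 1, W.cons (x.b.coeff 0, 0)),
      -(x.r ^ 2 • W.cons (x.b.coeff 0, 0)) - W.tail (W.tail x.b),
      W.reEvalL one_mem_annulus x.b, -W.reEvalL neg_one_mem_annulus x.b, calK x - 1) := by
  obtain ⟨entry_00, entry_01, entry_10⟩ := logEntry_zero m x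
  have real_smul (c : ℝ) (v : Laurent ρ) : Laurent.substInv (c • v) = c • Laurent.substInv v :=
    map_real_smul Laurent.substInv Laurent.substInv.continuous c v
  refine Prod.ext ?_ (Prod.ext ?_ (Prod.ext ?_ (Prod.ext ?_ (Prod.ext ?_ rfl))))
  · simp only [loopEq, unitarityDefect, entry_00, map_sub, map_smul, real_smul,
      W.posPart_toLaurent, W.posPart_T_neg_one_mul_toLaurent, W.posPart_substInv_toLaurent,
      W.posPart_substInv_T_neg_one_mul_toLaurent]
    module
  · simp only [loopEq, unitarityDefect, entry_10, entry_01, map_sub, map_add, map_smul,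
      W.nonnegPart_toLaurent, W.nonnegPart_T_one_mul_toLaurent,
      W.nonnegPart_T_neg_one_mul_toLaurent, W.nonnegPart_substInv_T_neg_one_mul_toLaurent]
  · simp only [loopEq, unitarityDefect, entry_10, entry_01, map_sub, map_add, map_smul, real_smul,
      Laurent.substInv_substInv, W.posPart_substInv_T_one_mul_toLaurent,
      W.posPart_substInv_toLaurent, W.posPart_T_neg_one_mul_toLaurent,
      W.posPart_substInv_T_neg_one_mul_toLaurent]
    module
  · change (Laurent.eval one_mem_annulus (logEntry m 0 1 0 x)).re = _
    rw [entry_01, map_mul, Laurent.eval_T, one_zpow, one_mul]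
    rfl
  · change (Laurent.eval neg_one_mem_annulus (logEntry m 0 1 0 x)).re = _
    rw [entry_01, map_mul, Laurent.eval_T, zpow_neg_one, inv_neg, inv_one, neg_one_mul,
      Complex.neg_re]
    rfl

theorem central_eq : Param.central ρ = (1, W.cons (0, W.cons (1, 0)),
    W.cons (-1 / 2, W.cons (0, W.cons (1 / 2, 0))), W.cons (-2, 0)) := by
  have ofPoly_zero : (W.ofPoly 0 : W ρ) = 0 := W.ext fun k => Polynomial.coeff_zero k
  simp only [Param.central, ← ofPoly_zero, ← W.ofPoly_C_add_X_mul]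
  refine Prod.ext rfl (Prod.ext ?_ (Prod.ext ?_ ?_))
  · simp
  · refine congrArg W.ofPoly ?_
    simp only [mul_zero, add_zero, Polynomial.C_0, zero_add]
    rw [neg_div, Polynomial.C_neg]
    ring
  · simp

theorem loopEq_central : loopEq m (0, Param.central ρ) = 0 := by
  simp only [loopEq_zero, central_eq, Param.r, Param.a, Param.b, Param.c, calK, W.tail_cons,
    W.coeff_cons_zero, W.coeff_cons_succ, W.reEvalL_cons, Complex.one_im, Complex.neg_im,
    Complex.one_re, Complex.neg_re, neg_zero, ← map_smul, ← map_add, ← map_sub, ← map_neg,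
    Prod.smul_mk, Prod.mk_add_mk, Prod.mk_sub_mk, Prod.neg_mk, map_zero, smul_zero, sub_zero]
  norm_num [W.cons_eq_zero_iff]

/-- The derivative of `loopEq` in the parameters, at time `0` and the central value. -/
def linEq : Param ρ →L[ℝ] EqSpace ρ :=
  fderiv ℝ (loopEq m) (0, Param.central ρ) ∘L .inr ℝ ℝ (Param ρ)

theorem linEq_eq_of_hasDerivAt {h : Param ρ} {d : EqSpace ρ}
    (hd : HasDerivAt (fun s : ℝ => loopEq m (0, Param.central ρ + s • h)) d 0) :
    linEq m h = d := by
  have line : HasDerivAt (fun s : ℝ => ((0 : ℝ), Param.central ρ + s • h)) (0, h) 0 := by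
    refine (hasDerivAt_const _ _).prodMk ?_
    simpa only [one_smul] using
      ((hasDerivAt_id' (0 : ℝ)).smul_const h).const_add (Param.central ρ)
  have loopEq_diff : HasFDerivAt (loopEq m) (fderiv ℝ (loopEq m) (0, Param.central ρ))
      (0, Param.central ρ) :=
    ((contDiffAt_loopEq m _).differentiableAt (by simp)).hasFDerivAt
  exact (loopEq_diff.comp_hasDerivAt_of_eq 0 line (by rw [zero_smul, add_zero])).unique hd

theorem hasDerivAt_loopEq_zero (x h : Param ρ) :
    HasDerivAt (fun s : ℝ => loopEq m (0, x + s • h))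
      (W.tail h.a - x.r • (W.tail (W.tail h.b) - W.cons (h.b.coeff 0, 0)) -
          h.r • (W.tail (W.tail x.b) - W.cons (x.b.coeff 0, 0)),
        W.cons (0, h.c) + (2 * x.r) • h.a + (2 * h.r) • x.a - x.r ^ 2 • W.tail h.b -
          (2 * x.r * h.r) • W.tail x.b - W.cons (h.b.coeff 1, W.cons (h.b.coeff 0, 0)),
        -(x.r ^ 2 • W.cons (h.b.coeff 0, 0)) - (2 * x.r * h.r) • W.cons (x.b.coeff 0, 0) -
          W.tail (W.tail h.b),
        W.reEvalL one_mem_annulus h.b, -W.reEvalL neg_one_mem_annulus h.b,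
        2 * x.a.coeff 0 * h.a.coeff 0 + h.b.coeff 0 * x.c.coeff 0 + x.b.coeff 0 * h.c.coeff 0)
      0 := by
  let y (s : ℝ) : Param ρ := x + s • h
  have y_zero : y 0 = x := by simp only [y, zero_smul, add_zero]
  have line {E : Type} [NormedAddCommGroup E] [NormedSpace ℝ E] (u v : E) :
      HasDerivAt (fun s : ℝ => u + s • v) v 0 := by
    simpa only [one_smul] using ((hasDerivAt_id' (0 : ℝ)).smul_const v).const_add u
  have comp {E F : Type} [NormedAddCommGroup E] [NormedSpace ℝ E] [NormedAddCommGroup F]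
      [NormedSpace ℝ F] (φ : E →L[ℝ] F) {u : ℝ → E} {u' : E} (hu : HasDerivAt u u' 0) :
      HasDerivAt (fun s => φ (u s)) (φ u') 0 := φ.hasFDerivAt.comp_hasDerivAt 0 hu
  have hr : HasDerivAt (fun s => (y s).r) h.r 0 := line _ _
  have r_sq : HasDerivAt (fun s => (y s).r ^ 2) (2 * x.r * h.r) 0 :=
    (hr.pow 2).congr_deriv (by rw [y_zero]; simp)
  have ha : HasDerivAt (fun s => (y s).a) h.a 0 := line _ _
  have hb : HasDerivAt (fun s => (y s).b) h.b 0 := line _ _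
  have hc : HasDerivAt (fun s => (y s).c) h.c 0 := line _ _
  have coeff_line (j : ℕ) {u : ℝ → W ρ} {u' : W ρ} (hu : HasDerivAt u u' 0) :
      HasDerivAt (fun s => (u s).coeff j) (u'.coeff j) 0 := by
    simpa only [W.coeffL_apply] using comp (W.coeffL j) hu
  have b_const := comp W.cons ((coeff_line 0 hb).prodMk (hasDerivAt_const 0 (0 : W ρ)))
  simp only [loopEq_zero]
  refine HasDerivAt.prodMk ?_ (HasDerivAt.prodMk ?_ (HasDerivAt.prodMk ?_
    ((comp _ hb).prodMk ((comp _ hb).neg.prodMk ?_))))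
  · refine ((comp W.tail ha).sub
      (hr.smul ((comp W.tail (comp W.tail hb)).sub b_const))).congr_deriv ?_
    simp only [Pi.sub_apply, y_zero]
    module
  · refine ((((comp W.cons ((hasDerivAt_const 0 (0 : ℝ)).prodMk hc)).add
      ((hr.const_mul 2).smul ha)).sub (r_sq.smul (comp W.tail hb))).sub
      (comp W.cons ((coeff_line 1 hb).prodMk b_const))).congr_deriv ?_
    rw [y_zero]
    module
  · refine ((r_sq.smul b_const).neg.sub (comp W.tail (comp W.tail hb))).congr_deriv ?_
    rw [y_zero]
    module
  · refine ((((coeff_line 0 ha).pow 2).add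
      ((coeff_line 0 hb).mul (coeff_line 0 hc))).sub_const 1).congr_deriv ?_
    rw [y_zero]
    ring

theorem linEq_cons (r a₀ a₁ b₀ b₁ b₂ c₀ : ℝ) (A B C : W ρ) :
    linEq m (r, W.cons (a₀, W.cons (a₁, A)), W.cons (b₀, W.cons (b₁, W.cons (b₂, B))),
        W.cons (c₀, C)) =
      (W.cons (a₁ + b₀ - b₂ - r, A - B),
        W.cons (2 * a₀ - 2 * b₁, W.cons (r + 2 * a₁ + c₀ - b₂ - b₀, C + (2 : ℝ) • A - B)),
        W.cons (r - b₀ - b₂, -B),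
        b₀ + b₁ + b₂ + W.reEvalL one_mem_annulus B,
        -(b₀ - b₁ + b₂ - W.reEvalL neg_one_mem_annulus B), -2 * b₀ - c₀ / 2) := by
  rw [linEq_eq_of_hasDerivAt m (hasDerivAt_loopEq_zero m _ _)]
  simp only [central_eq, Param.r, Param.a, Param.b, Param.c, W.tail_cons, W.coeff_cons_zero,
    W.coeff_cons_succ, W.reEvalL_cons, Complex.one_im, Complex.neg_im, Complex.one_re,
    Complex.neg_re, neg_zero, ← map_smul, ← map_add, ← map_sub, ← map_neg, Prod.smul_mk,
    Prod.mk_add_mk, Prod.mk_sub_mk, Prod.neg_mk]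
  refine Prod.ext (congrArg W.cons (Prod.ext ?_ ?_)) (Prod.ext (congrArg W.cons (Prod.ext ?_
    (congrArg W.cons (Prod.ext ?_ ?_)))) (Prod.ext (congrArg W.cons (Prod.ext ?_ ?_))
    (Prod.ext ?_ (Prod.ext ?_ ?_))))
  all_goals dsimp only [smul_eq_mul]
  all_goals first | module | ring

theorem linEq_injective : Function.Injective (linEq m : Param ρ → EqSpace ρ) := by
  refine (injective_iff_map_eq_zero _).mpr ?_
  rintro ⟨r, a, b, c⟩ h_zero
  obtain ⟨a₀, a', rfl⟩ := W.exists_eq_cons a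
  obtain ⟨a₁, A, rfl⟩ := W.exists_eq_cons a'
  obtain ⟨b₀, b', rfl⟩ := W.exists_eq_cons b
  obtain ⟨b₁, b'', rfl⟩ := W.exists_eq_cons b'
  obtain ⟨b₂, B, rfl⟩ := W.exists_eq_cons b''
  obtain ⟨c₀, C, rfl⟩ := W.exists_eq_cons c
  simp only [linEq_cons, Prod.mk_eq_zero, W.cons_eq_zero_iff] at h_zero ⊢
  obtain ⟨⟨f₀, f'⟩, ⟨g₀, g₁, g'⟩, ⟨n₀, n'⟩, at_one, at_neg_one, k⟩ := h_zero
  obtain rfl : B = 0 := neg_eq_zero.mp n'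
  obtain rfl : A = 0 := by rwa [sub_zero] at f'
  obtain rfl : C = 0 := by rwa [smul_zero, add_zero, sub_zero] at g'
  rw [map_zero] at at_one at_neg_one
  refine ⟨?_, ⟨?_, ?_, rfl⟩, ⟨?_, ?_, ?_, rfl⟩, ?_, rfl⟩ <;> linarith

theorem linEq_surjective : Function.Surjective (linEq m : Param ρ → EqSpace ρ) := by
  rintro ⟨f, g, n, h₁, h₂, κ⟩
  obtain ⟨f₀, F, rfl⟩ := W.exists_eq_cons f
  obtain ⟨g₀, g', rfl⟩ := W.exists_eq_cons g
  obtain ⟨g₁, G, rfl⟩ := W.exists_eq_cons g'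
  obtain ⟨n₀, N, rfl⟩ := W.exists_eq_cons n
  -- Evaluation at `±1` prescribes `b₀ + b₁ + b₂ = u` and `b₀ - b₁ + b₂ = -v`; `σ` is `b₀ + b₂`.
  let u : ℝ := h₁ + W.reEvalL one_mem_annulus N
  let v : ℝ := h₂ + W.reEvalL neg_one_mem_annulus N
  let σ : ℝ := (u - v) / 2
  let b₀ : ℝ := (3 * (n₀ + σ) + 2 * f₀ + σ - 2 * κ - g₁) / 8
  let b₁ : ℝ := (u + v) / 2
  refine ⟨(n₀ + σ, W.cons (g₀ / 2 + b₁, W.cons (f₀ + σ - 2 * b₀ + (n₀ + σ), F - N)),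
    W.cons (b₀, W.cons (b₁, W.cons (σ - b₀, -N))),
    W.cons (-2 * κ - 4 * b₀, G - (2 : ℝ) • F + N)), ?_⟩
  rw [linEq_cons, map_neg, map_neg]
  refine Prod.ext (congrArg W.cons (Prod.ext ?_ ?_)) (Prod.ext (congrArg W.cons (Prod.ext ?_
    (congrArg W.cons (Prod.ext ?_ ?_)))) (Prod.ext (congrArg W.cons (Prod.ext ?_ ?_))
    (Prod.ext ?_ (Prod.ext ?_ ?_))))
  all_goals dsimp only [u, v, σ, b₀, b₁]
  all_goals first | module | ring

theorem linEq_isInvertible : (linEq m : Param ρ →L[ℝ] EqSpace ρ).IsInvertible :=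
  ⟨ContinuousLinearEquiv.ofBijective (linEq m) (LinearMap.ker_eq_bot.mpr (linEq_injective m))
    (LinearMap.range_eq_top.mpr (linEq_surjective m)),
    ContinuousLinearEquiv.coe_ofBijective _ _ _⟩

end Linearisation

section Family

variable (m : ℕ)

theorem exists_implicit_family (hm : 1 ≤ m) : ∃ φ : ℝ → Param ρ, φ 0 = Param.central ρ ∧
    ContDiffAt ℝ ω φ 0 ∧ ∀ᶠ p : ℝ × Param ρ in 𝓝 (0, Param.central ρ),
      (SolvesMonodromyProblem m p.1 p.2 ↔ φ p.1 = p.2) := by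
  have smooth := contDiffAt_loopEq m (Param.central ρ)
  have ω_ne_zero : (ω : WithTop ℕ∞) ≠ 0 := by simp
  have invertible :
      (fderiv ℝ (loopEq m) (0, Param.central ρ) ∘L .inr ℝ ℝ (Param ρ)).IsInvertible :=
    linEq_isInvertible m
  refine ⟨smooth.implicitFunction ω_ne_zero invertible,
    smooth.implicitFunction_apply_self ω_ne_zero invertible,
    smooth.contDiffAt_implicitFunction ω_ne_zero invertible, ?_⟩
  filter_upwards [smooth.eventually_apply_eq_iff_implicitFunction ω_ne_zero invertible,
    eventually_isSmall m (Param.central ρ)] with p eq_iff small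
  rw [solvesMonodromyProblem_iff_loopEq m hm small, ← eq_iff, loopEq_central]

theorem exists_unique_solutionFamily (hm : 1 ≤ m) :
    ∃ ε > 0, ∃ U ∈ 𝓝 (Param.central ρ), ∃ x : ℝ → Param ρ,
      IsSolutionFamily m x ∧ ContDiffOn ℝ ∞ x (Set.Ioo (-ε) ε) ∧
      ∀ t ∈ Set.Ioo (-ε) ε, ∀ y : Param ρ,
        (y ∈ U ∧ SolvesMonodromyProblem m t y) ↔ y = x t := by
  obtain ⟨φ, φ_zero, φ_smooth, solves_iff⟩ := exists_implicit_family (ρ := ρ) m hm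
  rw [nhds_prod_eq] at solves_iff
  obtain ⟨p, hp, q, hq, hpq⟩ := Filter.eventually_prod_iff.mp solves_iff
  have q_φ : ∀ᶠ t in 𝓝 (0 : ℝ), q (φ t) := φ_smooth.continuousAt.eventually (by rwa [φ_zero])
  obtain ⟨ε, hε, on_ball⟩ := Metric.eventually_nhds_iff_ball.mp
    ((hp.and q_φ).and (φ_smooth.eventually (by simp)))
  rw [Real.ball_eq_Ioo, zero_sub, zero_add] at on_ball
  have solves (t : ℝ) (ht : t ∈ Set.Ioo (-ε) ε) : SolvesMonodromyProblem m t (φ t) :=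
    (hpq (on_ball t ht).1.1 (on_ball t ht).1.2).mpr rfl
  refine ⟨ε, hε, {y | q y}, hq, φ, ⟨φ_zero, φ_smooth.continuousAt, ?_⟩, fun t ht => ?_,
    fun t ht y => ⟨?_, ?_⟩⟩
  · filter_upwards [Ioo_mem_nhds (neg_lt_zero.mpr hε) hε] using solves
  · exact ((on_ball t ht).2.of_le le_top).contDiffWithinAt
  · rintro ⟨hy, y_solves⟩
    exact ((hpq (on_ball t ht).1.1 hy).mp y_solves).symm
  · rintro rfl
    exact ⟨(on_ball t ht).1.2, solves t ht⟩

theorem parity_central : (Param.central ρ).parity = Param.central ρ := by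
  rw [central_eq]
  refine Prod.ext (Param.parity_r _) (Prod.ext ((Param.parity_a _).trans ?_)
    (Prod.ext ((Param.parity_b _).trans ?_) ((Param.parity_c _).trans ?_)))
  all_goals
    simp only [Param.a, Param.b, Param.c, W.substNeg_cons, ← map_neg, Prod.neg_mk, map_zero,
      neg_zero, neg_neg]

theorem IsSolutionFamily.contDiffAt_and_eventually_parity (hm : 1 ≤ m) {x : ℝ → Param ρ}
    (hx : IsSolutionFamily m x) :
    ContDiffAt ℝ ∞ x 0 ∧ ∀ᶠ t in 𝓝 (0 : ℝ), x (-t) = (x t).parity := by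
  obtain ⟨φ, -, φ_smooth, solves_iff⟩ := exists_implicit_family (ρ := ρ) m hm
  obtain ⟨x_zero, x_cont, x_solves⟩ := hx
  have neg_tendsto : Filter.Tendsto (fun t : ℝ => -t) (𝓝 0) (𝓝 0) := by
    simpa only [neg_zero] using (continuous_neg (G := ℝ)).tendsto 0
  have x_tendsto : Filter.Tendsto x (𝓝 0) (𝓝 (Param.central ρ)) := x_zero ▸ x_cont
  have parity_tendsto :
      Filter.Tendsto (fun t => (x (-t)).parity) (𝓝 0) (𝓝 (Param.central ρ)) := by
    rw [← parity_central]
    exact (continuous_parity.tendsto _).comp (x_tendsto.comp neg_tendsto)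
  have eq_of_tendsto {y : ℝ → Param ρ} (hy : Filter.Tendsto y (𝓝 0) (𝓝 (Param.central ρ)))
      (y_solves : ∀ᶠ t in 𝓝 (0 : ℝ), SolvesMonodromyProblem m t (y t)) :
      ∀ᶠ t in 𝓝 (0 : ℝ), φ t = y t := by
    filter_upwards [(Filter.tendsto_id.prodMk_nhds hy).eventually solves_iff, y_solves]
      with t h_iff ht using h_iff.mp ht
  have φ_eq_x := eq_of_tendsto x_tendsto x_solves
  have φ_eq_parity := eq_of_tendsto parity_tendsto <| by
    filter_upwards [neg_tendsto.eventually x_solves] with t ht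
    simpa only [neg_neg] using SolvesMonodromyProblem.parity m ht
  refine ⟨(φ_smooth.of_le le_top).congr_of_eventuallyEq (φ_eq_x.mono fun t ht => ht.symm), ?_⟩
  filter_upwards [neg_tendsto.eventually φ_eq_x, neg_tendsto.eventually φ_eq_parity] with t h h'
  rw [← h, h', neg_neg]

theorem W.substNeg_iteratedDeriv_of_even {f : ℝ → W ρ} (hf : ContDiffAt ℝ ∞ f 0)
    (h : ∀ᶠ t in 𝓝 (0 : ℝ), f (-t) = -W.substNeg (f t)) {k : ℕ} (hk : Even k) :
    W.substNeg (iteratedDeriv k f 0) = -iteratedDeriv k f 0 := by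
  have comm : iteratedDeriv k (W.substNeg ∘ f) 0 = W.substNeg (iteratedDeriv k f 0) := by
    rw [iteratedDeriv_eq_iteratedFDeriv, iteratedDeriv_eq_iteratedFDeriv,
      W.substNeg.iteratedFDeriv_comp_left hf (by exact_mod_cast le_top)]
    rfl
  have h' : (fun t => f (-t)) =ᶠ[𝓝 0] fun t => -(W.substNeg ∘ f) t := h
  have deriv_eq := h'.iteratedDeriv_eq k
  rw [iteratedDeriv_comp_neg, iteratedDeriv_fun_neg, comm, hk.neg_one_pow, one_smul, neg_zero]
    at deriv_eq
  exact (neg_eq_iff_eq_neg.mpr deriv_eq).symm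

theorem W.eval_iteratedDeriv_neg_of_even {f : ℝ → W ρ} (hf : ContDiffAt ℝ ∞ f 0)
    (h : ∀ᶠ t in 𝓝 (0 : ℝ), f (-t) = -W.substNeg (f t)) {k : ℕ} (hk : Even k) (l : ℂ) :
    (iteratedDeriv k f 0).eval (-l) = -(iteratedDeriv k f 0).eval l := by
  rw [← W.eval_substNeg, W.substNeg_iteratedDeriv_of_even hf h hk, W.eval_neg]

end Family

end

end DPW

theorem mainTheorem10 (m : ℕ) (hm : 1 ≤ m) (ρ : ℝ) [Fact (1 < ρ)] :
    -- the family exists, is smooth and is unique in a neighbourhood of the central value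
    (∃ ε > 0, ∃ U ∈ 𝓝 (Param.central ρ), ∃ x : ℝ → Param ρ,
      IsSolutionFamily m x ∧ ContDiffOn ℝ ∞ x (Set.Ioo (-ε) ε) ∧
      ∀ t ∈ Set.Ioo (-ε) ε, ∀ y : Param ρ,
        (y ∈ U ∧ SolvesMonodromyProblem m t y) ↔ y = x t) ∧
    -- time parity of the potential and of the parameters, and of the derivatives of `a`
    (∀ x : ℝ → Param ρ, IsSolutionFamily m x →
      (∀ᶠ t in 𝓝 (0 : ℝ), PotentialParity m t (x t) (x (-t))) ∧
      (∀ᶠ t in 𝓝 (0 : ℝ), ParamParity (x t) (x (-t))) ∧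
      ContDiffAt ℝ ∞ x 0 ∧
      ∀ k : ℕ, Even k →
        (∀ l : ℂ, ‖l‖ < ρ →
          (iteratedDeriv k (fun t => Param.a (x t)) 0).eval (-l) =
            -(iteratedDeriv k (fun t => Param.a (x t)) 0).eval l) ∧
        (iteratedDeriv k (fun t => Param.a (x t)) 0).eval 0 = 0) ∧
    -- the two forms of the parity are equivalent
    (∀ t : ℝ, t ≠ 0 → ∀ x y : Param ρ, PotentialParity m t x y ↔ ParamParity x y) := by
  refine ⟨exists_unique_solutionFamily m hm, fun x hx => ?_, fun t ht x y =>
    ⟨fun h => paramParity_iff.mpr (h.eq_parity m hm ht),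
      fun h => paramParity_iff.mp h ▸ potentialParity_parity m t x⟩⟩
  obtain ⟨smooth, parity⟩ := hx.contDiffAt_and_eventually_parity m hm
  refine ⟨?_, ?_, smooth, fun k hk => ?_⟩
  · filter_upwards [parity] with t ht
    exact ht ▸ potentialParity_parity m t (x t)
  · filter_upwards [parity] with t ht using paramParity_iff.mpr ht
  · have a_parity : ∀ᶠ t in 𝓝 (0 : ℝ), (x (-t)).a = -W.substNeg (x t).a := by
      filter_upwards [parity] with t ht
      rw [ht, Param.parity_a]
    have odd := W.eval_iteratedDeriv_neg_of_even (f := fun t => (x t).a) smooth.snd.fst a_parity hk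
    refine ⟨fun l _ => odd l, self_eq_neg.mp ?_⟩
    simpa only [neg_zero] using odd 0
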